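/- Let $\mathcal I$ be a finite set, $R=\mathbb C\{e_\alpha\mid\alpha\in\mathcal I\}$ the ring spanned by pairwise orthogonal idempotents with $\sum_\alpha e_\alpha=1$, $M$ a finite-dimensional $R$-bimodule (with $\mathbb C$ acting in the same way on both sides), $W\subset M\otimes_R M$ a sub-bimodule, and $A=T_R(M)/\langle W\rangle$ the associated quadratic algebra, graded with $M$ in degree one. Assume that $A$ is Koszul, i.e. that each simple right module $L_\alpha=A/(A_+\oplus\mathbb C\{e_\beta\mid\beta\neq\alpha\})$ has a graded projective resolution $\cdots\to P_1\to P_0\to L_\alpha\to 0$ in which $P_i$ is generated in degree $i$. Let $M^*=\operatorname{Hom}_{\mathbb C}(M,\mathbb C)$, with the bimodule structure for which $e_\alpha M^*e_\beta=(e_\beta Me_\alpha)^*$, let $A^!=T_R(M^*)/\langle W^\perp\rangle$ be the quadratic dual, and let $Z(A^!)_2$ be the degree-two part of its center. Since $A^!_2=(M^*\otimes_RM^*)/W^\perp$, there is a canonical isomorphism $W\cong(A^!_2)^*$; let $q\colon W\cong(A^!_2)^*\to Z(A^!)_2^*$ be its composition with the restriction map. For a finite-dimensional complex vector space $U$, let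 $S=\operatorname{Sym}U$ with $U$ in degree two. A graded deformation of $A$ over $U^*$ is an $\mathbb N$-graded $R$-algebra $\tilde A$ (over $\mathbb C$) with graded $\mathbb C$-algebra homomorphisms $S\xrightarrow{j}\tilde A\xrightarrow{\pi}A$ such that $j(S)$ is central, $\pi$ is a homomorphism of $R$-algebras, and $\pi$ induces an isomorphism $\tilde A/\langle j(U)\rangle\cong A$ of graded algebras. It is flat if $\tilde A$ is a flat $S$-module. For a bimodule map $\Psi\colon W\to R\otimes_{\mathbb C}U$ put $$\tilde A_\Psi=T_R(M)\otimes_{\mathbb C}S\,\big/\,\langle w\otimes1-1\otimes\Psi(w)\mid w\in W\rangle ,$$ and let $\Psi^\circ\colon W\to U$ be the linear map that kills $e_\alpha We_\beta$ for $\alpha\ne\beta$ and satisfies $\Psi(w)=e_\alpha\otimes\Psi^\circ(w)$ for $w\in e_\alpha We_\alpha$. (1) For every finite-dimensional $U$ and every bimodule map $\Psi\colon W\to R\otimes_{\mathbb C} U$, the algebra $\tilde A_\Psi$ is a graded deformation of $A$ over $U^*$, and it is flat if and only if $\Psi^\circ$ factors through $q$, i.e. $\Psi^\circ=\psi\circ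 q$ for some linear map $\psi\colon Z(A^!)_2^*\to U$. (2) There is a bimodule map $\Omega\colon W\to R\otimes_{\mathbb C} Z(A^!)_2^*$ with $\Omega^\circ=q$, and $\tilde A:=\tilde A_\Omega$ is a flat graded deformation of $A$, with base ring $\operatorname{Sym}(Z(A^!)_2^*)$, that is universal in the following sense. Let $U$ be any finite-dimensional complex vector space. (a) For every linear map $\psi\colon Z(A^!)_2^*\to U$ there is a bimodule map $\Psi\colon W\to R\otimes_{\mathbb C} U$ with $\Psi^\circ=\psi\circ q$; the graded deformation $\tilde A_\Psi$ is flat and is isomorphic to the base change $\operatorname{Sym}U\otimes_{\operatorname{Sym}(Z(A^!)_2^*)}\tilde A$ along the homomorphism induced by $\psi$. (b) For every flat graded deformation $\tilde B$ of $A$ over $U^*$ there is exactly one linear map $\psi\colon Z(A^!)_2^*\to U$ such that $\tilde B$ is isomorphic, as a graded deformation of $A$ over $U^*$ (that is, compatibly with the gradings, with the maps from $R$ and from $\operatorname{Sym}U$, and with the projections to $A$), to the base change of $\tilde A$ along the homomorphism $\operatorname{Sym}(Z(A^!)_2^*)\to\operatorname{Sym}U$ induced by $\psi$. -/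

import Mathlib

open scoped TensorProduct
open MulOpposite (op)

set_option linter.unusedSectionVars false

noncomputable section

namespace QuadKoszul

universe u v w x

/-! ### Bimodules over `R = ℂ^I` and their tensor product over `R`

`R = I → ℂ` is spanned by the orthogonal idempotents `e a = Pi.single a 1`.  An `R`-bimodule is a
module over `R` and over `Rᵐᵒᵖ` with commuting actions that both extend the same action of `ℂ`;
`r • m` is the left action and `op r • m` is the right action `m r`. -/

/-- The idempotent `e a` of `R = I → ℂ`. -/
abbrev e {I : Type u} [DecidableEq I] (a : I) : I → ℂ := Pi.single a 1

section Bimodules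

variable (I : Type u)
variable (M : Type v) [AddCommGroup M] [Module ℂ M] [Module (I → ℂ) M] [Module (I → ℂ)ᵐᵒᵖ M]
  [SMulCommClass (I → ℂ) (I → ℂ)ᵐᵒᵖ M] [IsScalarTower ℂ (I → ℂ) M]
  [IsScalarTower ℂ (I → ℂ)ᵐᵒᵖ M]

/-- The subspace of `M ⊗[ℂ] M` spanned by all `m r ⊗ n - m ⊗ r n`. -/
def balancing : Submodule ℂ (M ⊗[ℂ] M) :=
  Submodule.span ℂ {t | ∃ (m n : M) (r : I → ℂ), t = (op r • m) ⊗ₜ[ℂ] n - m ⊗ₜ[ℂ] (r • n)}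

/-- The tensor product `M ⊗_R M` of bimodules. -/
abbrev Tens : Type v := (M ⊗[ℂ] M) ⧸ balancing I M

variable {M}

/-- The element `m ⊗ n` of `M ⊗_R M`. -/
def tmul (m n : M) : Tens I M := (balancing I M).mkQ (m ⊗ₜ[ℂ] n)

theorem tmul_balanced (m n : M) (r : I → ℂ) : tmul I (op r • m) n = tmul I m (r • n) := by
  unfold tmul
  rw [← sub_eq_zero, ← map_sub]
  exact (Submodule.Quotient.mk_eq_zero _).2 (Submodule.subset_span ⟨m, n, r, rfl⟩)

/-- Universal property of `M ⊗_R M`. -/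
def tensLift {P : Type*} [AddCommGroup P] [Module ℂ P] (B : M →ₗ[ℂ] M →ₗ[ℂ] P)
    (h : ∀ m n (r : I → ℂ), B (op r • m) n = B m (r • n)) : Tens I M →ₗ[ℂ] P :=
  (balancing I M).liftQ (TensorProduct.lift B) (by
    unfold balancing
    rw [Submodule.span_le]
    rintro _ ⟨m, n, r, rfl⟩
    simp [h])

@[simp] theorem tensLift_tmul {P : Type*} [AddCommGroup P] [Module ℂ P] (B : M →ₗ[ℂ] M →ₗ[ℂ] P)
    (h : ∀ m n (r : I → ℂ), B (op r • m) n = B m (r • n)) (m n : M) :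
    tensLift I B h (tmul I m n) = B m n := by
  simp [tensLift, tmul]

theorem tens_induction {p : Tens I M → Prop} (h0 : p 0) (ht : ∀ m n, p (tmul I m n))
    (ha : ∀ s t, p s → p t → p (s + t)) (t : Tens I M) : p t := by
  obtain ⟨t, rfl⟩ := Submodule.mkQ_surjective _ t
  induction t using TensorProduct.induction_on with
  | zero => simpa using h0
  | tmul m n => exact ht m n
  | add s t hs ht => simpa using ha _ _ hs ht

/-- Left multiplication by `r` on a bimodule. -/
def lAct (r : I → ℂ) : M →ₗ[ℂ] M where
  toFun m := r • m
  map_add' := smul_add r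
  map_smul' c m := smul_comm r c m

/-- Right multiplication by `r` on a bimodule. -/
def rAct (r : I → ℂ) : M →ₗ[ℂ] M where
  toFun m := op r • m
  map_add' := smul_add (op r)
  map_smul' c m := smul_comm (op r) c m

/-- `m ⊗ n` as a bilinear map. -/
def tmulBil : M →ₗ[ℂ] M →ₗ[ℂ] Tens I M :=
  (TensorProduct.mk ℂ M M).compr₂ (balancing I M).mkQ

@[simp] theorem tmulBil_apply (m n : M) : tmulBil I m n = tmul I m n := rfl

/-- The left action `r (m ⊗ n) = r m ⊗ n` on `M ⊗_R M`. -/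
def tensL (r : I → ℂ) : Tens I M →ₗ[ℂ] Tens I M :=
  tensLift I ((tmulBil I).comp (lAct I r)) (by
    intro m n s
    simp only [LinearMap.comp_apply, lAct, LinearMap.coe_mk, AddHom.coe_mk, tmulBil_apply]
    rw [smul_comm, tmul_balanced])

/-- The right action `(m ⊗ n) r = m ⊗ n r` on `M ⊗_R M`. -/
def tensR (r : I → ℂ) : Tens I M →ₗ[ℂ] Tens I M :=
  tensLift I ((tmulBil I).compl₂ (rAct I r)) (by
    intro m n s
    simp only [LinearMap.compl₂_apply, rAct, LinearMap.coe_mk, AddHom.coe_mk, tmulBil_apply]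
    rw [tmul_balanced, smul_comm])

@[simp] theorem tensL_tmul (r : I → ℂ) (m n : M) : tensL I r (tmul I m n) = tmul I (r • m) n := by
  simp [tensL, lAct]

@[simp] theorem tensR_tmul (r : I → ℂ) (m n : M) :
    tensR I r (tmul I m n) = tmul I m (op r • n) := by
  simp [tensR, rAct]

variable (M)

/-- A sub-bimodule of `M ⊗_R M`: the quadratic relations of a quadratic algebra. -/
structure Relations extends Submodule ℂ (Tens I M) where
  left_mem : ∀ (r : I → ℂ) {t}, t ∈ toSubmodule → tensL I r t ∈ toSubmodule
  right_mem : ∀ (r : I → ℂ) {t}, t ∈ toSubmodule → tensR I r t ∈ toSubmodule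

/-! ### The tensor algebra `T_R(M)` -/

/-- The relations presenting `T_R(M)`: the universal `ℂ`-algebra with an algebra map from `R` and a
bimodule map from `M`. -/
inductive TensorRel : TensorAlgebra ℂ ((I → ℂ) × M) → TensorAlgebra ℂ ((I → ℂ) × M) → Prop
  | one : TensorRel (TensorAlgebra.ι ℂ (1, 0)) 1
  | mul (r s : I → ℂ) : TensorRel (TensorAlgebra.ι ℂ (r * s, 0))
      (TensorAlgebra.ι ℂ (r, 0) * TensorAlgebra.ι ℂ (s, 0))
  | left (r : I → ℂ) (m : M) : TensorRel (TensorAlgebra.ι ℂ (0, r • m))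
      (TensorAlgebra.ι ℂ (r, 0) * TensorAlgebra.ι ℂ (0, m))
  | right (r : I → ℂ) (m : M) : TensorRel (TensorAlgebra.ι ℂ (0, op r • m))
      (TensorAlgebra.ι ℂ (0, m) * TensorAlgebra.ι ℂ (r, 0))

/-- The tensor algebra `T_R(M)` of the bimodule `M`. -/
def TensAlg : Type (max u v) := RingQuot (TensorRel I M)

instance : Ring (TensAlg I M) := inferInstanceAs (Ring (RingQuot (TensorRel I M)))
instance : Algebra ℂ (TensAlg I M) := inferInstanceAs (Algebra ℂ (RingQuot (TensorRel I M)))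

/-- The quotient map from the tensor algebra over `ℂ` onto `T_R(M)`. -/
def TensAlg.mk : TensorAlgebra ℂ ((I → ℂ) × M) →ₐ[ℂ] TensAlg I M :=
  RingQuot.mkAlgHom ℂ (TensorRel I M)

variable {I M} in
theorem TensAlg.mk_rel {x y : TensorAlgebra ℂ ((I → ℂ) × M)} (h : TensorRel I M x y) :
    TensAlg.mk I M x = TensAlg.mk I M y := RingQuot.mkAlgHom_rel ℂ h

/-- The canonical map `R → T_R(M)`. -/
def TensAlg.ofR : (I → ℂ) →ₐ[ℂ] TensAlg I M :=
  AlgHom.ofLinearMap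
    ((TensAlg.mk I M).toLinearMap ∘ₗ TensorAlgebra.ι ℂ ∘ₗ
      LinearMap.inl ℂ (I → ℂ) M)
    (by simpa using TensAlg.mk_rel (TensorRel.one (I := I) (M := M)))
    (fun r s => by simpa using TensAlg.mk_rel (TensorRel.mul (M := M) r s))

/-- The canonical map `M → T_R(M)`. -/
def TensAlg.ofM : M →ₗ[ℂ] TensAlg I M :=
  (TensAlg.mk I M).toLinearMap ∘ₗ TensorAlgebra.ι ℂ ∘ₗ
    LinearMap.inr ℂ (I → ℂ) M

variable {I M}

theorem TensAlg.ofM_left (r : I → ℂ) (m : M) :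
    TensAlg.ofM I M (r • m) = TensAlg.ofR I M r * TensAlg.ofM I M m := by
  simpa [TensAlg.ofM, TensAlg.ofR] using TensAlg.mk_rel (TensorRel.left r m)

theorem TensAlg.ofM_right (r : I → ℂ) (m : M) :
    TensAlg.ofM I M (op r • m) = TensAlg.ofM I M m * TensAlg.ofR I M r := by
  simpa [TensAlg.ofM, TensAlg.ofR] using TensAlg.mk_rel (TensorRel.right r m)

variable (I M)

/-- The multiplication map `M ⊗_R M → T_R(M)`. -/
def TensAlg.ofTens : Tens I M →ₗ[ℂ] TensAlg I M :=
  tensLift I ((LinearMap.mul ℂ (TensAlg I M)).compl₁₂ (TensAlg.ofM I M) (TensAlg.ofM I M)) (by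
    intro m n r
    simp [TensAlg.ofM_left, TensAlg.ofM_right, mul_assoc])

@[simp] theorem TensAlg.ofTens_tmul (m n : M) :
    TensAlg.ofTens I M (tmul I m n) = TensAlg.ofM I M m * TensAlg.ofM I M n := by
  simp [TensAlg.ofTens]

variable {I M}

/-- Universal property of `T_R(M)`. -/
def TensAlg.lift {B : Type*} [Ring B] [Algebra ℂ B] (f : (I → ℂ) →ₐ[ℂ] B) (g : M →ₗ[ℂ] B)
    (hl : ∀ (r : I → ℂ) m, g (r • m) = f r * g m)
    (hr : ∀ (r : I → ℂ) m, g (op r • m) = g m * f r) : TensAlg I M →ₐ[ℂ] B :=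
  RingQuot.liftAlgHom ℂ ⟨TensorAlgebra.lift ℂ (f.toLinearMap.coprod g), by
    rintro _ _ (_ | ⟨r, s⟩ | ⟨r, m⟩ | ⟨r, m⟩) <;> simp [hl, hr]⟩

@[simp] theorem TensAlg.lift_ofR {B : Type*} [Ring B] [Algebra ℂ B] (f : (I → ℂ) →ₐ[ℂ] B)
    (g : M →ₗ[ℂ] B) (hl : ∀ (r : I → ℂ) m, g (r • m) = f r * g m)
    (hr : ∀ (r : I → ℂ) m, g (op r • m) = g m * f r) (r : I → ℂ) :
    TensAlg.lift f g hl hr (TensAlg.ofR I M r) = f r := by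
  have h : TensAlg.lift f g hl hr (TensAlg.mk I M (TensorAlgebra.ι ℂ (r, 0))) =
      TensorAlgebra.lift ℂ (f.toLinearMap.coprod g) (TensorAlgebra.ι ℂ (r, 0)) :=
    RingQuot.liftAlgHom_mkAlgHom_apply ℂ _ _ _
  exact h.trans (by simp)

@[simp] theorem TensAlg.lift_ofM {B : Type*} [Ring B] [Algebra ℂ B] (f : (I → ℂ) →ₐ[ℂ] B)
    (g : M →ₗ[ℂ] B) (hl : ∀ (r : I → ℂ) m, g (r • m) = f r * g m)
    (hr : ∀ (r : I → ℂ) m, g (op r • m) = g m * f r) (m : M) :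
    TensAlg.lift f g hl hr (TensAlg.ofM I M m) = g m := by
  have h : TensAlg.lift f g hl hr (TensAlg.mk I M (TensorAlgebra.ι ℂ (0, m))) =
      TensorAlgebra.lift ℂ (f.toLinearMap.coprod g) (TensorAlgebra.ι ℂ (0, m)) :=
    RingQuot.liftAlgHom_mkAlgHom_apply ℂ _ _ _
  exact h.trans (by simp)

/-! ### Quadratic algebras -/

variable (W : Relations I M)

/-- The relations `t = 0`, for `t ∈ W`, of the quadratic algebra. -/
def QuadRel (x y : TensAlg I M) : Prop := ∃ t ∈ W.toSubmodule, x = TensAlg.ofTens I M t ∧ y = 0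

/-- The quadratic algebra `A = T_R(M) / ⟨W⟩`. -/
def QuadAlg : Type (max u v) := RingQuot (QuadRel W)

instance : Ring (QuadAlg W) := inferInstanceAs (Ring (RingQuot (QuadRel W)))
instance : Algebra ℂ (QuadAlg W) := inferInstanceAs (Algebra ℂ (RingQuot (QuadRel W)))

/-- The quotient map `T_R(M) → A`. -/
def QuadAlg.mk : TensAlg I M →ₐ[ℂ] QuadAlg W := RingQuot.mkAlgHom ℂ (QuadRel W)

/-- The canonical map `R → A`. -/
def QuadAlg.ofR : (I → ℂ) →ₐ[ℂ] QuadAlg W := (QuadAlg.mk W).comp (TensAlg.ofR I M)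

/-- The canonical map `M → A`. -/
def QuadAlg.ofM : M →ₗ[ℂ] QuadAlg W := (QuadAlg.mk W).toLinearMap ∘ₗ TensAlg.ofM I M

/-- The degree `n` part of `A`, spanned by the products `r m₁ ⋯ mₙ`. -/
def QuadAlg.gr (n : ℕ) : Submodule ℂ (QuadAlg W) :=
  LinearMap.range (QuadAlg.ofR W).toLinearMap * LinearMap.range (QuadAlg.ofM W) ^ n

theorem QuadAlg.mk_ofTens {t : Tens I M} (ht : t ∈ W.toSubmodule) :
    QuadAlg.mk W (TensAlg.ofTens I M t) = 0 := by
  have h : QuadAlg.mk W (TensAlg.ofTens I M t) = QuadAlg.mk W 0 :=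
    RingQuot.mkAlgHom_rel ℂ (s := QuadRel W) ⟨t, ht, rfl, rfl⟩
  rw [h, map_zero]

/-- The multiplication map `M ⊗_R M → A`. -/
def QuadAlg.ofTens : Tens I M →ₗ[ℂ] QuadAlg W := (QuadAlg.mk W).toLinearMap ∘ₗ TensAlg.ofTens I M

/-- The map `(M ⊗_R M) / W → A`. -/
def QuadAlg.ofQuot : (Tens I M ⧸ W.toSubmodule) →ₗ[ℂ] QuadAlg W :=
  W.toSubmodule.liftQ (QuadAlg.ofTens W) (fun _ ht => LinearMap.mem_ker.2 (QuadAlg.mk_ofTens W ht))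

@[simp] theorem QuadAlg.ofQuot_mk (t : Tens I M) :
    QuadAlg.ofQuot W (W.toSubmodule.mkQ t) = QuadAlg.mk W (TensAlg.ofTens I M t) :=
  rfl

/-! The next few facts identify the degree two part of `A` with `(M ⊗_R M) / W`, by letting `A` act
on `R × M × (M ⊗_R M) / W`. -/

theorem tmul_add_left (m m' n : M) : tmul I (m + m') n = tmul I m n + tmul I m' n := by
  simp [← tmulBil_apply]

theorem tmul_add_right (m n n' : M) : tmul I m (n + n') = tmul I m n + tmul I m n' := by
  simp [← tmulBil_apply]

theorem tmul_smul_left (c : ℂ) (m n : M) : tmul I (c • m) n = c • tmul I m n := by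
  simp [← tmulBil_apply]

theorem tmul_smul_right (c : ℂ) (m n : M) : tmul I m (c • n) = c • tmul I m n := by
  simp [← tmulBil_apply]

/-- The left action of `R` on `M ⊗_R M`, linear in `R`. -/
theorem tensL_mul (r s : I → ℂ) (t : Tens I M) : tensL I (r * s) t = tensL I r (tensL I s t) := by
  induction t using tens_induction with
  | h0 => simp
  | ht m n => simp [mul_smul]
  | ha s t hs ht => simp [hs, ht]

theorem tensL_add (r s : I → ℂ) (t : Tens I M) :
    tensL I (r + s) t = tensL I r t + tensL I s t := by
  induction t using tens_induction with
  | h0 => simp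
  | ht m n => simp [add_smul, tmul_add_left]
  | ha s t hs ht => simp only [map_add, hs, ht]; abel

theorem tensL_smul (c : ℂ) (r : I → ℂ) (t : Tens I M) :
    tensL I (c • r) t = c • tensL I r t := by
  induction t using tens_induction with
  | h0 => simp
  | ht m n => simp [tmul_smul_left]
  | ha s t hs ht => simp only [map_add, hs, ht, smul_add]

theorem tensL_one (t : Tens I M) : tensL I (1 : I → ℂ) t = t := by
  induction t using tens_induction with
  | h0 => simp
  | ht m n => simp
  | ha s t hs ht => simp only [map_add, hs, ht]

/-- The module `R × M × (M ⊗_R M) / W`. -/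
abbrev Trunc : Type (max u v) := (I → ℂ) × M × (Tens I M ⧸ W.toSubmodule)

/-- The left action of `R` on `(M ⊗_R M) / W`. -/
def quotL (r : I → ℂ) : (Tens I M ⧸ W.toSubmodule) →ₗ[ℂ] (Tens I M ⧸ W.toSubmodule) :=
  W.toSubmodule.mapQ W.toSubmodule (tensL I r) (fun _ ht => W.left_mem r ht)

@[simp] theorem quotL_mk (r : I → ℂ) (t : Tens I M) :
    quotL W r (W.toSubmodule.mkQ t) = W.toSubmodule.mkQ (tensL I r t) := rfl

/-- The left action of `R` on `R × M × (M ⊗_R M) / W`. -/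
def truncR : (I → ℂ) →ₐ[ℂ] Module.End ℂ (Trunc W) :=
  AlgHom.ofLinearMap
    { toFun := fun r => (LinearMap.mulLeft ℂ r).prodMap ((lAct I r).prodMap (quotL W r))
      map_add' := by
        intro r s
        refine LinearMap.ext fun ⟨x, m, t⟩ => ?_
        obtain ⟨t, rfl⟩ := Submodule.mkQ_surjective _ t
        simp only [LinearMap.prodMap_apply, LinearMap.add_apply, quotL_mk, tensL_add, map_add,
          LinearMap.mulLeft_apply, lAct, LinearMap.coe_mk, AddHom.coe_mk, add_smul, add_mul,
          Prod.mk_add_mk]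
      map_smul' := by
        intro c r
        refine LinearMap.ext fun ⟨x, m, t⟩ => ?_
        obtain ⟨t, rfl⟩ := Submodule.mkQ_surjective _ t
        simp only [LinearMap.prodMap_apply, LinearMap.smul_apply, quotL_mk, tensL_smul, map_smul,
          LinearMap.mulLeft_apply, lAct, LinearMap.coe_mk, AddHom.coe_mk, smul_assoc,
          smul_mul_assoc, Prod.smul_mk, RingHom.id_apply] }
    (by
      refine LinearMap.ext fun ⟨x, m, t⟩ => ?_
      obtain ⟨t, rfl⟩ := Submodule.mkQ_surjective _ t
      simp only [LinearMap.prodMap_apply, quotL_mk, tensL_one, LinearMap.coe_mk, AddHom.coe_mk,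
          LinearMap.mulLeft_apply, lAct, one_smul, one_mul, Module.End.one_apply])
    (by
      intro r s
      refine LinearMap.ext fun ⟨x, m, t⟩ => ?_
      obtain ⟨t, rfl⟩ := Submodule.mkQ_surjective _ t
      simp only [LinearMap.prodMap_apply, quotL_mk, tensL_mul, LinearMap.coe_mk, AddHom.coe_mk,
          LinearMap.mulLeft_apply, lAct, mul_smul, mul_assoc, Module.End.mul_apply])

theorem truncR_apply (r x : I → ℂ) (m : M) (t : Tens I M) :
    truncR W r (x, m, W.toSubmodule.mkQ t) = (r * x, r • m, W.toSubmodule.mkQ (tensL I r t)) :=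
  rfl

/-- The left action of `M` on `R × M × (M ⊗_R M) / W`: `m (x, n, t) = (0, m x, m ⊗ n)`. -/
def truncM : M →ₗ[ℂ] Module.End ℂ (Trunc W) where
  toFun m :=
    { toFun := fun p => (0, op p.1 • m, W.toSubmodule.mkQ (tmul I m p.2.1))
      map_add' := by
        intro p q
        simp only [Prod.fst_add, Prod.snd_add, MulOpposite.op_add, add_smul, tmul_add_right,
          map_add, Prod.mk_add_mk, add_zero]
      map_smul' := by
        intro c p
        simp only [Prod.smul_fst, Prod.smul_snd, MulOpposite.op_smul, smul_assoc,
          tmul_smul_right, map_smul, Prod.smul_mk, smul_zero, RingHom.id_apply] }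
  map_add' m n := by
    refine LinearMap.ext fun p => ?_
    simp only [LinearMap.coe_mk, AddHom.coe_mk, LinearMap.add_apply, smul_add, tmul_add_left,
      map_add, Prod.mk_add_mk, add_zero]
  map_smul' c m := by
    refine LinearMap.ext fun p => ?_
    simp only [LinearMap.coe_mk, AddHom.coe_mk, LinearMap.smul_apply, tmul_smul_left,
      map_smul, Prod.smul_mk, smul_zero, RingHom.id_apply]
    rw [smul_comm]

theorem truncM_apply (m : M) (p : Trunc W) :
    truncM W m p = (0, op p.1 • m, W.toSubmodule.mkQ (tmul I m p.2.1)) := rfl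

/-- The left action of `T_R(M)` on `R × M × (M ⊗_R M) / W`. -/
def truncT : TensAlg I M →ₐ[ℂ] Module.End ℂ (Trunc W) :=
  TensAlg.lift (truncR W) (truncM W)
    (by
      intro r m
      refine LinearMap.ext fun ⟨x, n, t⟩ => ?_
      rw [Module.End.mul_apply, truncM_apply, truncM_apply, truncR_apply, mul_zero, tensL_tmul,
        smul_comm r (op x) m])
    (by
      intro r m
      refine LinearMap.ext fun ⟨x, n, t⟩ => ?_
      obtain ⟨t, rfl⟩ := Submodule.mkQ_surjective _ t
      rw [Module.End.mul_apply, truncR_apply, truncM_apply, truncM_apply, tmul_balanced,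
        smul_smul, ← MulOpposite.op_mul])

theorem truncT_ofTens (t : Tens I M) (p : Trunc W) :
    truncT W (TensAlg.ofTens I M t) p = (0, 0, W.toSubmodule.mkQ (tensR I p.1 t)) := by
  induction t using tens_induction with
  | h0 => simp only [map_zero, LinearMap.zero_apply]; rfl
  | ht m n =>
    rw [TensAlg.ofTens_tmul, map_mul, Module.End.mul_apply, truncT, TensAlg.lift_ofM,
      TensAlg.lift_ofM, truncM_apply, truncM_apply, tensR_tmul, MulOpposite.op_zero, zero_smul]
  | ha s t hs ht =>
    simp only [map_add, LinearMap.add_apply, hs, ht, Prod.mk_add_mk, add_zero]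

/-- The left action of `A` on `R × M × (M ⊗_R M) / W`. -/
def truncA : QuadAlg W →ₐ[ℂ] Module.End ℂ (Trunc W) :=
  RingQuot.liftAlgHom ℂ ⟨truncT W, by
    rintro _ _ ⟨t, ht, rfl, rfl⟩
    refine LinearMap.ext fun p => ?_
    rw [truncT_ofTens, map_zero, LinearMap.zero_apply, Prod.mk_eq_zero, Prod.mk_eq_zero]
    exact ⟨rfl, rfl, (Submodule.Quotient.mk_eq_zero _).2 (W.right_mem _ ht)⟩⟩

theorem tensR_one (t : Tens I M) : tensR I (1 : I → ℂ) t = t := by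
  induction t using tens_induction with
  | h0 => simp
  | ht m n => simp
  | ha s t hs ht => simp only [map_add, hs, ht]

theorem QuadAlg.ofQuot_injective : Function.Injective (QuadAlg.ofQuot W) := by
  rw [injective_iff_map_eq_zero]
  intro t ht
  obtain ⟨t, rfl⟩ := Submodule.mkQ_surjective _ t
  rw [QuadAlg.ofQuot_mk] at ht
  have h : truncA W (QuadAlg.mk W (TensAlg.ofTens I M t)) = truncT W (TensAlg.ofTens I M t) :=
    RingQuot.liftAlgHom_mkAlgHom_apply ℂ _ _ _
  rw [ht, map_zero] at h
  have h' := congrArg (fun f => (f (1, 0, 0)).2.2) h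
  simp only [truncT_ofTens, tensR_one, LinearMap.zero_apply] at h'
  exact h'.symm

theorem QuadAlg.range_ofQuot : LinearMap.range (QuadAlg.ofQuot W) = QuadAlg.gr W 2 := by
  apply le_antisymm
  · rintro _ ⟨t, rfl⟩
    obtain ⟨t, rfl⟩ := Submodule.mkQ_surjective _ t
    rw [QuadAlg.ofQuot_mk]
    induction t using tens_induction with
    | h0 => simp
    | ht m n =>
      have h := Submodule.mul_mem_mul
        (LinearMap.mem_range_self (QuadAlg.ofR W).toLinearMap 1)
        (Submodule.mul_mem_mul (LinearMap.mem_range_self (QuadAlg.ofM W) m)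
          (LinearMap.mem_range_self (QuadAlg.ofM W) n))
      rw [← sq] at h
      simpa [QuadAlg.gr, QuadAlg.ofM] using h
    | ha s t hs ht => simpa using add_mem hs ht
  · rw [QuadAlg.gr, Submodule.mul_le]
    rintro _ ⟨r, rfl⟩ y hy
    rw [sq] at hy
    induction hy using Submodule.mul_induction_on' with
    | mem_mul_mem y hy z hz =>
      obtain ⟨m, rfl⟩ := hy
      obtain ⟨n, rfl⟩ := hz
      refine ⟨W.toSubmodule.mkQ (tmul I (r • m) n), ?_⟩
      rw [QuadAlg.ofQuot_mk]
      simp [QuadAlg.ofR, QuadAlg.ofM, TensAlg.ofM_left, mul_assoc]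
    | add y _ z _ hy hz => rw [mul_add]; exact add_mem hy hz

/-- The degree two part of `A` is `(M ⊗_R M) / W`. -/
def QuadAlg.degTwo : (Tens I M ⧸ W.toSubmodule) ≃ₗ[ℂ] QuadAlg.gr W 2 :=
  (LinearEquiv.ofInjective (QuadAlg.ofQuot W) (QuadAlg.ofQuot_injective W)).trans
    (LinearEquiv.ofEq _ _ (QuadAlg.range_ofQuot W))

/-! ### Koszul algebras -/

/-- The right ideal `A₊ ⊕ ℂ{e b | b ≠ a}` of `A`. -/
def simpleIdeal [DecidableEq I] (a : I) : Submodule (QuadAlg W)ᵐᵒᵖ (QuadAlg W) :=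
  Submodule.span (QuadAlg W)ᵐᵒᵖ
    ({x | ∃ n, 1 ≤ n ∧ x ∈ QuadAlg.gr W n} ∪ {x | ∃ b, b ≠ a ∧ x = QuadAlg.ofR W (e b)})

/-- The simple right `A`-module `L a`. -/
abbrev Simple [DecidableEq I] (a : I) : Type (max u v) := QuadAlg W ⧸ simpleIdeal W a

/-- A linear projective resolution `⋯ → P 1 → P 0 → L a → 0` of the right module `L a`: an exact
complex of graded projective right `A`-modules, with homogeneous maps of degree zero, such that
`P i` is generated in degree `i`.  (So `P i` lives in degrees `≥ i`, and gradings by `ℕ`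
suffice; `L a` sits in degree zero.) -/
structure LinearResolution [DecidableEq I] (a : I) where
  P : ℕ → Type w
  [addCommGroup : ∀ i, AddCommGroup (P i)]
  [module : ∀ i, Module (QuadAlg W)ᵐᵒᵖ (P i)]
  projective : ∀ i, Module.Projective (QuadAlg W)ᵐᵒᵖ (P i)
  /-- `gr i k` is the degree `k` part of `P i`. -/
  gr : ∀ i, ℕ → AddSubgroup (P i)
  isInternal : ∀ i, DirectSum.IsInternal (gr i)
  smul_mem : ∀ i k n, ∀ p ∈ gr i k, ∀ x ∈ QuadAlg.gr W n, op x • p ∈ gr i (k + n)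
  generated : ∀ i, Submodule.span (QuadAlg W)ᵐᵒᵖ (gr i i : Set (P i)) = ⊤
  d : ∀ i, P (i + 1) →ₗ[(QuadAlg W)ᵐᵒᵖ] P i
  d_mem : ∀ i k, ∀ p ∈ gr (i + 1) k, d i p ∈ gr i k
  ε : P 0 →ₗ[(QuadAlg W)ᵐᵒᵖ] Simple W a
  ε_eq_zero : ∀ k, 1 ≤ k → ∀ p ∈ gr 0 k, ε p = 0
  ε_surjective : Function.Surjective ε
  exact_zero : Function.Exact (d 0) ε
  exact_succ : ∀ i, Function.Exact (d (i + 1)) (d i)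

/-- `A` is Koszul if each simple module `L a` has a linear projective resolution. -/
def IsKoszul [DecidableEq I] : Prop :=
  ∀ a : I, Nonempty (LinearResolution.{u, v, max u v} W a)

/-! ### The quadratic dual -/

/-- The dual bimodule `M^* = Hom_ℂ(M, ℂ)`, with `(r f s)(m) = f (s m r)`, so that
`e a M^* e b = (e b M e a)^*`. -/
@[nolint unusedArguments]
def BDual (_I : Type u) (M : Type v) [AddCommGroup M] [Module ℂ M] : Type v := Module.Dual ℂ M

instance : AddCommGroup (BDual I M) := inferInstanceAs (AddCommGroup (Module.Dual ℂ M))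
instance : Module ℂ (BDual I M) := inferInstanceAs (Module ℂ (Module.Dual ℂ M))
instance : FunLike (BDual I M) M ℂ := inferInstanceAs (FunLike (Module.Dual ℂ M) M ℂ)
instance : LinearMapClass (BDual I M) ℂ M ℂ :=
  inferInstanceAs (LinearMapClass (Module.Dual ℂ M) ℂ M ℂ)

@[simp] theorem BDual.add_apply (f g : BDual I M) (m : M) : (f + g) m = f m + g m := rfl
@[simp] theorem BDual.zero_apply (m : M) : (0 : BDual I M) m = 0 := rfl
@[simp] theorem BDual.smul_apply (c : ℂ) (f : BDual I M) (m : M) : (c • f) m = c * f m := rfl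

theorem BDual.map_csmul (f : BDual I M) (c : ℂ) (m : M) : f (c • m) = c * f m :=
  LinearMap.map_smul (f : Module.Dual ℂ M) c m

@[ext] theorem BDual.ext {f g : BDual I M} (h : ∀ m, f m = g m) : f = g := LinearMap.ext h

instance : Module (I → ℂ) (BDual I M) where
  smul r f := LinearMap.comp (f : Module.Dual ℂ M) (rAct I r)
  one_smul f := BDual.ext fun m => congrArg f (one_smul (I → ℂ)ᵐᵒᵖ m)
  mul_smul r s f := BDual.ext fun m => congrArg f (by
    change op (r * s) • m = op s • op r • m
    rw [MulOpposite.op_mul, mul_smul])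
  smul_zero _ := rfl
  smul_add _ _ _ := rfl
  add_smul r s f := BDual.ext fun m => by
    change f ((op r + op s) • m) = f (op r • m) + f (op s • m)
    rw [add_smul, map_add]
  zero_smul f := BDual.ext fun m => by
    change f ((0 : (I → ℂ)ᵐᵒᵖ) • m) = 0
    rw [zero_smul, map_zero]

instance : Module (I → ℂ)ᵐᵒᵖ (BDual I M) where
  smul r f := LinearMap.comp (f : Module.Dual ℂ M) (lAct I r.unop)
  one_smul f := BDual.ext fun m => congrArg f (one_smul (I → ℂ) m)
  mul_smul r s f := BDual.ext fun m => congrArg f (by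
    change (r * s).unop • m = s.unop • r.unop • m
    rw [MulOpposite.unop_mul, mul_smul])
  smul_zero _ := rfl
  smul_add _ _ _ := rfl
  add_smul r s f := BDual.ext fun m => by
    change f ((r.unop + s.unop) • m) = f (r.unop • m) + f (s.unop • m)
    rw [add_smul, map_add]
  zero_smul f := BDual.ext fun m => by
    change f ((0 : I → ℂ) • m) = 0
    rw [zero_smul, map_zero]

@[simp] theorem BDual.left_apply (r : I → ℂ) (f : BDual I M) (m : M) :
    (r • f) m = f (op r • m) := rfl
@[simp] theorem BDual.right_apply (r : I → ℂ) (f : BDual I M) (m : M) :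
    (op r • f) m = f (r • m) := rfl

instance : SMulCommClass (I → ℂ) (I → ℂ)ᵐᵒᵖ (BDual I M) where
  smul_comm r s f := BDual.ext fun m => congrArg f (smul_comm s.unop (op r) m)

instance : IsScalarTower ℂ (I → ℂ) (BDual I M) where
  smul_assoc c r f := BDual.ext fun m => by
    change f (op (c • r) • m) = c * f (op r • m)
    rw [MulOpposite.op_smul, smul_assoc, map_smul, smul_eq_mul]

instance : IsScalarTower ℂ (I → ℂ)ᵐᵒᵖ (BDual I M) where
  smul_assoc c r f := BDual.ext fun m => by
    change f ((c • r.unop) • m) = c * f (r.unop • m)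
    rw [smul_assoc, map_smul, smul_eq_mul]

section Pairing

variable [Fintype I] [DecidableEq I]

theorem mul_e (r : I → ℂ) (c : I) : r * e c = r c • e c := by
  ext b
  by_cases h : b = c
  · subst h; simp
  · simp [h]

/-- The functional `f ⊗ g` on `M ⊗_R M`: `(f ⊗ g)(m ⊗ n) = ∑ c : I, f (e c n) g (m e c)`. -/
def dualTensor (f g : BDual I M) : Module.Dual ℂ (Tens I M) :=
  tensLift I
    (LinearMap.mk₂ ℂ (fun m n => ∑ c : I, f (e c • n) * g (op (e c) • m))
      (by intro m m' n; simp [mul_add, Finset.sum_add_distrib])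
      (by
        intro k m n
        simp only [smul_eq_mul, Finset.mul_sum]
        refine Finset.sum_congr rfl fun c _ => ?_
        rw [smul_comm (op (e c)) k m, BDual.map_csmul]; ring)
      (by intro m n n'; simp [add_mul, Finset.sum_add_distrib])
      (by
        intro k m n
        simp only [smul_eq_mul, Finset.mul_sum]
        refine Finset.sum_congr rfl fun c _ => ?_
        rw [smul_comm (e c) k n, BDual.map_csmul]; ring))
    (by
      intro m n r
      simp only [LinearMap.mk₂_apply]
      refine Finset.sum_congr rfl fun c _ => ?_
      rw [smul_smul, ← MulOpposite.op_mul, smul_smul, mul_comm (e c) r, mul_e, smul_assoc,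
        MulOpposite.op_smul, smul_assoc, BDual.map_csmul, BDual.map_csmul]
      ring)

@[simp] theorem dualTensor_tmul (f g : BDual I M) (m n : M) :
    dualTensor f g (tmul I m n) = ∑ c : I, f (e c • n) * g (op (e c) • m) := by
  simp [dualTensor]

theorem tens_hom_ext {P : Type*} [AddCommGroup P] [Module ℂ P] {f g : Tens I M →ₗ[ℂ] P}
    (h : ∀ m n, f (tmul I m n) = g (tmul I m n)) : f = g := by
  refine LinearMap.ext fun t => ?_
  induction t using tens_induction with
  | h0 => simp
  | ht m n => exact h m n
  | ha s t hs ht => simp [hs, ht]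

variable (I M) in
/-- The pairing identifying `M^* ⊗_R M^*` with `(M ⊗_R M)^*`. -/
def pairing : Tens I (BDual I M) →ₗ[ℂ] Module.Dual ℂ (Tens I M) :=
  tensLift I
    (LinearMap.mk₂ ℂ (fun f g => dualTensor f g)
      (by
        intro f f' g; refine tens_hom_ext fun m n => ?_
        simp [add_mul, Finset.sum_add_distrib])
      (by
        intro k f g; refine tens_hom_ext fun m n => ?_
        simp [Finset.mul_sum, mul_assoc])
      (by
        intro f g g'; refine tens_hom_ext fun m n => ?_
        simp [mul_add, Finset.sum_add_distrib])
      (by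
        intro k f g; refine tens_hom_ext fun m n => ?_
        simp [Finset.mul_sum, mul_left_comm]))
    (by
      intro f g r; refine tens_hom_ext fun m n => ?_
      simp only [LinearMap.mk₂_apply, dualTensor_tmul, BDual.left_apply, BDual.right_apply]
      refine Finset.sum_congr rfl fun c _ => ?_
      rw [smul_smul, smul_smul, ← MulOpposite.op_mul, mul_comm (e c) r, mul_e, smul_assoc,
        MulOpposite.op_smul, smul_assoc, BDual.map_csmul, BDual.map_csmul]
      ring)

@[simp] theorem pairing_tmul (f g : BDual I M) (m n : M) :
    pairing I M (tmul I f g) (tmul I m n) = ∑ c : I, f (e c • n) * g (op (e c) • m) := by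
  simp [pairing]

theorem pairing_tensL (r : I → ℂ) (s : Tens I (BDual I M)) (t : Tens I M) :
    pairing I M (tensL I r s) t = pairing I M s (tensR I r t) := by
  induction s using tens_induction with
  | h0 => simp
  | ha s s' hs hs' => simp only [map_add, LinearMap.add_apply, hs, hs']
  | ht f g =>
    induction t using tens_induction with
    | h0 => simp
    | ha t t' hs hs' => simp only [map_add, hs, hs']
    | ht m n => simp only [tensL_tmul, tensR_tmul, pairing_tmul, BDual.left_apply, smul_comm]

theorem pairing_tensR (r : I → ℂ) (s : Tens I (BDual I M)) (t : Tens I M) :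
    pairing I M (tensR I r s) t = pairing I M s (tensL I r t) := by
  induction s using tens_induction with
  | h0 => simp
  | ha s s' hs hs' => simp only [map_add, LinearMap.add_apply, hs, hs']
  | ht f g =>
    induction t using tens_induction with
    | h0 => simp
    | ha t t' hs hs' => simp only [map_add, hs, hs']
    | ht m n =>
      simp only [tensL_tmul, tensR_tmul, pairing_tmul, BDual.right_apply]
      refine Finset.sum_congr rfl fun c _ => ?_
      rw [smul_comm r (op (e c)) m]

/-- The orthogonal complement `W^⊥ ⊆ M^* ⊗_R M^*`. -/
def Relations.perp : Relations I (BDual I M) where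
  carrier := {s | ∀ t ∈ W.toSubmodule, pairing I M s t = 0}
  add_mem' := by
    intro s s' hs hs' t ht
    rw [map_add, LinearMap.add_apply, hs t ht, hs' t ht, add_zero]
  zero_mem' := by intro t _; simp
  smul_mem' := by
    intro c s hs t ht
    rw [map_smul, LinearMap.smul_apply, hs t ht, smul_zero]
  left_mem := by
    intro r s hs t ht
    rw [pairing_tensL]; exact hs _ (W.right_mem r ht)
  right_mem := by
    intro r s hs t ht
    rw [pairing_tensR]; exact hs _ (W.left_mem r ht)

/-- The quadratic dual `A^! = T_R(M^*) / ⟨W^⊥⟩`. -/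
abbrev QuadDual : Type (max u v) := QuadAlg W.perp

/-- The map `A^!_2 → W^*`, induced by the pairing of `A^!_2 = (M^* ⊗_R M^*) / W^⊥` with `W`.  Its
transpose is the isomorphism `W ≅ (A^!_2)^*`. -/
def dualDegTwo : QuadAlg.gr W.perp 2 →ₗ[ℂ] Module.Dual ℂ W.toSubmodule :=
  (W.perp.toSubmodule.liftQ ((Submodule.dualRestrict W.toSubmodule).comp (pairing I M))
    (fun _ hs => LinearMap.mem_ker.2 (LinearMap.ext fun t => hs t.1 t.2))).comp
    (QuadAlg.degTwo W.perp).symm.toLinearMap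

/-- `Z(A^!)_2`, the degree two part of the center of `A^!`. -/
def centerTwo : Submodule ℂ (QuadDual W) :=
  Subalgebra.toSubmodule (Subalgebra.center ℂ (QuadDual W)) ⊓ QuadAlg.gr W.perp 2

/-- The quotient map `W ≅ (A^!_2)^* → Z(A^!)_2^*`. -/
def toCenterDual : W.toSubmodule →ₗ[ℂ] Module.Dual ℂ (centerTwo W) :=
  ((dualDegTwo W).comp (Submodule.inclusion inf_le_right)).flip

end Pairing

/-! ### Graded deformations -/

section Deformations

variable (U : Type w) [AddCommGroup U] [Module ℂ U]

/-- Graded deformations of `A` over `U^*`, with `S = Sym U` and `U` in degree two.  Here `B` is an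
`S`-algebra (the algebra map `S → B`, central by definition, is `j`), `ρ : R → B` is its
`R`-algebra structure, `gr` its grading, and `π : B → A` is a graded homomorphism that induces
an isomorphism `B / ⟨j(U)⟩ ≅ A`. -/
structure IsGradedDeformation (B : Type x) [Ring B] [Algebra ℂ B]
    [Algebra (SymmetricAlgebra ℂ U) B] [IsScalarTower ℂ (SymmetricAlgebra ℂ U) B]
    (gr : ℕ → Submodule ℂ B) (ρ : (I → ℂ) →ₐ[ℂ] B) (π : B →ₐ[ℂ] QuadAlg W) : Prop where
  isInternal : DirectSum.IsInternal gr
  one_mem : (1 : B) ∈ gr 0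
  mul_mem : ∀ m n, ∀ x ∈ gr m, ∀ y ∈ gr n, x * y ∈ gr (m + n)
  ρ_mem : ∀ r, ρ r ∈ gr 0
  j_mem : ∀ z, algebraMap (SymmetricAlgebra ℂ U) B (SymmetricAlgebra.ι ℂ U z) ∈ gr 2
  π_ρ : ∀ r, π (ρ r) = QuadAlg.ofR W r
  π_mem : ∀ n, ∀ x ∈ gr n, π x ∈ QuadAlg.gr W n
  π_surjective : Function.Surjective π
  ker_π : TwoSidedIdeal.ker π = TwoSidedIdeal.span
    (Set.range fun z => algebraMap (SymmetricAlgebra ℂ U) B (SymmetricAlgebra.ι ℂ U z))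

variable {U}

/-- `Ψ : W → R ⊗ U` is a map of `R`-bimodules. -/
def IsBimoduleMap (Ψ : W.toSubmodule →ₗ[ℂ] (I → ℂ) ⊗[ℂ] U) : Prop :=
  ∀ (r : I → ℂ) (t : W.toSubmodule),
    Ψ ⟨tensL I r t, W.left_mem r t.2⟩ = r • Ψ t ∧
    Ψ ⟨tensR I r t, W.right_mem r t.2⟩ = op r • Ψ t

variable {W}

/-- The linear map `Ψ° : W → U` with `Ψ (e a t e a) = e a ⊗ Ψ° (e a t e a)`; it is `Ψ` followed by
the map `R ⊗ U → U` that sends each `e a ⊗ z` to `z`. -/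
def circ [Fintype I] (Ψ : W.toSubmodule →ₗ[ℂ] (I → ℂ) ⊗[ℂ] U) : W.toSubmodule →ₗ[ℂ] U :=
  (TensorProduct.lid ℂ U).toLinearMap ∘ₗ
    (LinearMap.rTensor U (∑ a, LinearMap.proj a : (I → ℂ) →ₗ[ℂ] ℂ)) ∘ₗ Ψ

variable (I M U) in
/-- The inclusion `R ⊗ U → S ⊗ T_R(M)`, where `S = Sym U`. -/
def ofRU : (I → ℂ) ⊗[ℂ] U →ₗ[ℂ] SymmetricAlgebra ℂ U ⊗[ℂ] TensAlg I M :=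
  (TensorProduct.map (SymmetricAlgebra.ι ℂ U) (TensAlg.ofR I M).toLinearMap) ∘ₗ
    (TensorProduct.comm ℂ (I → ℂ) U).toLinearMap

/-- The relations `1 ⊗ t = Ψ(t)` of `Ã_Ψ`. -/
def DefRel (Ψ : W.toSubmodule →ₗ[ℂ] (I → ℂ) ⊗[ℂ] U)
    (x y : SymmetricAlgebra ℂ U ⊗[ℂ] TensAlg I M) : Prop :=
  ∃ t : W.toSubmodule, x = 1 ⊗ₜ[ℂ] TensAlg.ofTens I M t ∧ y = ofRU I M U (Ψ t)

/-- `Ã_Ψ = S ⊗ T_R(M) / ⟨1 ⊗ t - Ψ(t) | t ∈ W⟩`, an algebra over `S = Sym U`. -/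
def Deform (Ψ : W.toSubmodule →ₗ[ℂ] (I → ℂ) ⊗[ℂ] U) : Type (max u v w) :=
  RingQuot (DefRel Ψ)

variable (Ψ : W.toSubmodule →ₗ[ℂ] (I → ℂ) ⊗[ℂ] U)

instance : Ring (Deform Ψ) := inferInstanceAs (Ring (RingQuot (DefRel Ψ)))
instance : Algebra ℂ (Deform Ψ) := inferInstanceAs (Algebra ℂ (RingQuot (DefRel Ψ)))
instance : Algebra (SymmetricAlgebra ℂ U) (Deform Ψ) :=
  inferInstanceAs (Algebra (SymmetricAlgebra ℂ U) (RingQuot (DefRel Ψ)))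
instance : IsScalarTower ℂ (SymmetricAlgebra ℂ U) (Deform Ψ) :=
  inferInstanceAs (IsScalarTower ℂ (SymmetricAlgebra ℂ U) (RingQuot (DefRel Ψ)))

/-- The quotient map `S ⊗ T_R(M) → Ã_Ψ`. -/
def Deform.mk : SymmetricAlgebra ℂ U ⊗[ℂ] TensAlg I M →ₐ[ℂ] Deform Ψ :=
  RingQuot.mkAlgHom ℂ (DefRel Ψ)

/-- The map `R → Ã_Ψ`. -/
def Deform.ofR : (I → ℂ) →ₐ[ℂ] Deform Ψ :=
  ((Deform.mk Ψ).comp Algebra.TensorProduct.includeRight).comp (TensAlg.ofR I M)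

/-- The map `M → Ã_Ψ`. -/
def Deform.ofM : M →ₗ[ℂ] Deform Ψ :=
  ((Deform.mk Ψ).comp Algebra.TensorProduct.includeRight).toLinearMap ∘ₗ TensAlg.ofM I M

/-- The map `U → Ã_Ψ`. -/
def Deform.ofU : U →ₗ[ℂ] Deform Ψ :=
  ((Deform.mk Ψ).comp Algebra.TensorProduct.includeLeft).toLinearMap ∘ₗ SymmetricAlgebra.ι ℂ U

/-- The degree `n` part of `Ã_Ψ`, spanned by the products `z₁ ⋯ z_k r m₁ ⋯ m_i` with
`i + 2 k = n`. -/
def Deform.gr (n : ℕ) : Submodule ℂ (Deform Ψ) :=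
  ⨆ (i : ℕ) (k : ℕ) (_ : i + 2 * k = n),
    LinearMap.range (Deform.ofU Ψ) ^ k * LinearMap.range (Deform.ofR Ψ).toLinearMap *
      LinearMap.range (Deform.ofM Ψ) ^ i

/-- The map `S ⊗ T_R(M) → A` that kills `U`. -/
def preProj (W : Relations I M) : SymmetricAlgebra ℂ U ⊗[ℂ] TensAlg I M →ₐ[ℂ] QuadAlg W :=
  Algebra.TensorProduct.lift
    ((Algebra.ofId ℂ (QuadAlg W)).comp SymmetricAlgebra.algebraMapInv) (QuadAlg.mk W)
    (by
      intro c t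
      rw [AlgHom.comp_apply]
      exact Algebra.commute_algebraMap_left (SymmetricAlgebra.algebraMapInv c) _)

theorem preProj_ofRU (p : (I → ℂ) ⊗[ℂ] U) : preProj W (ofRU I M U p) = 0 := by
  induction p using TensorProduct.induction_on with
  | zero => simp
  | tmul r z =>
    simp only [preProj, ofRU, LinearMap.comp_apply, LinearEquiv.coe_coe, TensorProduct.comm_tmul,
      TensorProduct.map_tmul]
    rw [Algebra.TensorProduct.lift_tmul, AlgHom.comp_apply, SymmetricAlgebra.algebraMapInv_ι,
      map_zero, zero_mul]
  | add p q hp hq => simp [hp, hq]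

/-- The projection `π : Ã_Ψ → A`. -/
def Deform.π : Deform Ψ →ₐ[ℂ] QuadAlg W :=
  RingQuot.liftAlgHom ℂ ⟨preProj W, by
    rintro _ _ ⟨t, rfl, rfl⟩
    rw [preProj_ofRU, preProj, Algebra.TensorProduct.lift_tmul, QuadAlg.mk_ofTens W t.2,
      mul_zero]⟩

/-- The ring homomorphism `Sym V → Sym U` induced by a linear map `V → U`. -/
def symMap {V : Type x} [AddCommGroup V] [Module ℂ V] (ψ : V →ₗ[ℂ] U) :
    SymmetricAlgebra ℂ V →ₐ[ℂ] SymmetricAlgebra ℂ U :=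
  SymmetricAlgebra.lift (SymmetricAlgebra.ι ℂ U ∘ₗ ψ)

end Deformations

/-- Let `C` be a graded deformation of `A` over `V^*` and `B` one over `U^*`.  `IsBaseChange ψ`
says that `B` is isomorphic, as a graded deformation of `A` over `U^*`, to the base change
`Sym U ⊗_{Sym V} C` along the homomorphism `Sym V → Sym U` induced by `ψ : V → U`. -/
def IsBaseChange {U : Type*} {V : Type*} [AddCommGroup U] [Module ℂ U] [AddCommGroup V]
    [Module ℂ V] (ψ : V →ₗ[ℂ] U)
    {C : Type*} [Ring C] [Algebra ℂ C] [Algebra (SymmetricAlgebra ℂ V) C]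
    (grC : ℕ → Submodule ℂ C) (ρC : (I → ℂ) →ₐ[ℂ] C) (πC : C →ₐ[ℂ] QuadAlg W)
    {B : Type*} [Ring B] [Algebra ℂ B] [Algebra (SymmetricAlgebra ℂ U) B]
    (grB : ℕ → Submodule ℂ B) (ρB : (I → ℂ) →ₐ[ℂ] B) (πB : B →ₐ[ℂ] QuadAlg W) : Prop :=
  letI : Algebra (SymmetricAlgebra ℂ V) (SymmetricAlgebra ℂ U) := (symMap ψ).toRingHom.toAlgebra
  ∃ θ : (SymmetricAlgebra ℂ U ⊗[SymmetricAlgebra ℂ V] C) ≃ₐ[SymmetricAlgebra ℂ U] B,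
    (∀ n, ∀ x ∈ grC n, θ (1 ⊗ₜ x) ∈ grB n) ∧
    (∀ r, θ (1 ⊗ₜ ρC r) = ρB r) ∧
    (∀ x, πB (θ (1 ⊗ₜ x)) = πC x)

end Bimodules

end QuadKoszul

end

/-! Write `T` for `T_R(M)` and `S` for `Sym U`. The algebra `Ã_Ψ` is flat when the relations `w =
Ψ(w)` identify no more than the relations `w = 0` do. An element of `W ⊗_R M ∩ M ⊗_R W` can be
reduced from either end, and in a flat `Ã_Ψ` the two results, `Ψ ⊗ 1` and `1 ⊗ Ψ` of it, must agree.
This is the condition `IsPBW`. It is always necessary for flatness, it is sufficient when `A` is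
Koszul, and it is dual to a centrality condition in `A^!`.

Necessity (`isPBW_of_flat`): the difference of the two reductions lies in `U ⊗ M` and dies in `Ã_Ψ`.
By the equational criterion for flatness its coefficients in `M` die in `A`, and `M` embeds in `A`.

Sufficiency (`Deform.flat_of_isPBW`): with a graded section `σ` of `T → A`, the map `S ⊗ A → Ã_Ψ` is
onto by rewriting, and it has to be injective. This amounts to `snd_mem_lowIdeal`: if a sum of terms
`a w b` of degree `n` vanishes in `T`, then the sum of the `a (w - Ψ(w)) b` is a combination of such
elements of lower degree. Stripping arrows from the left by Fox derivatives leads to syzygies over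
`A` between the basic relations `w_j = ∑ x_k ⊗ y_jk`. Koszulness is used here and only here: by
minimality the first three terms of a linear resolution are those of the Koszul complex, and since
`P_3` is generated in degree three, all syzygies come from linear ones (`mem_span_linearSyzygies`).
A linear syzygy is an element of `W ⊗_R M ∩ M ⊗_R W`, settled by `IsPBW`. What remains involves two
disjoint relations, whose rewritings commute up to lower degree (`relPair_mul_mem_of_mk_eq_zero`).

Duality: `A^!_2` is the dual of `W`, and the cubic relations of `A^!` annihilate `W ⊗_R M ∩ M ⊗_R
W`. An element of `A^!_2` commutes with `M^*` exactly when its functional `f` satisfies `f ⊗ 1 = 1 ⊗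
f` on that intersection, and with `R` exactly when `f(r w) = f(w r)`. So `Z(A^!)_2` is the space of
such functionals (`isCentralFunctional_iff`), and `q` is onto. Bimodule maps `Ψ` are the same as
linear maps `Ψ°` with `Ψ°(r w) = Ψ°(w r)`. Testing against functionals on `U` turns `IsPBW` into the
factorization of `Ψ°` through `q` (`isPBW_iff`).

Universality needs no Koszulness once `Ω` is given. In a graded deformation `B` the kernel of `π` is
`U B`, which starts in degree two, so `T` maps to `B` in exactly one admissible way. If `B` is flat,
the image of `w ∈ W` is a well-defined element of `R ⊗ U`, which gives `Ψ`. The map `Ã_Ψ → B` is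
onto by induction on the degree; its kernel `K` satisfies `K = U K` by flatness of `B`, hence is
zero (`bijective_liftSym`). So `Ã_Ψ` is flat, `Ψ° = ψ ∘ q`, and `Ψ` is `Ω` followed by `ψ`, which is
base change (`exists_baseChange_equiv`). The map `ψ` is unique because `B` determines `Ψ` and `q` is
onto. -/

noncomputable section

namespace QuadKoszul

universe u v w x

/-! ### Gradings given by a homomorphism to the polynomial ring -/

section Grading

open Polynomial

variable {B : Type*} [Ring B] [Algebra ℂ B] (δ : B →ₐ[ℂ] B[X])

/-- The elements of degree `n`, for the grading given by `δ : B → B[X]`. -/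
def homog (n : ℕ) : Submodule ℂ B :=
  LinearMap.eqLocus δ.toLinearMap ((monomial n : B →ₗ[B] B[X]).restrictScalars ℂ)

variable {δ}

theorem mem_homog {n : ℕ} {b : B} : b ∈ homog δ n ↔ δ b = monomial n b := Iff.rfl

theorem mul_mem_homog {m n : ℕ} {a b : B} (ha : a ∈ homog δ m) (hb : b ∈ homog δ n) :
    a * b ∈ homog δ (m + n) := by
  rw [mem_homog] at *
  rw [map_mul, ha, hb, monomial_mul_monomial]

theorem one_mem_homog : (1 : B) ∈ homog δ 0 := by
  rw [mem_homog, map_one, monomial_zero_one]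

variable (δ) in
/-- The component of degree `n`. -/
def comp (n : ℕ) : B →ₗ[ℂ] B := ((lcoeff B n).restrictScalars ℂ) ∘ₗ δ.toLinearMap

theorem comp_apply (n : ℕ) (b : B) : comp δ n b = (δ b).coeff n := rfl

theorem comp_of_mem {m : ℕ} {b : B} (hb : b ∈ homog δ m) (n : ℕ) :
    comp δ n b = if m = n then b else 0 := by
  rw [comp_apply, mem_homog.1 hb, coeff_monomial]

theorem comp_same {m : ℕ} {b : B} (hb : b ∈ homog δ m) : comp δ m b = b := by
  rw [comp_of_mem hb, if_pos rfl]

/-- No coaction identities are required of `δ`. Both claims are additive in `b`, and for a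
homogeneous element `δ b` is a single monomial, so it is enough that homogeneous elements span. -/
theorem comp_mem_and_sum (h : ⨆ n, homog δ n = ⊤) (b : B) :
    (∀ n, comp δ n b ∈ homog δ n) ∧ (δ b).sum (fun _ a => a) = b := by
  have hb : b ∈ ⨆ n, homog δ n := h ▸ Submodule.mem_top
  induction hb using Submodule.iSup_induction' with
  | mem i x hx =>
    refine ⟨fun n => ?_, ?_⟩
    · rw [comp_of_mem hx]
      split_ifs with h
      · exact h ▸ hx
      · exact zero_mem _
    · rw [mem_homog.1 hx, sum_monomial_index _ _ rfl]
  | zero => simp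
  | add x y _ _ hx hy =>
    refine ⟨fun n => ?_, ?_⟩
    · rw [map_add]; exact add_mem (hx.1 n) (hy.1 n)
    · rw [map_add, sum_add_index _ _ _ (fun _ => rfl) (fun _ _ _ => rfl), hx.2, hy.2]

theorem comp_mem (h : ⨆ n, homog δ n = ⊤) (n : ℕ) (b : B) : comp δ n b ∈ homog δ n :=
  (comp_mem_and_sum h b).1 n

theorem sum_comp (h : ⨆ n, homog δ n = ⊤) (b : B) :
    ∑ n ∈ (δ b).support, comp δ n b = b := (comp_mem_and_sum h b).2

theorem eq_zero_of_comp (h : ⨆ n, homog δ n = ⊤) {b : B} (hb : ∀ n, comp δ n b = 0) : b = 0 := by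
  rw [← sum_comp h b]
  exact Finset.sum_eq_zero fun n _ => hb n

theorem comp_mul_left {m : ℕ} {a : B} (ha : a ∈ homog δ m) (b : B) (n : ℕ) :
    comp δ (m + n) (a * b) = a * comp δ n b := by
  rw [comp_apply, map_mul, mem_homog.1 ha, add_comm, coeff_monomial_mul, comp_apply]

theorem comp_mul_left_of_lt {m : ℕ} {a : B} (ha : a ∈ homog δ m) (b : B) {n : ℕ} (hn : n < m) :
    comp δ n (a * b) = 0 := by
  rw [comp_apply, map_mul, mem_homog.1 ha, coeff_mul]
  refine Finset.sum_eq_zero fun p hp => ?_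
  rw [coeff_monomial, if_neg, zero_mul]
  have := Finset.HasAntidiagonal.mem_antidiagonal.1 hp
  omega

theorem mul_mem_iSup {gr : ℕ → Submodule ℂ B}
    (h : ∀ i j, ∀ a ∈ gr i, ∀ b ∈ gr j, a * b ∈ gr (i + j)) {x y : B}
    (hx : x ∈ ⨆ n, gr n) (hy : y ∈ ⨆ n, gr n) : x * y ∈ ⨆ n, gr n := by
  induction hx using Submodule.iSup_induction' with
  | mem i x hx =>
    induction hy using Submodule.iSup_induction' with
    | mem j y hy => exact Submodule.mem_iSup_of_mem (i + j) (h i j x hx y hy)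
    | zero => simp
    | add y y' _ _ hy hy' => rw [mul_add]; exact add_mem hy hy'
  | zero => simp
  | add x x' _ _ hx hx' => rw [add_mul]; exact add_mem hx hx'

theorem iSup_homog_eq_top_of_adjoin {s : Set B} (hs : Algebra.adjoin ℂ s = ⊤)
    (h : ∀ a ∈ s, a ∈ ⨆ n, homog δ n) : ⨆ n, homog δ n = ⊤ := by
  refine eq_top_iff.2 fun b _ => ?_
  have hb : b ∈ Algebra.adjoin ℂ s := hs ▸ Algebra.mem_top
  induction hb using Algebra.adjoin_induction with
  | mem x hx => exact h x hx
  | algebraMap r =>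
    refine Submodule.mem_iSup_of_mem 0 ?_
    rw [Algebra.algebraMap_eq_smul_one]
    exact Submodule.smul_mem _ _ one_mem_homog
  | add x y _ _ hx hy => exact add_mem (hx trivial) (hy trivial)
  | mul x y _ _ hx hy =>
    exact mul_mem_iSup (fun _ _ _ ha _ hb => mul_mem_homog ha hb) (hx trivial) (hy trivial)

theorem isInternal_homog (h : ⨆ n, homog δ n = ⊤) : DirectSum.IsInternal (homog δ) := by
  refine (DirectSum.isInternal_submodule_iff_iSupIndep_and_iSup_eq_top _).2 ⟨?_, h⟩
  rw [iSupIndep_def]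
  intro i
  rw [Submodule.disjoint_def]
  intro x hx hx'
  have key : ∀ y ∈ ⨆ j, ⨆ (_ : j ≠ i), homog δ j, comp δ i y = 0 := by
    intro y hy
    have : (⨆ j, ⨆ (_ : j ≠ i), homog δ j) ≤ LinearMap.ker (comp δ i) := by
      refine iSup_le fun j => iSup_le fun hj z hz => ?_
      rw [LinearMap.mem_ker, comp_of_mem hz, if_neg hj]
    exact this hy
  rw [← comp_same hx, key x hx']

/-- The component map of `δ` in degree `n` has image in `gr n`, as one sees on the spanning pieces,
while it fixes `homog δ n`. This identifies the gradings defined by spans of products with those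
defined by `δ`. -/
theorem eq_homog_of_le {gr : ℕ → Submodule ℂ B} (hle : ∀ n, gr n ≤ homog δ n)
    (htop : ⨆ n, gr n = ⊤) (n : ℕ) : gr n = homog δ n := by
  refine le_antisymm (hle n) fun b hb => ?_
  have h : ∀ b, comp δ n b ∈ gr n := by
    intro b
    have hb : b ∈ ⨆ n, gr n := htop ▸ Submodule.mem_top
    induction hb using Submodule.iSup_induction' with
    | mem i x hx =>
      rw [comp_of_mem (hle i hx)]
      split_ifs with h
      · exact h ▸ hx
      · exact zero_mem _
    | zero => simp
    | add x y _ _ hx hy => rw [map_add]; exact add_mem hx hy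
  rw [← comp_same hb]
  exact h b

/-- A homomorphism compatible with the gradings commutes with the component maps. -/
theorem map_comp {C : Type*} [Ring C] [Algebra ℂ C] {δ' : C →ₐ[ℂ] C[X]}
    (h : ⨆ n, homog δ n = ⊤) (f : B →ₗ[ℂ] C) (hf : ∀ n, ∀ b ∈ homog δ n, f b ∈ homog δ' n)
    (n : ℕ) (b : B) : f (comp δ n b) = comp δ' n (f b) := by
  have hb : b ∈ ⨆ n, homog δ n := h ▸ Submodule.mem_top
  induction hb using Submodule.iSup_induction' with
  | mem i x hx =>
    rw [comp_of_mem hx, comp_of_mem (hf i x hx)]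
    split_ifs <;> simp
  | zero => simp
  | add x y _ _ hx hy => simp only [map_add, hx, hy]

end Grading

/-! ### Kernels of `RingQuot` -/

section RingQuot

variable {B : Type*} [Ring B] [Algebra ℂ B]

/-- The kernel of the quotient map by relations `x = y` is spanned by the `a (x - y) b`. -/
theorem mem_span_of_mkAlgHom_eq_zero {rel : B → B → Prop} {b : B}
    (h : RingQuot.mkAlgHom ℂ rel b = 0) :
    b ∈ Submodule.span ℂ {z | ∃ a x y c, rel x y ∧ z = a * (x - y) * c} := by
  set N := Submodule.span ℂ {z : B | ∃ a x y c, rel x y ∧ z = a * (x - y) * c} with hN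
  have hl : ∀ d, ∀ z ∈ N, d * z ∈ N := by
    intro d z hz
    induction hz using Submodule.span_induction with
    | mem z hz =>
      obtain ⟨a, x, y, c, hr, rfl⟩ := hz
      exact Submodule.subset_span ⟨d * a, x, y, c, hr, by simp only [mul_assoc]⟩
    | zero => simp
    | add x y _ _ hx hy => rw [mul_add]; exact add_mem hx hy
    | smul r x _ hx => rw [mul_smul_comm]; exact Submodule.smul_mem _ _ hx
  have hr : ∀ d, ∀ z ∈ N, z * d ∈ N := by
    intro d z hz
    induction hz using Submodule.span_induction with
    | mem z hz =>
      obtain ⟨a, x, y, c, hr, rfl⟩ := hz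
      exact Submodule.subset_span ⟨a, x, y, c * d, hr, by simp only [mul_assoc]⟩
    | zero => simp
    | add x y _ _ hx hy => rw [add_mul]; exact add_mem hx hy
    | smul r x _ hx => rw [smul_mul_assoc]; exact Submodule.smul_mem _ _ hx
  -- The span is already a two-sided ideal, and the relations hold modulo it. So the map to `B / J`
  -- factors through `RingQuot`, and whatever dies there lies in `J`.
  let J : TwoSidedIdeal B := TwoSidedIdeal.mk' N (zero_mem _) (fun hx hy => add_mem hx hy)
    (fun hx => neg_mem hx) (fun {x y} hy => hl x y hy) (fun {x y} hx => hr y x hx)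
  have hJ : ∀ ⦃x y⦄, rel x y → J.ringCon.mk' x = J.ringCon.mk' y := by
    intro x y hxy
    refine (RingCon.eq _).2 ?_
    rw [TwoSidedIdeal.rel_iff, TwoSidedIdeal.mem_mk']
    exact Submodule.subset_span ⟨1, x, y, 1, hxy, by simp⟩
  have h2 : RingQuot.lift ⟨J.ringCon.mk', hJ⟩ (RingQuot.mkRingHom rel b) = J.ringCon.mk' b :=
    RingQuot.lift_mkRingHom_apply _ _ _
  rw [← RingQuot.mkAlgHom_coe ℂ, RingHom.coe_coe, h, map_zero] at h2
  have h3 : J.ringCon b 0 := (RingCon.eq _).1 h2.symm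
  rw [← TwoSidedIdeal.mem_iff, TwoSidedIdeal.mem_mk'] at h3
  exact h3

end RingQuot

/-! ### Bases adapted to a bimodule structure -/

section Adapted

variable {I : Type u} [Fintype I] [DecidableEq I]

theorem sum_e : ∑ a : I, (e a) = (1 : I → ℂ) := by
  ext b
  simp [Finset.sum_apply, Pi.single_apply]

theorem e_self (a : I) : e a a = 1 := Pi.single_eq_same _ _

theorem e_of_ne {a b : I} (h : b ≠ a) : e a b = 0 := Pi.single_eq_of_ne h _

theorem e_mul_e (a : I) : e a * e a = e a := by
  rw [← Pi.single_mul, one_mul]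

theorem sum_smul_e (r : I → ℂ) : ∑ a, r a • e a = r := by
  ext b
  simp [Finset.sum_apply, Pi.single_apply]

/-- A basis of `V` consisting of elements of the spaces `e a V e b`, for commuting actions `L` and
`Q` of `R` on `V`. -/
structure AdaptedBasis {V : Type v} [AddCommGroup V] [Module ℂ V]
    (L Q : (I → ℂ) → V → V) where
  ι : Type v
  [fintype : Fintype ι]
  [decEq : DecidableEq ι]
  basis : Module.Basis ι ℂ V
  src : ι → I
  tgt : ι → I
  left : ∀ r i, L r (basis i) = r (src i) • basis i
  right : ∀ r i, Q r (basis i) = r (tgt i) • basis i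

attribute [instance] AdaptedBasis.fintype AdaptedBasis.decEq

/-- Since `1 = ∑ e a`, the space is spanned by the vectors `e a v e b`, which are simultaneous
eigenvectors, and a basis can be extracted from any spanning set. The right action is encoded by the
family `Q` of operators; `R` being commutative, the order of factors is immaterial. -/
theorem exists_adaptedBasis {V : Type v} [AddCommGroup V] [Module ℂ V] [FiniteDimensional ℂ V]
    (L Q : (I → ℂ) → V →ₗ[ℂ] V)
    (hLm : ∀ r s v, L (r * s) v = L r (L s v)) (hL1 : ∀ v, L 1 v = v)
    (hLs : ∀ (c : ℂ) r v, L (c • r) v = c • L r v) (hLa : ∀ r s v, L (r + s) v = L r v + L s v)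
    (hQm : ∀ r s v, Q (r * s) v = Q r (Q s v)) (hQ1 : ∀ v, Q 1 v = v)
    (hQs : ∀ (c : ℂ) r v, Q (c • r) v = c • Q r v) (hQa : ∀ r s v, Q (r + s) v = Q r v + Q s v)
    (hc : ∀ r s v, L r (Q s v) = Q s (L r v)) :
    Nonempty (AdaptedBasis (I := I) (fun r => L r) (fun r => Q r)) := by
  classical
  let S : Set V := {v | ∃ a b : I, (∀ r, L r v = r a • v) ∧ ∀ r, Q r v = r b • v}
  have sumL : ∀ v, ∑ a, L (e a) v = v := by
    intro v
    let f : (I → ℂ) →+ V := AddMonoidHom.mk' (fun r => L r v) (fun r s => hLa r s v)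
    have h : f (∑ a, e a) = ∑ a, f (e a) := map_sum f _ _
    rw [sum_e] at h
    exact h.symm.trans (hL1 v)
  have sumQ : ∀ v, ∑ a, Q (e a) v = v := by
    intro v
    let f : (I → ℂ) →+ V := AddMonoidHom.mk' (fun r => Q r v) (fun r s => hQa r s v)
    have h : f (∑ a, e a) = ∑ a, f (e a) := map_sum f _ _
    rw [sum_e] at h
    exact h.symm.trans (hQ1 v)
  have hS : Submodule.span ℂ S = ⊤ := by
    refine eq_top_iff.2 fun v _ => ?_
    rw [← sumL v]
    refine sum_mem fun a _ => ?_
    rw [← sumQ (L (e a) v)]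
    refine sum_mem fun b _ => Submodule.subset_span ⟨a, b, fun r => ?_, fun r => ?_⟩
    · rw [hc, ← hLm, mul_e, hLs, map_smul]
    · rw [← hQm, mul_e, hQs]
  obtain ⟨b, hbS, hspan, hli⟩ := exists_linearIndependent ℂ S
  rw [hS] at hspan
  have hspan' : ⊤ ≤ Submodule.span ℂ (Set.range ((↑) : b → V)) := by
    rw [Subtype.range_coe, hspan]
  let bas : Module.Basis b ℂ V := Module.Basis.mk hli hspan'
  have : Fintype b := FiniteDimensional.fintypeBasisIndex bas
  choose s t hst using fun i : b => hbS i.2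
  refine ⟨{ ι := b, basis := bas, src := s, tgt := t, left := ?_, right := ?_ }⟩
  · intro r i
    rw [Module.Basis.mk_apply]
    exact (hst i).1 r
  · intro r i
    rw [Module.Basis.mk_apply]
    exact (hst i).2 r

end Adapted

end QuadKoszul

end

noncomputable section

namespace QuadKoszul

universe u v w x

/-! ### The structure of `T_R(M)` -/

section TensorAlgebraStructure

open Polynomial

variable {I : Type u}
variable {M : Type v} [AddCommGroup M] [Module ℂ M] [Module (I → ℂ) M] [Module (I → ℂ)ᵐᵒᵖ M]
  [SMulCommClass (I → ℂ) (I → ℂ)ᵐᵒᵖ M] [IsScalarTower ℂ (I → ℂ) M]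
  [IsScalarTower ℂ (I → ℂ)ᵐᵒᵖ M]

theorem TensAlg.mk_surjective : Function.Surjective (TensAlg.mk I M) :=
  RingQuot.mkAlgHom_surjective ℂ _

theorem TensAlg.adjoin_eq_top :
    Algebra.adjoin ℂ (Set.range (TensAlg.ofR I M) ∪ Set.range (TensAlg.ofM I M)) = ⊤ := by
  have h : (⊤ : Subalgebra ℂ (TensAlg I M)) =
      (Algebra.adjoin ℂ (Set.range (TensorAlgebra.ι ℂ))).map (TensAlg.mk I M) := by
    rw [TensorAlgebra.adjoin_range_ι, Algebra.map_top, eq_comm, AlgHom.range_eq_top]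
    exact TensAlg.mk_surjective
  rw [eq_top_iff, h, AlgHom.map_adjoin]
  refine Algebra.adjoin_le ?_
  rintro _ ⟨_, ⟨⟨r, m⟩, rfl⟩, rfl⟩
  have : TensAlg.mk I M (TensorAlgebra.ι ℂ (r, m)) = TensAlg.ofR I M r + TensAlg.ofM I M m := by
    rw [show (r, m) = (r, 0) + ((0, m) : (I → ℂ) × M) by simp, map_add, map_add]
    rfl
  rw [this]
  exact add_mem (Algebra.subset_adjoin (Or.inl ⟨r, rfl⟩)) (Algebra.subset_adjoin (Or.inr ⟨m, rfl⟩))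

theorem TensAlg.induction {p : TensAlg I M → Prop} (hR : ∀ r, p (TensAlg.ofR I M r))
    (hM : ∀ m, p (TensAlg.ofM I M m)) (ha : ∀ x y, p x → p y → p (x + y))
    (hm : ∀ x y, p x → p y → p (x * y)) (t : TensAlg I M) : p t := by
  have ht : t ∈ Algebra.adjoin ℂ (Set.range (TensAlg.ofR I M) ∪ Set.range (TensAlg.ofM I M)) :=
    TensAlg.adjoin_eq_top (I := I) (M := M) ▸ Algebra.mem_top
  induction ht using Algebra.adjoin_induction with
  | mem x hx => rcases hx with ⟨r, rfl⟩ | ⟨m, rfl⟩ <;> simp [hR, hM]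
  | algebraMap c => rw [← AlgHom.commutes (TensAlg.ofR I M)]; exact hR _
  | add x y _ _ hx hy => exact ha x y hx hy
  | mul x y _ _ hx hy => exact hm x y hx hy

theorem TensAlg.hom_ext {B : Type*} [Ring B] [Algebra ℂ B] {f g : TensAlg I M →ₐ[ℂ] B}
    (hR : ∀ r, f (TensAlg.ofR I M r) = g (TensAlg.ofR I M r))
    (hM : ∀ m, f (TensAlg.ofM I M m) = g (TensAlg.ofM I M m)) : f = g := by
  refine AlgHom.ext fun t => ?_
  induction t using TensAlg.induction with
  | hR r => exact hR r
  | hM m => exact hM m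
  | ha x y hx hy => simp [hx, hy]
  | hm x y hx hy => simp [hx, hy]

variable (I M) in
/-- The grading of `T_R(M)`. -/
def TensAlg.deg : TensAlg I M →ₐ[ℂ] (TensAlg I M)[X] :=
  TensAlg.lift (CAlgHom.comp (TensAlg.ofR I M))
    (((monomial 1 : TensAlg I M →ₗ[TensAlg I M] _).restrictScalars ℂ) ∘ₗ TensAlg.ofM I M)
    (by intro r m; simp [TensAlg.ofM_left, C_mul_monomial])
    (by intro r m; simp [TensAlg.ofM_right, monomial_mul_C])

theorem TensAlg.ofR_mem (r : I → ℂ) : TensAlg.ofR I M r ∈ homog (TensAlg.deg I M) 0 := by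
  rw [mem_homog, TensAlg.deg, TensAlg.lift_ofR]
  rfl

theorem TensAlg.ofM_mem (m : M) : TensAlg.ofM I M m ∈ homog (TensAlg.deg I M) 1 := by
  rw [mem_homog, TensAlg.deg, TensAlg.lift_ofM]
  rfl

theorem TensAlg.ofTens_mem (t : Tens I M) : TensAlg.ofTens I M t ∈ homog (TensAlg.deg I M) 2 := by
  induction t using tens_induction with
  | h0 => simp
  | ht m n =>
    rw [TensAlg.ofTens_tmul]; exact mul_mem_homog (TensAlg.ofM_mem m) (TensAlg.ofM_mem n)
  | ha s t hs ht => rw [map_add]; exact add_mem hs ht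

theorem TensAlg.iSup_homog : ⨆ n, homog (TensAlg.deg I M) n = ⊤ := by
  refine iSup_homog_eq_top_of_adjoin TensAlg.adjoin_eq_top ?_
  rintro _ (⟨r, rfl⟩ | ⟨m, rfl⟩)
  · exact Submodule.mem_iSup_of_mem 0 (TensAlg.ofR_mem r)
  · exact Submodule.mem_iSup_of_mem 1 (TensAlg.ofM_mem m)

variable (I M) in
/-- The augmentation `T_R(M) → R`. -/
def TensAlg.aug : TensAlg I M →ₐ[ℂ] (I → ℂ) :=
  TensAlg.lift (AlgHom.id ℂ _) 0 (by simp) (by simp)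

@[simp] theorem TensAlg.aug_ofR (r : I → ℂ) : TensAlg.aug I M (TensAlg.ofR I M r) = r := by
  simp [TensAlg.aug]

@[simp] theorem TensAlg.aug_ofM (m : M) : TensAlg.aug I M (TensAlg.ofM I M m) = 0 := by
  simp [TensAlg.aug]

@[simp] theorem TensAlg.aug_ofTens (t : Tens I M) :
    TensAlg.aug I M (TensAlg.ofTens I M t) = 0 := by
  induction t using tens_induction with
  | h0 => simp
  | ht m n => simp
  | ha s t hs ht => simp [hs, ht]

@[simp] theorem TensAlg.ofTens_tensL (r : I → ℂ) (t : Tens I M) :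
    TensAlg.ofTens I M (tensL I r t) = TensAlg.ofR I M r * TensAlg.ofTens I M t := by
  induction t using tens_induction with
  | h0 => simp
  | ht m n => simp [TensAlg.ofM_left, mul_assoc]
  | ha s t hs ht => simp [hs, ht, mul_add]

@[simp] theorem TensAlg.ofTens_tensR (r : I → ℂ) (t : Tens I M) :
    TensAlg.ofTens I M (tensR I r t) = TensAlg.ofTens I M t * TensAlg.ofR I M r := by
  induction t using tens_induction with
  | h0 => simp
  | ht m n => simp [TensAlg.ofM_right, mul_assoc]
  | ha s t hs ht => simp [hs, ht, add_mul]

variable [Fintype I] [DecidableEq I]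

variable (I M) in
/-- A basis of `M` adapted to the bimodule structure: the arrows of a quiver with vertex set
`I`. -/
abbrev ArrowBasis := AdaptedBasis (I := I) (fun r (m : M) => r • m) (fun r (m : M) => op r • m)

variable (I M) in
theorem exists_arrowBasis [FiniteDimensional ℂ M] : Nonempty (ArrowBasis I M) :=
  exists_adaptedBasis (lAct I) (rAct I) (fun r s m => mul_smul r s m) (fun m => one_smul _ m)
    (fun c r m => smul_assoc c r m) (fun r s m => add_smul r s m)
    (fun r s m => by
      change op (r * s) • m = op r • op s • m
      rw [mul_comm, MulOpposite.op_mul, mul_smul])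
    (fun m => one_smul (I → ℂ)ᵐᵒᵖ m)
    (fun c r m => by
      change op (c • r) • m = c • op r • m
      rw [MulOpposite.op_smul, smul_assoc])
    (fun r s m => by
      change op (r + s) • m = op r • m + op s • m
      rw [MulOpposite.op_add, add_smul])
    (fun r s m => smul_comm r (op s) m)

variable (X : ArrowBasis I M)

/-- The `k`-th coordinate on `M`. -/
def ArrowBasis.coord (k : X.ι) : M →ₗ[ℂ] ℂ := X.basis.coord k

theorem ArrowBasis.sum_coord (m : M) : ∑ k, ArrowBasis.coord X k m • X.basis k = m :=
  X.basis.sum_repr m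

theorem ArrowBasis.coord_basis (k l : X.ι) :
    ArrowBasis.coord X k (X.basis l) = if l = k then 1 else 0 := by
  rw [ArrowBasis.coord, Module.Basis.coord_apply, X.basis.repr_self, Finsupp.single_apply]

theorem ArrowBasis.coord_left (k : X.ι) (r : I → ℂ) (m : M) :
    ArrowBasis.coord X k (r • m) = r (X.src k) * ArrowBasis.coord X k m := by
  have h : ArrowBasis.coord X k ∘ₗ lAct I r = r (X.src k) • ArrowBasis.coord X k := by
    refine X.basis.ext fun l => ?_
    simp only [lAct, LinearMap.comp_apply, LinearMap.coe_mk, AddHom.coe_mk, LinearMap.smul_apply]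
    rw [X.left, map_smul, smul_eq_mul, smul_eq_mul, ArrowBasis.coord_basis]
    split_ifs with h
    · rw [h]
    · simp
  exact LinearMap.congr_fun h m

theorem ArrowBasis.coord_right (k : X.ι) (r : I → ℂ) (m : M) :
    ArrowBasis.coord X k (op r • m) = r (X.tgt k) * ArrowBasis.coord X k m := by
  have h : ArrowBasis.coord X k ∘ₗ rAct I r = r (X.tgt k) • ArrowBasis.coord X k := by
    refine X.basis.ext fun l => ?_
    simp only [rAct, LinearMap.comp_apply, LinearMap.coe_mk, AddHom.coe_mk, LinearMap.smul_apply]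
    rw [X.right, map_smul, smul_eq_mul, smul_eq_mul, ArrowBasis.coord_basis]
    split_ifs with h
    · rw [h]
    · simp
  exact LinearMap.congr_fun h m

/-- The matrices `[[r_s, 0], [0, r]]`. -/
def ArrowBasis.triangR (k : X.ι) : (I → ℂ) →ₐ[ℂ] Matrix (Fin 2) (Fin 2) (TensAlg I M) :=
  AlgHom.ofLinearMap
    { toFun := fun r => !![algebraMap ℂ _ (r (X.src k)), 0; 0, TensAlg.ofR I M r]
      map_add' := by intro r s; simp
      map_smul' := by
        intro c r
        simp only [Matrix.smul_of, Matrix.smul_cons, Matrix.smul_empty, smul_zero, Pi.smul_apply,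
          smul_eq_mul, map_mul, map_smul, RingHom.id_apply, Algebra.smul_def c (algebraMap ℂ _ _)] }
    (by simp [Matrix.one_fin_two])
    (by
      intro r s
      simp only [LinearMap.coe_mk, AddHom.coe_mk, Matrix.mul_fin_two, Pi.mul_apply, map_mul,
        mul_zero, zero_mul, add_zero, zero_add])

/-- The matrices `[[0, ξ_k(m) e], [0, m]]`. -/
def ArrowBasis.triangM (k : X.ι) : M →ₗ[ℂ] Matrix (Fin 2) (Fin 2) (TensAlg I M) where
  toFun m := !![0, ArrowBasis.coord X k m • TensAlg.ofR I M (e (X.tgt k)); 0, TensAlg.ofM I M m]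
  map_add' := by intro r s; simp [add_smul]
  map_smul' := by intro c r; simp [mul_smul]

theorem ArrowBasis.triangR_apply (k : X.ι) (r : I → ℂ) : ArrowBasis.triangR X k r =
    !![algebraMap ℂ _ (r (X.src k)), 0; 0, TensAlg.ofR I M r] := rfl

theorem ArrowBasis.triangM_apply (k : X.ι) (m : M) : ArrowBasis.triangM X k m =
    !![0, ArrowBasis.coord X k m • TensAlg.ofR I M (e (X.tgt k)); 0, TensAlg.ofM I M m] := rfl

/-- The homomorphism `t ↦ [[ε(t), ∂t], [0, t]]`. -/
def ArrowBasis.triang (k : X.ι) : TensAlg I M →ₐ[ℂ] Matrix (Fin 2) (Fin 2) (TensAlg I M) :=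
  TensAlg.lift (ArrowBasis.triangR X k) (ArrowBasis.triangM X k)
    (by
      intro r m
      rw [ArrowBasis.triangR_apply, ArrowBasis.triangM_apply, ArrowBasis.triangM_apply,
        Matrix.mul_fin_two, ArrowBasis.coord_left, TensAlg.ofM_left, mul_smul]
      simp only [mul_zero, zero_mul, add_zero, zero_add, Algebra.smul_def (r (X.src k))])
    (by
      intro r m
      rw [ArrowBasis.triangR_apply, ArrowBasis.triangM_apply, ArrowBasis.triangM_apply,
        Matrix.mul_fin_two, ArrowBasis.coord_right, TensAlg.ofM_right,
        smul_mul_assoc _ _ (TensAlg.ofR I M r), ← map_mul, mul_comm (e _) r, mul_e, map_smul,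
        smul_smul, mul_comm (r _)]
      simp only [mul_zero, zero_mul, add_zero, zero_add])

@[simp] theorem ArrowBasis.triang_ofR (k : X.ι) (r : I → ℂ) :
    ArrowBasis.triang X k (TensAlg.ofR I M r) =
      !![algebraMap ℂ _ (r (X.src k)), 0; 0, TensAlg.ofR I M r] :=
  TensAlg.lift_ofR _ _ _ _ r

@[simp] theorem ArrowBasis.triang_ofM (k : X.ι) (m : M) :
    ArrowBasis.triang X k (TensAlg.ofM I M m) =
      !![0, ArrowBasis.coord X k m • TensAlg.ofR I M (e (X.tgt k)); 0, TensAlg.ofM I M m] :=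
  TensAlg.lift_ofM _ _ _ _ m

/-- With these diagonal entries, multiplicativity of the upper right corner becomes the twisted
Leibniz rule of `ArrowBasis.deriv_mul`. Thus `∂_k` needs only the universal property of `T_R(M)` and
no basis of it. -/
theorem ArrowBasis.triang_entries (k : X.ι) (t : TensAlg I M) :
    ArrowBasis.triang X k t 0 0 = algebraMap ℂ _ (TensAlg.aug I M t (X.src k)) ∧
    ArrowBasis.triang X k t 1 0 = 0 ∧ ArrowBasis.triang X k t 1 1 = t := by
  induction t using TensAlg.induction with
  | hR r => simp
  | hM m => simp
  | ha x y hx hy => simp [hx, hy]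
  | hm x y hx hy => simp [hx, hy, Matrix.mul_apply]

/-- The derivation `∂_k` of `T_R(M)` with `∂_k (m t) = ξ_k(m) e t`. -/
def ArrowBasis.deriv (k : X.ι) : TensAlg I M →ₗ[ℂ] TensAlg I M where
  toFun t := ArrowBasis.triang X k t 0 1
  map_add' := by simp
  map_smul' := by simp

theorem ArrowBasis.deriv_mul (k : X.ι) (x y : TensAlg I M) :
    ArrowBasis.deriv X k (x * y) =
      ArrowBasis.deriv X k x * y + TensAlg.aug I M x (X.src k) • ArrowBasis.deriv X k y := by
  simp only [ArrowBasis.deriv, LinearMap.coe_mk, AddHom.coe_mk, map_mul, Matrix.mul_apply,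
    Fin.sum_univ_two, (ArrowBasis.triang_entries X k _).1, (ArrowBasis.triang_entries X k _).2.2,
    Algebra.smul_def]
  rw [add_comm]

@[simp] theorem ArrowBasis.deriv_ofR (k : X.ι) (r : I → ℂ) :
    ArrowBasis.deriv X k (TensAlg.ofR I M r) = 0 := by
  simp [ArrowBasis.deriv]

@[simp] theorem ArrowBasis.deriv_ofM (k : X.ι) (m : M) :
    ArrowBasis.deriv X k (TensAlg.ofM I M m) =
      ArrowBasis.coord X k m • TensAlg.ofR I M (e (X.tgt k)) := by
  simp [ArrowBasis.deriv]

theorem ArrowBasis.deriv_ofR_mul (k : X.ι) (r : I → ℂ) (t : TensAlg I M) :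
    ArrowBasis.deriv X k (TensAlg.ofR I M r * t) = r (X.src k) • ArrowBasis.deriv X k t := by
  simp [ArrowBasis.deriv_mul]

theorem ArrowBasis.deriv_ofM_mul (k : X.ι) (m : M) (t : TensAlg I M) :
    ArrowBasis.deriv X k (TensAlg.ofM I M m * t) =
      ArrowBasis.coord X k m • (TensAlg.ofR I M (e (X.tgt k)) * t) := by
  simp [ArrowBasis.deriv_mul]

theorem ArrowBasis.e_mul_deriv (k : X.ι) (t : TensAlg I M) :
    TensAlg.ofR I M (e (X.tgt k)) * ArrowBasis.deriv X k t = ArrowBasis.deriv X k t := by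
  induction t using TensAlg.induction with
  | hR r => simp
  | hM m => rw [ArrowBasis.deriv_ofM, mul_smul_comm, ← map_mul, e_mul_e]
  | ha x y hx hy => simp only [map_add, mul_add, hx, hy]
  | hm x y hx hy => rw [ArrowBasis.deriv_mul, mul_add, ← mul_assoc, hx, mul_smul_comm, hy]

theorem ArrowBasis.ofM_basis_mul_e (k : X.ι) :
    TensAlg.ofM I M (X.basis k) * TensAlg.ofR I M (e (X.tgt k)) = TensAlg.ofM I M (X.basis k) := by
  rw [← TensAlg.ofM_right, X.right, e_self, one_smul]

/-- The fundamental formula of Fox calculus. Together with `ArrowBasis.deriv_sum` it says that the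
augmentation ideal of `T_R(M)` is the direct sum of the right ideals generated by the arrows, each
isomorphic to some `e T_R(M)`. -/
theorem ArrowBasis.eq_aug_add_sum (t : TensAlg I M) :
    t = TensAlg.ofR I M (TensAlg.aug I M t) +
      ∑ k, TensAlg.ofM I M (X.basis k) * ArrowBasis.deriv X k t := by
  induction t using TensAlg.induction with
  | hR r => simp
  | hM m =>
    simp only [TensAlg.aug_ofM, map_zero, zero_add, ArrowBasis.deriv_ofM, mul_smul_comm,
      ArrowBasis.ofM_basis_mul_e]
    simp only [← map_smul, ← map_sum, ArrowBasis.sum_coord]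
  | ha x y hx hy =>
    simp only [map_add, mul_add, Finset.sum_add_distrib]
    nth_rw 1 [hx, hy]
    abel
  | hm x y hx hy =>
    have h1 : ∑ k, TensAlg.ofM I M (X.basis k) *
        (TensAlg.aug I M x (X.src k) • ArrowBasis.deriv X k y) =
        TensAlg.ofR I M (TensAlg.aug I M x) *
          ∑ k, TensAlg.ofM I M (X.basis k) * ArrowBasis.deriv X k y := by
      rw [Finset.mul_sum]
      refine Finset.sum_congr rfl fun k _ => ?_
      rw [← mul_assoc, ← TensAlg.ofM_left, X.left, map_smul, smul_mul_assoc, mul_smul_comm]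
    simp only [ArrowBasis.deriv_mul, mul_add, Finset.sum_add_distrib, h1, map_mul]
    nth_rw 1 [hx]
    rw [add_mul, Finset.sum_mul]
    nth_rw 1 [hy]
    rw [mul_add]
    simp only [mul_assoc]
    abel

theorem TensAlg.eq_ofR_of_mem_zero (X : ArrowBasis I M) {t : TensAlg I M}
    (ht : t ∈ homog (TensAlg.deg I M) 0) : t = TensAlg.ofR I M (TensAlg.aug I M t) := by
  have h := congrArg (comp (TensAlg.deg I M) 0) (ArrowBasis.eq_aug_add_sum X t)
  rw [comp_same ht, map_add, comp_same (TensAlg.ofR_mem _), map_sum] at h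
  rw [Finset.sum_eq_zero, add_zero] at h
  · exact h
  · intro k _
    exact comp_mul_left_of_lt (TensAlg.ofM_mem _) _ one_pos

theorem ArrowBasis.eq_sum_of_mem_succ {n : ℕ} {t : TensAlg I M}
    (ht : t ∈ homog (TensAlg.deg I M) (n + 1)) :
    t = ∑ k, TensAlg.ofM I M (X.basis k) * ArrowBasis.deriv X k t := by
  have h := ArrowBasis.eq_aug_add_sum X t
  have h2 : TensAlg.ofR I M (TensAlg.aug I M t) = 0 := by
    have h3 := congrArg (comp (TensAlg.deg I M) 0) h
    rw [comp_of_mem ht, if_neg (Nat.succ_ne_zero n), map_add, comp_same (TensAlg.ofR_mem _),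
      map_sum, Finset.sum_eq_zero, add_zero] at h3
    · exact h3.symm
    · intro k _
      exact comp_mul_left_of_lt (TensAlg.ofM_mem _) _ one_pos
  rwa [h2, zero_add] at h

/-- Uniqueness of coefficients in an expansion by first arrows, once the `k`-th coefficient is
normalized to start at the target of the `k`-th arrow. -/
theorem ArrowBasis.deriv_sum (c : X.ι → TensAlg I M)
    (hc : ∀ k, TensAlg.ofR I M (e (X.tgt k)) * c k = c k) (k : X.ι) :
    ArrowBasis.deriv X k (∑ l, TensAlg.ofM I M (X.basis l) * c l) = c k := by
  rw [map_sum, Finset.sum_eq_single k]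
  · rw [ArrowBasis.deriv_ofM_mul, ArrowBasis.coord_basis, if_pos rfl, one_smul, hc]
  · intro l _ hl
    rw [ArrowBasis.deriv_ofM_mul, ArrowBasis.coord_basis, if_neg hl, zero_smul]
  · simp

/-- Taking the component of degree `n + 1` of the Fox expansion gives a second expansion of `t`,
with homogeneous coefficients; uniqueness identifies the two. -/
theorem ArrowBasis.deriv_mem {n : ℕ} {t : TensAlg I M}
    (ht : t ∈ homog (TensAlg.deg I M) (n + 1)) (k : X.ι) :
    ArrowBasis.deriv X k t ∈ homog (TensAlg.deg I M) n := by
  have h := congrArg (comp (TensAlg.deg I M) (n + 1)) (ArrowBasis.eq_sum_of_mem_succ X ht)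
  rw [comp_same ht, map_sum] at h
  have h2 : ∀ k, comp (TensAlg.deg I M) (n + 1)
      (TensAlg.ofM I M (X.basis k) * ArrowBasis.deriv X k t) =
      TensAlg.ofM I M (X.basis k) * comp (TensAlg.deg I M) n (ArrowBasis.deriv X k t) := by
    intro k
    rw [add_comm]; exact comp_mul_left (TensAlg.ofM_mem _) _ _
  simp only [h2] at h
  have h3 : ArrowBasis.deriv X k t = comp (TensAlg.deg I M) n (ArrowBasis.deriv X k t) := by
    conv_lhs => rw [h]
    refine ArrowBasis.deriv_sum X _ (fun l => ?_) k
    have := comp_mul_left (TensAlg.ofR_mem (M := M) (e (X.tgt l))) (ArrowBasis.deriv X l t) n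
    rw [ArrowBasis.e_mul_deriv, zero_add] at this
    exact this.symm
  rw [h3]
  exact comp_mem TensAlg.iSup_homog _ _

/-- Left contraction `M ⊗_R M → M` with the `k`-th coordinate. -/
def ArrowBasis.contr (k : X.ι) : Tens I M →ₗ[ℂ] M :=
  tensLift I (LinearMap.mk₂ ℂ (fun m n => ArrowBasis.coord X k m • e (X.tgt k) • n)
    (by intro m m' n; rw [map_add, add_smul])
    (by intro c m n; rw [map_smul, smul_eq_mul, mul_smul])
    (by intro m n n'; rw [smul_add, smul_add])
    (by intro c m n; rw [smul_comm (e (X.tgt k)) c n, smul_comm]))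
    (by
      intro m n r
      simp only [LinearMap.mk₂_apply]
      rw [ArrowBasis.coord_right, smul_smul, mul_comm (e _), mul_e, smul_assoc, smul_smul,
        mul_comm])

@[simp] theorem ArrowBasis.contr_tmul (k : X.ι) (m n : M) :
    ArrowBasis.contr X k (tmul I m n) = ArrowBasis.coord X k m • e (X.tgt k) • n := by
  simp [ArrowBasis.contr]

theorem ArrowBasis.deriv_ofTens (k : X.ι) (t : Tens I M) :
    ArrowBasis.deriv X k (TensAlg.ofTens I M t) = TensAlg.ofM I M (ArrowBasis.contr X k t) := by
  induction t using tens_induction with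
  | h0 => simp
  | ht m n => simp [ArrowBasis.deriv_ofM_mul, TensAlg.ofM_left]
  | ha s t hs ht => simp [hs, ht]

theorem ArrowBasis.e_smul_contr (k : X.ι) (t : Tens I M) :
    e (X.tgt k) • ArrowBasis.contr X k t = ArrowBasis.contr X k t := by
  induction t using tens_induction with
  | h0 => simp
  | ht m n => rw [ArrowBasis.contr_tmul, smul_comm, smul_smul, e_mul_e]
  | ha s t hs ht => simp only [map_add, smul_add, hs, ht]

theorem ArrowBasis.contr_tensL (k : X.ι) (r : I → ℂ) (t : Tens I M) :
    ArrowBasis.contr X k (tensL I r t) = r (X.src k) • ArrowBasis.contr X k t := by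
  induction t using tens_induction with
  | h0 => simp
  | ht m n => simp [ArrowBasis.coord_left, mul_smul]
  | ha s t hs ht => simp only [map_add, smul_add, hs, ht]

theorem ArrowBasis.contr_tensR (k : X.ι) (r : I → ℂ) (t : Tens I M) :
    ArrowBasis.contr X k (tensR I r t) = op r • ArrowBasis.contr X k t := by
  induction t using tens_induction with
  | h0 => simp
  | ht m n =>
    rw [tensR_tmul, ArrowBasis.contr_tmul, ArrowBasis.contr_tmul, smul_comm _ (op r) n,
      smul_comm]
  | ha s t hs ht => simp only [map_add, smul_add, hs, ht]

theorem ArrowBasis.sum_tmul_contr (t : Tens I M) :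
    ∑ k, tmul I (X.basis k) (ArrowBasis.contr X k t) = t := by
  induction t using tens_induction with
  | h0 => simp [← tmulBil_apply]
  | ht m n =>
    simp only [ArrowBasis.contr_tmul, tmul_smul_right, ← tmul_balanced, X.right,
      e_self, one_smul]
    simp only [← tmul_smul_left]
    conv_rhs => rw [← ArrowBasis.sum_coord X m]
    simp only [← tmulBil_apply, map_sum, LinearMap.sum_apply]
  | ha s t hs ht =>
    simp only [map_add, tmul_add_right, Finset.sum_add_distrib, hs, ht]

theorem ArrowBasis.contr_sum (c : X.ι → M) (hc : ∀ k, e (X.tgt k) • c k = c k) (k : X.ι) :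
    ArrowBasis.contr X k (∑ l, tmul I (X.basis l) (c l)) = c k := by
  rw [map_sum, Finset.sum_eq_single k]
  · rw [ArrowBasis.contr_tmul, ArrowBasis.coord_basis, if_pos rfl, one_smul, hc]
  · intro l _ hl
    rw [ArrowBasis.contr_tmul, ArrowBasis.coord_basis, if_neg hl, zero_smul]
  · simp

end TensorAlgebraStructure

end QuadKoszul

end

noncomputable section

namespace QuadKoszul

universe u v w x

/-! ### The structure of the quadratic algebra -/

section QuadraticAlgebraStructure

open Polynomial

variable {I : Type u}
variable {M : Type v} [AddCommGroup M] [Module ℂ M] [Module (I → ℂ) M] [Module (I → ℂ)ᵐᵒᵖ M]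
  [SMulCommClass (I → ℂ) (I → ℂ)ᵐᵒᵖ M] [IsScalarTower ℂ (I → ℂ) M]
  [IsScalarTower ℂ (I → ℂ)ᵐᵒᵖ M]
variable (W : Relations I M)

theorem QuadAlg.mk_surjective : Function.Surjective (QuadAlg.mk W) :=
  RingQuot.mkAlgHom_surjective ℂ _

@[simp] theorem QuadAlg.mk_ofR (r : I → ℂ) :
    QuadAlg.mk W (TensAlg.ofR I M r) = QuadAlg.ofR W r := rfl

@[simp] theorem QuadAlg.mk_ofM (m : M) : QuadAlg.mk W (TensAlg.ofM I M m) = QuadAlg.ofM W m := rfl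

theorem QuadAlg.ofM_left (r : I → ℂ) (m : M) :
    QuadAlg.ofM W (r • m) = QuadAlg.ofR W r * QuadAlg.ofM W m := by
  simp only [← QuadAlg.mk_ofM, ← QuadAlg.mk_ofR, TensAlg.ofM_left, map_mul]

theorem QuadAlg.ofM_right (r : I → ℂ) (m : M) :
    QuadAlg.ofM W (op r • m) = QuadAlg.ofM W m * QuadAlg.ofR W r := by
  simp only [← QuadAlg.mk_ofM, ← QuadAlg.mk_ofR, TensAlg.ofM_right, map_mul]

theorem QuadAlg.mk_ofTens_eq_zero_iff (t : Tens I M) :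
    QuadAlg.mk W (TensAlg.ofTens I M t) = 0 ↔ t ∈ W.toSubmodule := by
  refine ⟨fun h => ?_, fun h => QuadAlg.mk_ofTens W h⟩
  rw [← QuadAlg.ofQuot_mk] at h
  exact (Submodule.Quotient.mk_eq_zero _).1
    ((map_eq_zero_iff _ (QuadAlg.ofQuot_injective W)).1 h)

variable {W} in
/-- Universal property of the quadratic algebra. -/
def QuadAlg.lift {B : Type*} [Ring B] [Algebra ℂ B] (f : TensAlg I M →ₐ[ℂ] B)
    (h : ∀ t ∈ W.toSubmodule, f (TensAlg.ofTens I M t) = 0) : QuadAlg W →ₐ[ℂ] B :=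
  RingQuot.liftAlgHom ℂ ⟨f, by
    rintro _ _ ⟨t, ht, rfl, rfl⟩
    rw [h t ht, map_zero]⟩

variable {W} in
@[simp] theorem QuadAlg.lift_mk {B : Type*} [Ring B] [Algebra ℂ B] (f : TensAlg I M →ₐ[ℂ] B)
    (h : ∀ t ∈ W.toSubmodule, f (TensAlg.ofTens I M t) = 0) (t : TensAlg I M) :
    QuadAlg.lift f h (QuadAlg.mk W t) = f t :=
  RingQuot.liftAlgHom_mkAlgHom_apply ℂ _ _ _

variable {W} in
theorem QuadAlg.induction {p : QuadAlg W → Prop} (hR : ∀ r, p (QuadAlg.ofR W r))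
    (hM : ∀ m, p (QuadAlg.ofM W m)) (ha : ∀ x y, p x → p y → p (x + y))
    (hm : ∀ x y, p x → p y → p (x * y)) (t : QuadAlg W) : p t := by
  obtain ⟨t, rfl⟩ := QuadAlg.mk_surjective W t
  induction t using TensAlg.induction with
  | hR r => exact hR r
  | hM m => exact hM m
  | ha x y hx hy => rw [map_add]; exact ha _ _ hx hy
  | hm x y hx hy => rw [map_mul]; exact hm _ _ hx hy

/-- The grading of `A`. -/
def QuadAlg.deg : QuadAlg W →ₐ[ℂ] (QuadAlg W)[X] :=
  QuadAlg.lift ((mapAlgHom (QuadAlg.mk W)).comp (TensAlg.deg I M)) (by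
    intro t ht
    rw [AlgHom.comp_apply, mem_homog.1 (TensAlg.ofTens_mem t), coe_mapAlgHom, map_monomial,
      RingHom.coe_coe, QuadAlg.mk_ofTens W ht, map_zero])

theorem QuadAlg.mk_mem {n : ℕ} {t : TensAlg I M} (ht : t ∈ homog (TensAlg.deg I M) n) :
    QuadAlg.mk W t ∈ homog (QuadAlg.deg W) n := by
  rw [mem_homog, QuadAlg.deg, QuadAlg.lift_mk, AlgHom.comp_apply, mem_homog.1 ht, coe_mapAlgHom,
    map_monomial]
  rfl

theorem QuadAlg.iSup_homog : ⨆ n, homog (QuadAlg.deg W) n = ⊤ := by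
  refine eq_top_iff.2 fun a _ => ?_
  obtain ⟨t, rfl⟩ := QuadAlg.mk_surjective W a
  have ht : t ∈ ⨆ n, homog (TensAlg.deg I M) n := TensAlg.iSup_homog (I := I) (M := M) ▸ trivial
  induction ht using Submodule.iSup_induction' with
  | mem i x hx => exact Submodule.mem_iSup_of_mem i (QuadAlg.mk_mem W hx)
  | zero => simp
  | add x y _ _ hx hy => rw [map_add]; exact add_mem (hx trivial) (hy trivial)

theorem QuadAlg.mk_comp (n : ℕ) (t : TensAlg I M) :
    QuadAlg.mk W (comp (TensAlg.deg I M) n t) = comp (QuadAlg.deg W) n (QuadAlg.mk W t) :=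
  map_comp TensAlg.iSup_homog (QuadAlg.mk W).toLinearMap (fun _ _ ht => QuadAlg.mk_mem W ht) n t

theorem QuadAlg.ofR_mem (r : I → ℂ) : QuadAlg.ofR W r ∈ homog (QuadAlg.deg W) 0 :=
  QuadAlg.mk_mem W (TensAlg.ofR_mem r)

theorem QuadAlg.ofM_mem (m : M) : QuadAlg.ofM W m ∈ homog (QuadAlg.deg W) 1 :=
  QuadAlg.mk_mem W (TensAlg.ofM_mem m)

theorem QuadAlg.exists_homog_lift {n : ℕ} {a : QuadAlg W} (ha : a ∈ homog (QuadAlg.deg W) n) :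
    ∃ t ∈ homog (TensAlg.deg I M) n, QuadAlg.mk W t = a := by
  obtain ⟨t, rfl⟩ := QuadAlg.mk_surjective W a
  exact ⟨comp _ n t, comp_mem TensAlg.iSup_homog _ _, by rw [QuadAlg.mk_comp, comp_same ha]⟩

/-- The augmentation `A → R`. -/
def QuadAlg.aug : QuadAlg W →ₐ[ℂ] (I → ℂ) := QuadAlg.lift (TensAlg.aug I M) (by simp)

@[simp] theorem QuadAlg.aug_mk (t : TensAlg I M) :
    QuadAlg.aug W (QuadAlg.mk W t) = TensAlg.aug I M t := by
  simp [QuadAlg.aug]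

@[simp] theorem QuadAlg.aug_ofR (r : I → ℂ) : QuadAlg.aug W (QuadAlg.ofR W r) = r := by
  rw [← QuadAlg.mk_ofR, QuadAlg.aug_mk, TensAlg.aug_ofR]

@[simp] theorem QuadAlg.aug_ofM (m : M) : QuadAlg.aug W (QuadAlg.ofM W m) = 0 := by
  rw [← QuadAlg.mk_ofM, QuadAlg.aug_mk, TensAlg.aug_ofM]

theorem QuadAlg.ofR_injective : Function.Injective (QuadAlg.ofR W) :=
  Function.LeftInverse.injective (QuadAlg.aug_ofR W)

/-- In the action of `A` on `R × M × (M ⊗_R M) / W`, an element of `M` is recovered from what it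
does to `(1, 0, 0)`. -/
theorem QuadAlg.ofM_injective : Function.Injective (QuadAlg.ofM W) := by
  rw [injective_iff_map_eq_zero]
  intro m hm
  have h : truncA W (QuadAlg.mk W (TensAlg.ofM I M m)) = truncT W (TensAlg.ofM I M m) :=
    RingQuot.liftAlgHom_mkAlgHom_apply ℂ _ _ _
  rw [QuadAlg.mk_ofM, hm, map_zero] at h
  have h' := congrArg (fun f => (f (1, 0, 0)).2.1) h
  simpa [truncT, truncM_apply] using h'.symm

/-- The kernel of `T_R(M) → A`. -/
theorem QuadAlg.mem_span_of_mk_eq_zero {t : TensAlg I M} (ht : QuadAlg.mk W t = 0) :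
    t ∈ Submodule.span ℂ {z | ∃ a b, ∃ s ∈ W.toSubmodule, z = a * TensAlg.ofTens I M s * b} := by
  refine Submodule.span_mono ?_ (mem_span_of_mkAlgHom_eq_zero ht)
  rintro _ ⟨a, _, _, b, ⟨s, hs, rfl, rfl⟩, rfl⟩
  exact ⟨a, b, s, hs, by rw [sub_zero]⟩

/-- The kernel of `T_R(M) → A` in degree `n`. -/
theorem QuadAlg.mem_span_of_mk_eq_zero_of_mem {n : ℕ} {t : TensAlg I M} (ht : QuadAlg.mk W t = 0)
    (hn : t ∈ homog (TensAlg.deg I M) n) :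
    t ∈ Submodule.span ℂ {z | ∃ p q, p + q + 2 = n ∧ ∃ a ∈ homog (TensAlg.deg I M) p,
      ∃ b ∈ homog (TensAlg.deg I M) q, ∃ s ∈ W.toSubmodule, z = a * TensAlg.ofTens I M s * b} := by
  have key : ∀ z ∈ Submodule.span ℂ {z | ∃ a b, ∃ s ∈ W.toSubmodule,
      z = a * TensAlg.ofTens I M s * b}, comp (TensAlg.deg I M) n z ∈
      Submodule.span ℂ {z | ∃ p q, p + q + 2 = n ∧ ∃ a ∈ homog (TensAlg.deg I M) p,
      ∃ b ∈ homog (TensAlg.deg I M) q, ∃ s ∈ W.toSubmodule,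
        z = a * TensAlg.ofTens I M s * b} := by
    intro z hz
    induction hz using Submodule.span_induction with
    | mem z hz =>
      obtain ⟨a, b, s, hs, rfl⟩ := hz
      -- Each term splits into products of homogeneous components, and only those of total degree
      -- `n` survive the projection.
      rw [← sum_comp TensAlg.iSup_homog a, ← sum_comp TensAlg.iSup_homog b, Finset.sum_mul,
        Finset.sum_mul, map_sum]
      refine sum_mem fun p _ => ?_
      rw [Finset.mul_sum, map_sum]
      refine sum_mem fun q _ => ?_
      have hmem : comp (TensAlg.deg I M) p a * TensAlg.ofTens I M s * comp (TensAlg.deg I M) q b ∈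
          homog (TensAlg.deg I M) (p + 2 + q) :=
        mul_mem_homog (mul_mem_homog (comp_mem TensAlg.iSup_homog _ _) (TensAlg.ofTens_mem s))
          (comp_mem TensAlg.iSup_homog _ _)
      rw [comp_of_mem hmem]
      split_ifs with h
      · exact Submodule.subset_span ⟨p, q, by omega, _, comp_mem TensAlg.iSup_homog _ _, _,
          comp_mem TensAlg.iSup_homog _ _, s, hs, rfl⟩
      · exact zero_mem _
    | zero => simp
    | add x y _ _ hx hy => rw [map_add]; exact add_mem hx hy
    | smul c x _ hx => rw [map_smul]; exact Submodule.smul_mem _ _ hx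
  rw [← comp_same hn]
  exact key t (QuadAlg.mem_span_of_mk_eq_zero W ht)

theorem QuadAlg.gr_le (n : ℕ) : QuadAlg.gr W n ≤ homog (QuadAlg.deg W) n := by
  rw [QuadAlg.gr, Submodule.mul_le]
  rintro _ ⟨r, rfl⟩ b hb
  rw [← zero_add n]
  refine mul_mem_homog (QuadAlg.ofR_mem W r) ?_
  have : LinearMap.range (QuadAlg.ofM W) ^ n ≤ homog (QuadAlg.deg W) n := by
    clear hb
    induction n with
    | zero =>
      rw [pow_zero, Submodule.one_le]
      exact one_mem_homog
    | succ n ih =>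
      rw [pow_succ, Submodule.mul_le]
      rintro a ha _ ⟨m, rfl⟩
      exact mul_mem_homog (ih ha) (QuadAlg.ofM_mem W m)
  exact this hb

theorem QuadAlg.ofM_mul_mem_gr {n : ℕ} (m : M) {a : QuadAlg W} (ha : a ∈ QuadAlg.gr W n) :
    QuadAlg.ofM W m * a ∈ QuadAlg.gr W (n + 1) := by
  induction ha using Submodule.mul_induction_on' with
  | mem_mul_mem r hr y hy =>
    obtain ⟨r, rfl⟩ := hr
    rw [AlgHom.toLinearMap_apply, ← mul_assoc, ← QuadAlg.ofM_right,
      ← one_mul (QuadAlg.ofM W (op r • m) * y), QuadAlg.gr, pow_succ']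
    exact Submodule.mul_mem_mul ⟨1, map_one (QuadAlg.ofR W)⟩
      (Submodule.mul_mem_mul ⟨_, rfl⟩ hy)
  | add x _ y _ hx hy => rw [mul_add]; exact add_mem hx hy

variable [Fintype I] [DecidableEq I]

/-- Homogeneous elements of `T_R(M)` are spanned by products of the right length, because the Fox
expansion peels off one arrow at a time. The two gradings are thus interchangeable. -/
theorem QuadAlg.gr_eq [FiniteDimensional ℂ M] (n : ℕ) :
    QuadAlg.gr W n = homog (QuadAlg.deg W) n := by
  obtain ⟨X⟩ := exists_arrowBasis I M
  refine eq_homog_of_le (QuadAlg.gr_le W) ?_ n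
  have key : ∀ n, ∀ t ∈ homog (TensAlg.deg I M) n, QuadAlg.mk W t ∈ QuadAlg.gr W n := by
    intro n
    induction n with
    | zero =>
      intro t ht
      rw [TensAlg.eq_ofR_of_mem_zero X ht, QuadAlg.gr, pow_zero, mul_one]
      exact ⟨_, rfl⟩
    | succ n ih =>
      intro t ht
      rw [ArrowBasis.eq_sum_of_mem_succ X ht, map_sum]
      refine sum_mem fun k _ => ?_
      rw [map_mul]
      exact QuadAlg.ofM_mul_mem_gr W _ (ih _ (ArrowBasis.deriv_mem X ht k))
  refine eq_top_iff.2 fun a _ => ?_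
  obtain ⟨t, rfl⟩ := QuadAlg.mk_surjective W a
  have ht : t ∈ ⨆ n, homog (TensAlg.deg I M) n := TensAlg.iSup_homog (I := I) (M := M) ▸ trivial
  induction ht using Submodule.iSup_induction' with
  | mem i x hx => exact Submodule.mem_iSup_of_mem i (key i x hx)
  | zero => simp
  | add x y _ _ hx hy => rw [map_add]; exact add_mem (hx trivial) (hy trivial)

variable (X : ArrowBasis I M)

theorem QuadAlg.eq_ofR_of_mem_zero (X : ArrowBasis I M) {a : QuadAlg W}
    (ha : a ∈ homog (QuadAlg.deg W) 0) : a = QuadAlg.ofR W (QuadAlg.aug W a) := by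
  obtain ⟨t, ht, rfl⟩ := QuadAlg.exists_homog_lift W ha
  rw [QuadAlg.aug_mk, ← QuadAlg.mk_ofR, ← TensAlg.eq_ofR_of_mem_zero X ht]

theorem QuadAlg.exists_ofM_of_mem_one (X : ArrowBasis I M) {a : QuadAlg W}
    (ha : a ∈ homog (QuadAlg.deg W) 1) : ∃ m, a = QuadAlg.ofM W m := by
  obtain ⟨t, ht, rfl⟩ := QuadAlg.exists_homog_lift W ha
  refine ⟨∑ k, op (TensAlg.aug I M (ArrowBasis.deriv X k t)) • X.basis k, ?_⟩
  conv_lhs => rw [ArrowBasis.eq_sum_of_mem_succ X ht]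
  rw [map_sum, map_sum]
  refine Finset.sum_congr rfl fun k _ => ?_
  rw [← QuadAlg.mk_ofM, TensAlg.ofM_right]
  congr 2
  exact TensAlg.eq_ofR_of_mem_zero X (ArrowBasis.deriv_mem X ht k)

/-- The augmentation depends only on the component of degree zero, since taking constant
coefficients of `δ` is multiplicative. -/
theorem QuadAlg.aug_of_mem_succ {n : ℕ} {a : QuadAlg W}
    (ha : a ∈ homog (QuadAlg.deg W) (n + 1)) : QuadAlg.aug W a = 0 := by
  have key : ∀ b : QuadAlg W, QuadAlg.aug W b = QuadAlg.aug W (comp (QuadAlg.deg W) 0 b) := by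
    intro b
    induction b using QuadAlg.induction with
    | hR r => rw [comp_same (QuadAlg.ofR_mem W r)]
    | hM m => rw [comp_of_mem (QuadAlg.ofM_mem W m), if_neg one_ne_zero, map_zero, aug_ofM]
    | ha x y hx hy => simp only [map_add, ← hx, ← hy]
    | hm x y hx hy =>
      rw [map_mul, hx, hy, comp_apply, comp_apply, comp_apply, map_mul, mul_coeff_zero, map_mul]
  rw [key, comp_of_mem ha, if_neg (Nat.succ_ne_zero n), map_zero]

theorem QuadAlg.comp_zero (X : ArrowBasis I M) (a : QuadAlg W) :
    comp (QuadAlg.deg W) 0 a = QuadAlg.ofR W (QuadAlg.aug W a) := by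
  have h : QuadAlg.aug W a = QuadAlg.aug W (comp (QuadAlg.deg W) 0 a) := by
    have ha : a ∈ ⨆ n, homog (QuadAlg.deg W) n := QuadAlg.iSup_homog W ▸ trivial
    induction ha using Submodule.iSup_induction' with
    | mem i x hx =>
      rw [comp_of_mem hx]
      split_ifs with h
      · rfl
      · obtain ⟨j, rfl⟩ := Nat.exists_eq_succ_of_ne_zero h
        rw [QuadAlg.aug_of_mem_succ W hx, map_zero]
    | zero => simp
    | add x y _ _ hx hy => rw [map_add, map_add, map_add, ← hx, ← hy]
  rw [h]
  exact QuadAlg.eq_ofR_of_mem_zero W X (comp_mem (QuadAlg.iSup_homog W) _ _)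

end QuadraticAlgebraStructure

end QuadKoszul

end

noncomputable section

namespace QuadKoszul

universe u v w x

/-! ### Graded right modules over a quadratic algebra -/

section GradedModules

variable {P : Type*} [AddCommGroup P] {gr : ℕ → AddSubgroup P} (h : DirectSum.IsInternal gr)

/-- The component of degree `n` of an element of a graded abelian group. -/
def component (n : ℕ) : P →+ P :=
  letI := h.chooseDecomposition
  ((gr n).subtype.comp (DFinsupp.evalAddMonoidHom n)).comp
    (DirectSum.decomposeAddEquiv gr).toAddMonoidHom

theorem component_mem (n : ℕ) (p : P) : component h n p ∈ gr n := by
  let _ := h.chooseDecomposition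
  exact (DirectSum.decompose gr p n).2

theorem component_of_mem {m : ℕ} {p : P} (hp : p ∈ gr m) (n : ℕ) :
    component h n p = if m = n then p else 0 := by
  let _ := h.chooseDecomposition
  change (DirectSum.decompose gr p n : P) = _
  split_ifs with hmn
  · subst hmn; exact DirectSum.decompose_of_mem_same gr hp
  · exact DirectSum.decompose_of_mem_ne gr hp hmn

theorem exists_sum_component (p : P) : ∃ s : Finset ℕ, p = ∑ n ∈ s, component h n p := by
  classical
  let _ := h.chooseDecomposition
  exact ⟨_, (DirectSum.sum_support_decompose gr p).symm⟩

theorem map_component {Q : Type*} [AddCommGroup Q] {gr' : ℕ → AddSubgroup Q}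
    (h' : DirectSum.IsInternal gr') (f : P →+ Q) (hf : ∀ n, ∀ p ∈ gr n, f p ∈ gr' n) (n : ℕ)
    (p : P) : f (component h n p) = component h' n (f p) := by
  obtain ⟨s, hs⟩ := exists_sum_component h p
  have : ∀ q ∈ AddSubgroup.closure {q | ∃ m, q ∈ gr m},
      f (component h n q) = component h' n (f q) := by
    intro q hq
    induction hq using AddSubgroup.closure_induction with
    | mem q hq =>
      obtain ⟨m, hm⟩ := hq
      rw [component_of_mem h hm, component_of_mem h' (hf m q hm)]
      split_ifs <;> simp
    | zero => simp
    | add x y _ _ hx hy => simp only [map_add, hx, hy]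
    | neg x _ hx => simp only [map_neg, hx]
  refine this p ?_
  rw [hs]
  exact sum_mem fun m _ => AddSubgroup.subset_closure ⟨m, component_mem h m p⟩

end GradedModules

/-! ### Minimal generators of graded projective right modules -/

section Modules

variable {I : Type u} [Fintype I] [DecidableEq I]
variable {M : Type v} [AddCommGroup M] [Module ℂ M] [Module (I → ℂ) M] [Module (I → ℂ)ᵐᵒᵖ M]
  [SMulCommClass (I → ℂ) (I → ℂ)ᵐᵒᵖ M] [IsScalarTower ℂ (I → ℂ) M]
  [IsScalarTower ℂ (I → ℂ)ᵐᵒᵖ M] [FiniteDimensional ℂ M]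
variable {W : Relations I M}
variable {P : Type*} [AddCommGroup P] [Module (QuadAlg W)ᵐᵒᵖ P]
variable {J : Type*} [Fintype J]

variable (W) in
/-- The map `a ↦ ∑ g_j a_j` from a free right module. -/
def rightComb (g : J → P) : (J → QuadAlg W) →ₗ[(QuadAlg W)ᵐᵒᵖ] P where
  toFun a := ∑ j, op (a j) • g j
  map_add' a b := by simp [add_smul, Finset.sum_add_distrib]
  map_smul' c a := by simp [Finset.smul_sum, smul_smul]

variable (W) in
theorem rightComb_apply (g : J → P) (a : J → QuadAlg W) :
    rightComb W g a = ∑ j, op (a j) • g j := rfl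

/-- The families `a` with `e a_j = a_j`. -/
def IsLeftFixed (t : J → I) (a : J → QuadAlg W) : Prop :=
  ∀ j, QuadAlg.ofR W (e (t j)) * a j = a j

theorem rightComb_fix {g : J → P} {t : J → I} (hg : ∀ j, op (QuadAlg.ofR W (e (t j))) • g j = g j)
    (a : J → QuadAlg W) :
    rightComb W g (fun j => QuadAlg.ofR W (e (t j)) * a j) = rightComb W g a := by
  rw [rightComb_apply, rightComb_apply]
  refine Finset.sum_congr rfl fun j _ => ?_
  rw [MulOpposite.op_mul, mul_smul, hg]

theorem isLeftFixed_mul (t : J → I) (a : J → QuadAlg W) :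
    IsLeftFixed t (fun j => QuadAlg.ofR W (e (t j)) * a j) := by
  intro j
  rw [← mul_assoc, ← map_mul, e_mul_e]

/-- A graded Nakayama argument. The entries of `d` have no component of degree zero, so the
component of `a j` in degree `n` is expressed by components of the `a i` in degrees below `n`. -/
theorem eq_zero_of_matrix_aug {a : J → QuadAlg W} (X : ArrowBasis I M) (d : J → J → QuadAlg W)
    (hd : ∀ i j, QuadAlg.aug W (d i j) = 0) (ha : ∀ j, a j = -∑ i, d i j * a i) (j : J) :
    a j = 0 := by
  have key : ∀ n, ∀ j, comp (QuadAlg.deg W) n (a j) = 0 := by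
    intro n
    induction n using Nat.strong_induction_on with
    | _ n ih =>
      intro j
      rw [ha, map_neg, neg_eq_zero, map_sum]
      refine Finset.sum_eq_zero fun i _ => ?_
      rw [comp_apply, map_mul, Polynomial.coeff_mul]
      refine Finset.sum_eq_zero fun p hp => ?_
      have hp := Finset.HasAntidiagonal.mem_antidiagonal.1 hp
      rcases Nat.eq_zero_or_pos p.1 with h0 | h0
      · rw [h0, ← comp_apply, QuadAlg.comp_zero W X, hd, map_zero, zero_mul]
      · rw [← comp_apply (δ := QuadAlg.deg W) p.2, ih p.2 (by omega), mul_zero]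
  exact eq_zero_of_comp (QuadAlg.iSup_homog W) fun n => key n j

/-- A minimal surjection onto a projective module is injective. -/
theorem eq_zero_of_rightComb_eq_zero (X : ArrowBasis I M)
    [Module.Projective (QuadAlg W)ᵐᵒᵖ P] {g : J → P} {t : J → I}
    (hg : ∀ j, op (QuadAlg.ofR W (e (t j))) • g j = g j)
    (hsurj : Function.Surjective (rightComb W g))
    (haug : ∀ a, IsLeftFixed t a → rightComb W g a = 0 → ∀ j, QuadAlg.aug W (a j) = 0)
    {a : J → QuadAlg W} (ha : IsLeftFixed t a) (h0 : rightComb W g a = 0) (j : J) : a j = 0 := by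
  classical
  obtain ⟨s, hs⟩ := Module.projective_lifting_property (rightComb W g) LinearMap.id hsurj
  -- Row `i` is the defect between `s (g i)` and the `i`-th unit vector, cut down by the
  -- idempotents. It lies in the kernel of the surjection, so by minimality its entries have zero
  -- augmentation.
  let d : J → J → QuadAlg W := fun i j =>
    QuadAlg.ofR W (e (t j)) * (s (g i) j - if i = j then 1 else 0)
  refine eq_zero_of_matrix_aug X d (fun i => haug (d i) (isLeftFixed_mul t _) ?_) (fun j => ?_) j
  · rw [rightComb_fix hg]
    have h1 : rightComb W g (s (g i)) = g i := LinearMap.congr_fun hs (g i)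
    rw [rightComb_apply] at h1
    rw [rightComb_apply]
    simp only [MulOpposite.op_sub, sub_smul, Finset.sum_sub_distrib, h1]
    rw [Finset.sum_eq_single i]
    · simp
    · intro k _ hk
      rw [if_neg hk.symm, MulOpposite.op_zero, zero_smul]
    · simp
  -- Applying the splitting `s` to the relation `∑ g_i a_i = 0` gives `a = -d a`, the situation of
  -- the Nakayama argument.
  · have h1 : ∑ i, s (g i) j * a i = 0 := by
      have h2 := congrArg (fun p => s p j) h0
      simpa [rightComb_apply, map_sum, Finset.sum_apply] using h2
    have h3 : ∑ i, d i j * a i = QuadAlg.ofR W (e (t j)) *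
        (∑ i, s (g i) j * a i - ∑ i, (if i = j then 1 else 0) * a i) := by
      rw [← Finset.sum_sub_distrib, Finset.mul_sum]
      refine Finset.sum_congr rfl fun i _ => ?_
      rw [← sub_mul, mul_assoc]
    rw [h3, h1, zero_sub, mul_neg, neg_neg]
    simp [ha j]

variable {gr : ℕ → AddSubgroup P} (hi : DirectSum.IsInternal gr)
  (hs : ∀ k n, ∀ p ∈ gr k, ∀ x ∈ QuadAlg.gr W n, op x • p ∈ gr (k + n))

include hs in
-- Generation in degree `i` is a statement about the ungraded span. Splitting the scalars into
-- homogeneous parts makes it degreewise: degree `k` is reached from degree `i` by scalars of degree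
-- `k - i`.
theorem mem_closure_of_generated {i : ℕ}
    (hgen : Submodule.span (QuadAlg W)ᵐᵒᵖ (gr i : Set P) = ⊤) (p : P) (k : ℕ) :
    component hi k p ∈ AddSubgroup.closure
      {q | ∃ n, i + n = k ∧ ∃ a ∈ homog (QuadAlg.deg W) n, ∃ p ∈ gr i, q = op a • p} := by
  have h1 : p ∈ AddSubgroup.closure
      {q | ∃ n, ∃ a ∈ homog (QuadAlg.deg W) n, ∃ p ∈ gr i, q = op a • p} := by
    have hp : p ∈ Submodule.span (QuadAlg W)ᵐᵒᵖ (gr i : Set P) := hgen ▸ trivial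
    induction hp using Submodule.closure_induction with
    | zero => exact zero_mem _
    | add x y _ _ hx hy => exact add_mem hx hy
    | smul_mem r x hx =>
      have : r = op (r.unop) := rfl
      rw [this, ← sum_comp (QuadAlg.iSup_homog W) r.unop, Finset.op_sum, Finset.sum_smul]
      exact sum_mem fun n _ => AddSubgroup.subset_closure
        ⟨n, _, comp_mem (QuadAlg.iSup_homog W) _ _, x, hx, rfl⟩
  induction h1 using AddSubgroup.closure_induction with
  | mem x hx =>
    obtain ⟨n, a, ha, p, hp, rfl⟩ := hx
    rw [component_of_mem hi (hs i n p hp a (QuadAlg.gr_eq W n ▸ ha))]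
    split_ifs with h
    · exact AddSubgroup.subset_closure ⟨n, h, a, ha, p, hp, rfl⟩
    · exact zero_mem _
  | zero => rw [map_zero]; exact zero_mem _
  | add x y _ _ hx hy => rw [map_add]; exact add_mem hx hy
  | neg x _ hx => rw [map_neg]; exact neg_mem hx

include hi hs in
theorem eq_zero_of_generated {i : ℕ}
    (hgen : Submodule.span (QuadAlg W)ᵐᵒᵖ (gr i : Set P) = ⊤) {k : ℕ} (hk : k < i) {p : P}
    (hp : p ∈ gr k) : p = 0 := by
  have h := mem_closure_of_generated hi hs hgen p k
  rw [component_of_mem hi hp, if_pos rfl] at h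
  have h2 : {q : P | ∃ n, i + n = k ∧ ∃ a ∈ homog (QuadAlg.deg W) n, ∃ p ∈ gr i,
      q = op a • p} = ∅ := by
    ext q
    simp only [Set.mem_ofPred_eq, Set.mem_empty_iff_false, iff_false]
    rintro ⟨n, hn, _⟩
    omega
  rw [h2, AddSubgroup.closure_empty] at h
  simpa using h

variable {t : J → I} {g : J → P}

include hi hs in
-- Coefficients with respect to the generators can be chosen homogeneous and supported on the right
-- idempotents. For `n = 1` they are therefore elements of `M`, which is how linearity of the
-- resolution enters.
theorem exists_rightComb_of_mem {i : ℕ}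
    (hgen : Submodule.span (QuadAlg W)ᵐᵒᵖ (gr i : Set P) = ⊤)
    (hg : ∀ j, op (QuadAlg.ofR W (e (t j))) • g j = g j)
    (hspan : ∀ q ∈ gr i, ∃ c : J → ℂ, q = rightComb W g (fun j => algebraMap ℂ (QuadAlg W) (c j)))
    {n : ℕ} {p : P} (hp : p ∈ gr (i + n)) :
    ∃ a : J → QuadAlg W, IsLeftFixed t a ∧ (∀ j, a j ∈ homog (QuadAlg.deg W) n) ∧
      p = rightComb W g a := by
  have h := mem_closure_of_generated hi hs hgen p (i + n)
  rw [component_of_mem hi hp, if_pos rfl] at h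
  clear hp
  induction h using AddSubgroup.closure_induction with
  | mem x hx =>
    obtain ⟨m, hm, a, ha, q, hq, rfl⟩ := hx
    obtain rfl : m = n := by omega
    obtain ⟨c, rfl⟩ := hspan q hq
    refine ⟨fun j => QuadAlg.ofR W (e (t j)) * (algebraMap ℂ (QuadAlg W) (c j) * a),
      isLeftFixed_mul t _, fun j => ?_, ?_⟩
    · rw [← zero_add m]
      beta_reduce
      rw [← Algebra.smul_def]
      exact mul_mem_homog (QuadAlg.ofR_mem W _) (Submodule.smul_mem _ _ ha)
    · rw [rightComb_fix hg, ← map_smul]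
      rfl
  | zero => exact ⟨0, fun j => by simp, fun j => zero_mem _, by simp⟩
  | add x y _ _ hx hy =>
    obtain ⟨a, ha, ha', rfl⟩ := hx
    obtain ⟨b, hb, hb', rfl⟩ := hy
    exact ⟨a + b, fun j => by rw [Pi.add_apply, mul_add, ha, hb],
      fun j => add_mem (ha' j) (hb' j), by rw [map_add]⟩
  | neg x _ hx =>
    obtain ⟨a, ha, ha', rfl⟩ := hx
    exact ⟨-a, fun j => by rw [Pi.neg_apply, mul_neg, ha], fun j => neg_mem (ha' j),
      by rw [map_neg]⟩

theorem rightComb_surjective {i : ℕ}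
    (hgen : Submodule.span (QuadAlg W)ᵐᵒᵖ (gr i : Set P) = ⊤)
    (hspan : ∀ q ∈ gr i, ∃ c : J → ℂ, q = rightComb W g (fun j => algebraMap ℂ (QuadAlg W) (c j))) :
    Function.Surjective (rightComb W g) := by
  rw [← LinearMap.range_eq_top, eq_top_iff, ← hgen, Submodule.span_le]
  intro q hq
  obtain ⟨c, rfl⟩ := hspan q hq
  exact ⟨_, rfl⟩

include hs in
/-- One step in the comparison of a linear resolution with the Koszul complex: a graded projective
module generated in degree `n`, whose degree `n` part maps bijectively onto the span of the `v_j`,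
is `∏ e_j A`. -/
theorem exists_free_generators (X : ArrowBasis I M) [Module.Projective (QuadAlg W)ᵐᵒᵖ P]
    {N : Type*} [AddCommGroup N] [Module (QuadAlg W)ᵐᵒᵖ N] (d : P →ₗ[(QuadAlg W)ᵐᵒᵖ] N)
    {n : ℕ} (hgen : Submodule.span (QuadAlg W)ᵐᵒᵖ (gr n : Set P) = ⊤)
    (hker : ∀ q ∈ gr n, d q = 0 → q = 0) {v : J → N}
    (hv : ∀ j, op (QuadAlg.ofR W (e (t j))) • v j = v j) (hlift : ∀ j, ∃ p ∈ gr n, d p = v j)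
    (hspan : ∀ q ∈ gr n, ∃ c : J → ℂ, d q = rightComb W v (fun j => algebraMap ℂ (QuadAlg W) (c j)))
    (haug : ∀ a, IsLeftFixed t a → rightComb W v a = 0 → ∀ j, QuadAlg.aug W (a j) = 0) :
    ∃ g : J → P, (∀ j, g j ∈ gr n) ∧ (∀ j, op (QuadAlg.ofR W (e (t j))) • g j = g j) ∧
      (∀ j, d (g j) = v j) ∧
      (∀ q ∈ gr n, ∃ c : J → ℂ, q = rightComb W g (fun j => algebraMap ℂ (QuadAlg W) (c j))) ∧
      ∀ a, IsLeftFixed t a → rightComb W g a = 0 → a = 0 := by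
  choose p hp hdp using hlift
  have hR : ∀ (r : I → ℂ), ∀ q ∈ gr n, op (QuadAlg.ofR W r) • q ∈ gr n := fun r q hq =>
    hs n 0 q hq _ (QuadAlg.gr_eq W 0 ▸ QuadAlg.ofR_mem W r)
  -- Cutting the lift by the idempotent leaves its image unchanged, since `v j` is fixed by that
  -- idempotent.
  let g : J → P := fun j => op (QuadAlg.ofR W (e (t j))) • p j
  have hgm : ∀ j, g j ∈ gr n := fun j => hR _ _ (hp j)
  have hdg : ∀ j, d (g j) = v j := fun j => by simp only [g, map_smul, hdp, hv]
  have hge : ∀ j, op (QuadAlg.ofR W (e (t j))) • g j = g j := fun j => by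
    simp only [g, smul_smul, ← MulOpposite.op_mul, ← map_mul, e_mul_e]
  have hdc : ∀ a, d (rightComb W g a) = rightComb W v a := fun a => by
    simp only [rightComb_apply, map_sum, map_smul, hdg]
  have hsp : ∀ q ∈ gr n, ∃ c : J → ℂ,
      q = rightComb W g (fun j => algebraMap ℂ (QuadAlg W) (c j)) := by
    intro q hq
    obtain ⟨c, hc⟩ := hspan q hq
    refine ⟨c, sub_eq_zero.1 (hker _ (sub_mem hq ?_) ?_)⟩
    · rw [rightComb_apply]
      refine sum_mem fun j _ => ?_
      rw [← AlgHom.commutes (QuadAlg.ofR W)]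
      exact hR _ _ (hgm j)
    · rw [map_sub, hdc, hc, sub_self]
  refine ⟨g, hgm, hge, hdg, hsp, fun a ha h0 => funext fun j => ?_⟩
  refine eq_zero_of_rightComb_eq_zero X hge (rightComb_surjective hgen hsp)
    (fun a ha h0 => haug a ha ?_) ha h0 j
  rw [← hdc, h0, map_zero]

end Modules

end QuadKoszul

end

noncomputable section

namespace QuadKoszul

universe u v w x

/-! ### Linear resolutions and the Koszul complex -/

section KoszulComplex

variable {I : Type u} [Fintype I] [DecidableEq I]
variable {M : Type v} [AddCommGroup M] [Module ℂ M] [Module (I → ℂ) M] [Module (I → ℂ)ᵐᵒᵖ M]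
  [SMulCommClass (I → ℂ) (I → ℂ)ᵐᵒᵖ M] [IsScalarTower ℂ (I → ℂ) M]
  [IsScalarTower ℂ (I → ℂ)ᵐᵒᵖ M] [FiniteDimensional ℂ M]
variable (W : Relations I M)

/-- The left action of `R` on the relations. -/
def Relations.lMap (r : I → ℂ) : W.toSubmodule →ₗ[ℂ] W.toSubmodule :=
  (tensL I r).restrict fun _ ht => W.left_mem r ht

/-- The right action of `R` on the relations. -/
def Relations.rMap (r : I → ℂ) : W.toSubmodule →ₗ[ℂ] W.toSubmodule :=
  (tensR I r).restrict fun _ ht => W.right_mem r ht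

@[simp] theorem Relations.coe_lMap (r : I → ℂ) (t : W.toSubmodule) :
    (W.lMap r t : Tens I M) = tensL I r t := rfl

@[simp] theorem Relations.coe_rMap (r : I → ℂ) (t : W.toSubmodule) :
    (W.rMap r t : Tens I M) = tensR I r t := rfl

theorem tensR_mul (r s : I → ℂ) (t : Tens I M) : tensR I (r * s) t = tensR I r (tensR I s t) := by
  induction t using tens_induction with
  | h0 => simp
  | ht m n => rw [tensR_tmul, tensR_tmul, tensR_tmul, smul_smul, ← MulOpposite.op_mul, mul_comm]
  | ha s t hs ht => simp [hs, ht]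

theorem tensR_add (r s : I → ℂ) (t : Tens I M) :
    tensR I (r + s) t = tensR I r t + tensR I s t := by
  induction t using tens_induction with
  | h0 => simp
  | ht m n => simp [add_smul, tmul_add_right]
  | ha s t hs ht => simp only [map_add, hs, ht]; abel

theorem tensR_smul (c : ℂ) (r : I → ℂ) (t : Tens I M) :
    tensR I (c • r) t = c • tensR I r t := by
  induction t using tens_induction with
  | h0 => simp
  | ht m n => simp [tmul_smul_right]
  | ha s t hs ht => simp only [map_add, hs, ht, smul_add]

theorem tensL_tensR (r s : I → ℂ) (t : Tens I M) :
    tensL I r (tensR I s t) = tensR I s (tensL I r t) := by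
  induction t using tens_induction with
  | h0 => simp
  | ht m n => simp
  | ha s t hs ht => simp only [map_add, hs, ht]

/-- A basis of the relations adapted to the bimodule structure. -/
abbrev RelBasis := AdaptedBasis (I := I) (V := W.toSubmodule) (fun r => W.lMap r)
  (fun r => W.rMap r)

instance : FiniteDimensional ℂ (Tens I M) :=
  inferInstanceAs (FiniteDimensional ℂ ((M ⊗[ℂ] M) ⧸ balancing I M))

theorem exists_relBasis : Nonempty (RelBasis W) :=
  exists_adaptedBasis W.lMap W.rMap
    (fun r s _ => Subtype.ext (tensL_mul r s _)) (fun _ => Subtype.ext (tensL_one _))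
    (fun c r _ => Subtype.ext (tensL_smul c r _)) (fun r s _ => Subtype.ext (tensL_add r s _))
    (fun r s _ => Subtype.ext (tensR_mul r s _)) (fun _ => Subtype.ext (tensR_one _))
    (fun c r _ => Subtype.ext (tensR_smul c r _)) (fun r s _ => Subtype.ext (tensR_add r s _))
    (fun r s _ => Subtype.ext (tensL_tensR r s _))

variable {W}
variable (X : ArrowBasis I M) (Y : RelBasis W)

theorem RelBasis.tensL_basis (r : I → ℂ) (j : Y.ι) :
    tensL I r (Y.basis j : Tens I M) = r (Y.src j) • (Y.basis j : Tens I M) :=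
  congrArg Subtype.val (Y.left r j)

theorem RelBasis.tensR_basis (r : I → ℂ) (j : Y.ι) :
    tensR I r (Y.basis j : Tens I M) = r (Y.tgt j) • (Y.basis j : Tens I M) :=
  congrArg Subtype.val (Y.right r j)

/-- The coefficients `y` of the basic relations `w_j = ∑ x_k ⊗ y_{jk}`. -/
def relCoeff (j : Y.ι) (k : X.ι) : M := ArrowBasis.contr X k (Y.basis j : Tens I M)

theorem e_smul_relCoeff (j : Y.ι) (k : X.ι) :
    e (X.tgt k) • relCoeff X Y j k = relCoeff X Y j k := ArrowBasis.e_smul_contr X k _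

theorem relCoeff_right (r : I → ℂ) (j : Y.ι) (k : X.ι) :
    op r • relCoeff X Y j k = r (Y.tgt j) • relCoeff X Y j k := by
  rw [relCoeff, ← ArrowBasis.contr_tensR, RelBasis.tensR_basis, map_smul]

theorem relCoeff_of_ne {j : Y.ι} {k : X.ι} (h : X.src k ≠ Y.src j) : relCoeff X Y j k = 0 := by
  have h1 : relCoeff X Y j k = e (Y.src j) (X.src k) • relCoeff X Y j k := by
    rw [relCoeff, ← ArrowBasis.contr_tensL, RelBasis.tensL_basis, e_self, one_smul]
  rw [h1, e_of_ne h, zero_smul]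

theorem sum_tmul_relCoeff (j : Y.ι) :
    ∑ k, tmul I (X.basis k) (relCoeff X Y j k) = (Y.basis j : Tens I M) :=
  ArrowBasis.sum_tmul_contr X _

theorem ofR_e_mul_ofM_basis (k : X.ι) :
    QuadAlg.ofR W (e (X.src k)) * QuadAlg.ofM W (X.basis k) = QuadAlg.ofM W (X.basis k) := by
  rw [← QuadAlg.ofM_left, X.left, e_self, one_smul]

theorem ofM_basis_mul_ofR_e (k : X.ι) :
    QuadAlg.ofM W (X.basis k) * QuadAlg.ofR W (e (X.tgt k)) = QuadAlg.ofM W (X.basis k) := by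
  rw [← QuadAlg.ofM_right, X.right, e_self, one_smul]

theorem ofR_e_mul_relCoeff (j : Y.ι) (k : X.ι) :
    QuadAlg.ofR W (e (X.tgt k)) * QuadAlg.ofM W (relCoeff X Y j k) =
      QuadAlg.ofM W (relCoeff X Y j k) := by
  rw [← QuadAlg.ofM_left, e_smul_relCoeff]

theorem relCoeff_mul_ofR_e (j : Y.ι) (k : X.ι) :
    QuadAlg.ofM W (relCoeff X Y j k) * QuadAlg.ofR W (e (Y.tgt j)) =
      QuadAlg.ofM W (relCoeff X Y j k) := by
  rw [← QuadAlg.ofM_right, relCoeff_right, e_self, one_smul]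

theorem mk_ofTens_tmul (m n : M) :
    QuadAlg.mk W (TensAlg.ofTens I M (tmul I m n)) = QuadAlg.ofM W m * QuadAlg.ofM W n := by
  rw [TensAlg.ofTens_tmul, map_mul]; rfl

theorem sum_ofM_mul_relCoeff (j : Y.ι) :
    ∑ k, QuadAlg.ofM W (X.basis k) * QuadAlg.ofM W (relCoeff X Y j k) = 0 := by
  simp only [← mk_ofTens_tmul, ← map_sum, sum_tmul_relCoeff]
  exact QuadAlg.mk_ofTens W (Y.basis j).2

/-- The resolution of `L a` involves only arrows and relations starting at `a`, while the tensor
identities run over the full bases; this passes between the two. -/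
theorem sum_subtype_of_src {T : Type*} [AddCommMonoid T] {ι : Type*} [Fintype ι] (s : ι → I)
    (a : I) (f : ι → T) (hf : ∀ k, s k ≠ a → f k = 0) :
    ∑ k : {k // s k = a}, f k = ∑ k, f k := by
  rw [← Finset.sum_subtype (Finset.univ.filter fun k => s k = a) (by simp) f]
  refine Finset.sum_subset (Finset.subset_univ _) fun k _ hk => hf k ?_
  simpa using hk

theorem sum_subtype_relCoeff {a : I} (j : {j // Y.src j = a}) :
    ∑ k : {k // X.src k = a}, QuadAlg.ofM W (X.basis k) * QuadAlg.ofM W (relCoeff X Y j k) =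
      0 := by
  rw [← sum_ofM_mul_relCoeff X Y j]
  refine sum_subtype_of_src X.src a
    (fun k => QuadAlg.ofM W (X.basis k) * QuadAlg.ofM W (relCoeff X Y j k)) fun k hk => ?_
  rw [relCoeff_of_ne X Y (by rwa [j.2]), map_zero, mul_zero]

theorem aug_eq_of_fixed {i : I} {a : QuadAlg W} (ha : QuadAlg.ofR W (e i) * a = a) :
    QuadAlg.aug W a = QuadAlg.aug W a i • e i := by
  conv_lhs => rw [← ha, map_mul, QuadAlg.aug_ofR, mul_comm, mul_e]

theorem comp_one_ofM_mul (m : M) (a : QuadAlg W) :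
    comp (QuadAlg.deg W) 1 (QuadAlg.ofM W m * a) =
      QuadAlg.ofM W (op (QuadAlg.aug W a) • m) := by
  obtain ⟨X⟩ := exists_arrowBasis I M
  rw [QuadAlg.ofM_right, ← QuadAlg.comp_zero W X]
  exact comp_mul_left (QuadAlg.ofM_mem W m) a 0

theorem aug_eq_zero_of_mem_simpleIdeal {a : I} {x : QuadAlg W} (hx : x ∈ simpleIdeal W a) :
    QuadAlg.aug W x a = 0 := by
  induction hx using Submodule.span_induction with
  | mem x hx =>
    rcases hx with ⟨n, hn, hx⟩ | ⟨b, hb, rfl⟩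
    · obtain ⟨n, rfl⟩ : ∃ m, n = m + 1 := ⟨n - 1, by omega⟩
      rw [QuadAlg.aug_of_mem_succ W (QuadAlg.gr_le W _ hx), Pi.zero_apply]
    · rw [QuadAlg.aug_ofR, e_of_ne hb.symm]
  | zero => simp
  | add x y _ _ hx hy => rw [map_add, Pi.add_apply, hx, hy, add_zero]
  | smul c x _ hx => rw [MulOpposite.smul_eq_mul_unop, map_mul, Pi.mul_apply, hx, zero_mul]

/-- The module `L a` is spanned over `ℂ` by the class of `e a`: positive degrees and the other
idempotents lie in the ideal. -/
theorem mkQ_eq_of_aug (X : ArrowBasis I M) (a : I) (x : QuadAlg W) :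
    (simpleIdeal W a).mkQ x =
      (simpleIdeal W a).mkQ (QuadAlg.ofR W (e a) * algebraMap ℂ _ (QuadAlg.aug W x a)) := by
  rw [← sub_eq_zero, ← map_sub, Submodule.mkQ_apply, Submodule.Quotient.mk_eq_zero]
  have h : ∀ y : QuadAlg W,
      y - QuadAlg.ofR W (e a) * algebraMap ℂ _ (QuadAlg.aug W y a) ∈ simpleIdeal W a := by
    intro y
    have hy : y ∈ ⨆ n, homog (QuadAlg.deg W) n := QuadAlg.iSup_homog W ▸ trivial
    induction hy using Submodule.iSup_induction' with
    | mem i y hy =>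
      rcases Nat.eq_zero_or_pos i with rfl | hi
      · rw [QuadAlg.eq_ofR_of_mem_zero W X hy, QuadAlg.aug_ofR]
        set r := QuadAlg.aug W y
        rw [← AlgHom.commutes (QuadAlg.ofR W), ← map_mul, ← map_sub]
        have : r - e a * algebraMap ℂ (I → ℂ) (r a) =
            ∑ b ∈ Finset.univ.erase a, e b * algebraMap ℂ (I → ℂ) (r b) := by
          rw [sub_eq_iff_eq_add, Finset.sum_erase_add _ _ (Finset.mem_univ a)]
          conv_lhs => rw [← sum_smul_e r]
          exact Finset.sum_congr rfl fun b _ => by rw [Algebra.smul_def, mul_comm]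
        rw [this, map_sum]
        refine sum_mem fun b hb => ?_
        rw [map_mul]
        exact Submodule.smul_mem _ (op _)
          (Submodule.subset_span (Or.inr ⟨b, Finset.ne_of_mem_erase hb, rfl⟩))
      · have h0 : QuadAlg.aug W y = 0 := by
          obtain ⟨n, rfl⟩ : ∃ m, i = m + 1 := ⟨i - 1, by omega⟩
          exact QuadAlg.aug_of_mem_succ W hy
        rw [h0, Pi.zero_apply, map_zero, mul_zero, sub_zero]
        exact Submodule.subset_span (Or.inl ⟨i, hi, QuadAlg.gr_eq W i ▸ hy⟩)
    | zero => simp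
    | add x y _ _ hx hy =>
      rw [map_add, Pi.add_apply, map_add, mul_add, add_sub_add_comm]
      exact add_mem hx hy
  exact h x

attribute [instance] LinearResolution.addCommGroup LinearResolution.module
  LinearResolution.projective

/-! ### The first three terms of a linear resolution of a simple module -/

section Resolution

variable {a : I} (Q : LinearResolution.{u, v, max u v} W a)

theorem LinearResolution.eq_zero_of_lt {i k : ℕ} (hk : k < i) {p : Q.P i} (hp : p ∈ Q.gr i k) :
    p = 0 :=
  eq_zero_of_generated (Q.isInternal i) (Q.smul_mem i) (Q.generated i) hk hp

theorem LinearResolution.d_component (i k : ℕ) (p : Q.P (i + 1)) :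
    Q.d i (component (Q.isInternal (i + 1)) k p) = component (Q.isInternal i) k (Q.d i p) :=
  map_component (Q.isInternal (i + 1)) (Q.isInternal i) (Q.d i).toAddMonoidHom (Q.d_mem i) k p

/-- A kernel element in the lowest degree of `P (i + 1)` would come from degree `i + 1` of `P (i +
2)`, which starts only in degree `i + 2`. -/
theorem LinearResolution.eq_zero_of_d {i : ℕ} {p : Q.P (i + 1)} (hp : p ∈ Q.gr (i + 1) (i + 1))
    (h : Q.d i p = 0) : p = 0 := by
  obtain ⟨q, rfl⟩ := (Q.exact_succ i p).1 h
  have h1 := Q.d_component (i + 1) (i + 1) q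
  rw [component_of_mem _ hp, if_pos rfl] at h1
  rw [← h1, Q.eq_zero_of_lt (Nat.lt_succ_self (i + 1)) (component_mem _ _ q), map_zero]

theorem LinearResolution.exists_lift {i k : ℕ} {p : Q.P (i + 1)} (hp : p ∈ Q.gr (i + 1) k)
    (h : Q.d i p = 0) : ∃ q ∈ Q.gr (i + 1 + 1) k, Q.d (i + 1) q = p := by
  obtain ⟨q, rfl⟩ := (Q.exact_succ i p).1 h
  refine ⟨_, component_mem (Q.isInternal _) k q, ?_⟩
  rw [Q.d_component, component_of_mem _ hp, if_pos rfl]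

theorem LinearResolution.exists_lift_zero {k : ℕ} {p : Q.P 0} (hp : p ∈ Q.gr 0 k)
    (h : Q.ε p = 0) : ∃ q ∈ Q.gr 1 k, Q.d 0 q = p := by
  obtain ⟨q, rfl⟩ := (Q.exact_zero p).1 h
  refine ⟨_, component_mem (Q.isInternal _) k q, ?_⟩
  rw [Q.d_component, component_of_mem _ hp, if_pos rfl]

/-- This identifies `P 0` with `e a A`, generated over the class of `e a` in `L a`. -/
theorem LinearResolution.exists_generators_zero : ∃ g : Unit → Q.P 0, (∀ j, g j ∈ Q.gr 0 0) ∧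
    (∀ j, op (QuadAlg.ofR W (e a)) • g j = g j) ∧
    (∀ j, Q.ε (g j) = (simpleIdeal W a).mkQ (QuadAlg.ofR W (e a))) ∧
    (∀ q ∈ Q.gr 0 0, ∃ c : Unit → ℂ,
      q = rightComb W g (fun j => algebraMap ℂ (QuadAlg W) (c j))) ∧
    ∀ b, IsLeftFixed (fun _ => a) b → rightComb W g b = 0 → b = 0 := by
  obtain ⟨X⟩ := exists_arrowBasis I M
  refine exists_free_generators (t := fun _ : Unit => a) (Q.smul_mem 0) X Q.ε (Q.generated 0) ?_
    (v := fun _ => (simpleIdeal W a).mkQ (QuadAlg.ofR W (e a))) ?_ ?_ ?_ ?_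
  · intro q hq h
    obtain ⟨p, hp, rfl⟩ := Q.exists_lift_zero hq h
    rw [Q.eq_zero_of_lt zero_lt_one hp, map_zero]
  · intro _
    rw [← map_smul, MulOpposite.smul_eq_mul_unop, MulOpposite.unop_op, ← map_mul, e_mul_e]
  · intro _
    obtain ⟨p, hp⟩ := Q.ε_surjective ((simpleIdeal W a).mkQ (QuadAlg.ofR W (e a)))
    refine ⟨component (Q.isInternal 0) 0 p, component_mem _ _ _, ?_⟩
    rw [← hp]
    obtain ⟨s, hs⟩ := exists_sum_component (Q.isInternal 0) p
    -- Since `L a` sits in degree zero, the component of degree zero of a preimage has the same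
    -- image.
    have h1 : ∀ n, n ≠ 0 → Q.ε (component (Q.isInternal 0) n p) = 0 := fun n hn =>
      Q.ε_eq_zero n (Nat.pos_of_ne_zero hn) _ (component_mem _ _ _)
    conv_rhs => rw [hs, map_sum]
    rw [Finset.sum_eq_single 0 (fun n _ hn => h1 n hn)]
    intro h0
    have : component (Q.isInternal 0) 0 p = 0 := by
      rw [hs, map_sum]
      refine Finset.sum_eq_zero fun n hn => ?_
      rw [component_of_mem _ (component_mem _ n p), if_neg]
      rintro rfl
      exact h0 hn
    rw [this, map_zero]
  · intro q _
    obtain ⟨x, hx⟩ := Submodule.mkQ_surjective (simpleIdeal W a) (Q.ε q)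
    refine ⟨fun _ => QuadAlg.aug W x a, ?_⟩
    rw [← hx, mkQ_eq_of_aug X, rightComb_apply, Finset.univ_unique, Finset.sum_singleton,
      ← map_smul, MulOpposite.smul_eq_mul_unop, MulOpposite.unop_op]
  · intro b hb h j
    rw [rightComb_apply, Finset.univ_unique, Finset.sum_singleton, ← map_smul,
      MulOpposite.smul_eq_mul_unop, MulOpposite.unop_op, hb, Submodule.mkQ_apply,
      Submodule.Quotient.mk_eq_zero] at h
    rw [aug_eq_of_fixed (hb j), aug_eq_zero_of_mem_simpleIdeal h, zero_smul]

/-- This identifies `P 1` with the sum of the modules `e A` over the arrows starting at `a`, the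
generator `h k` mapping to the `k`-th arrow. Minimality holds because distinct basis arrows are
linearly independent in degree one of `A`. -/
theorem LinearResolution.exists_generators_one :
    ∃ (g : Q.P 0) (h : {k // X.src k = a} → Q.P 1),
    (∀ b, QuadAlg.ofR W (e a) * b = b → op b • g = 0 → b = 0) ∧
    (∀ k, h k ∈ Q.gr 1 1) ∧
    (∀ k : {k // X.src k = a}, op (QuadAlg.ofR W (e (X.tgt k))) • h k = h k) ∧
    (∀ k, Q.d 0 (h k) = op (QuadAlg.ofM W (X.basis k)) • g) ∧
    (∀ q ∈ Q.gr 1 1, ∃ c : {k // X.src k = a} → ℂ,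
      q = rightComb W h (fun j => algebraMap ℂ (QuadAlg W) (c j))) ∧
    ∀ b, IsLeftFixed (fun k : {k // X.src k = a} => X.tgt k) b → rightComb W h b = 0 → b = 0 := by
  obtain ⟨g, hg0, hge, hgε, hgs, hgi⟩ := Q.exists_generators_zero
  have hgi' : ∀ b, QuadAlg.ofR W (e a) * b = b → op b • g () = 0 → b = 0 := by
    intro b hb hb0
    exact congrFun (hgi (fun _ => b) (fun _ => hb) (by simpa [rightComb_apply] using hb0)) ()
  have hx : ∀ k : {k // X.src k = a}, QuadAlg.ofR W (e a) * QuadAlg.ofM W (X.basis k) =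
      QuadAlg.ofM W (X.basis k) := by
    rintro ⟨k, rfl⟩; exact ofR_e_mul_ofM_basis X k
  refine Exists.elim (exists_free_generators (t := fun k : {k // X.src k = a} => X.tgt k)
    (Q.smul_mem 1) X (Q.d 0) (Q.generated 1) (fun q hq h => Q.eq_zero_of_d hq h)
    (v := fun k => op (QuadAlg.ofM W (X.basis k)) • g ()) ?_ ?_ ?_ ?_)
    (fun h hh => ⟨g (), h, hgi', hh⟩)
  · intro k
    rw [smul_smul, ← MulOpposite.op_mul, ofM_basis_mul_ofR_e]
  · intro k
    refine Q.exists_lift_zero (Q.smul_mem 0 0 1 _ (hg0 ()) _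
      (QuadAlg.gr_eq W 1 ▸ QuadAlg.ofM_mem W _)) ?_
    rw [map_smul, hgε, ← map_smul, MulOpposite.smul_eq_mul_unop, MulOpposite.unop_op, hx,
      Submodule.mkQ_apply, Submodule.Quotient.mk_eq_zero]
    exact Submodule.subset_span (Or.inl ⟨1, le_rfl, QuadAlg.gr_eq W 1 ▸ QuadAlg.ofM_mem W _⟩)
  · intro q hq
    obtain ⟨b, hb, hb1, hbq⟩ := exists_rightComb_of_mem (Q.isInternal 0) (Q.smul_mem 0)
      (Q.generated 0) hge hgs (n := 1) (p := Q.d 0 q) (by simpa using Q.d_mem 0 1 q hq)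
    obtain ⟨m, hm⟩ := QuadAlg.exists_ofM_of_mem_one W X (hb1 ())
    refine ⟨fun k => ArrowBasis.coord X k m, ?_⟩
    rw [hbq, rightComb_apply, rightComb_apply, Finset.univ_unique, Finset.sum_singleton]
    simp only [smul_smul, ← Finset.sum_smul, ← MulOpposite.op_mul, ← Finset.op_sum]
    congr 2
    rw [← hb, show b default = b () from rfl, hm, ← QuadAlg.ofM_left]
    conv_lhs => rw [← ArrowBasis.sum_coord X m, Finset.smul_sum, map_sum]
    rw [← sum_subtype_of_src X.src a]
    · refine Finset.sum_congr rfl fun k _ => ?_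
      rw [smul_comm, map_smul, QuadAlg.ofM_left, hx, Algebra.smul_def, Algebra.commutes]
    · intro k hk
      rw [smul_comm, X.left, e_of_ne hk, zero_smul, smul_zero, map_zero]
  · intro b hb h
    rw [rightComb_apply] at h
    simp only [smul_smul, ← MulOpposite.op_mul, ← Finset.sum_smul, ← Finset.op_sum] at h
    have h1 := hgi' _ (by
      rw [Finset.mul_sum]
      exact Finset.sum_congr rfl fun k _ => by rw [← mul_assoc, hx]) h
    have h2 := congrArg (comp (QuadAlg.deg W) 1) h1
    simp only [map_sum, comp_one_ofM_mul, X.right, map_zero] at h2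
    -- In degree one only the augmentations of the coefficients contribute, giving a linear relation
    -- between basis arrows.
    rw [← map_sum, map_eq_zero_iff _ (QuadAlg.ofM_injective W)] at h2
    intro k
    have h3 := (Fintype.linearIndependent_iff.1
      (X.basis.linearIndependent.comp (Subtype.val : {k // X.src k = a} → X.ι)
        Subtype.val_injective)) _ h2 k
    rw [aug_eq_of_fixed (hb k), h3, zero_smul]

/-- This identifies `P 2` with the sum of the modules `e A` over the basic relations starting at
`a`, the generator `f j` mapping to `(y_jk)_k`. The reason is that the kernel of `P 1 → P 0` in
degree two consists of tensors `∑ x_k ⊗ n_k` that vanish in `A`, which are exactly the relations. -/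
theorem LinearResolution.exists_generators_two :
    ∃ (h : {k // X.src k = a} → Q.P 1) (f : {j // Y.src j = a} → Q.P 2),
    (∀ b, IsLeftFixed (fun k : {k // X.src k = a} => X.tgt k) b → rightComb W h b = 0 → b = 0) ∧
    (∀ j : {j // Y.src j = a}, op (QuadAlg.ofR W (e (Y.tgt j))) • f j = f j) ∧
    (∀ j, Q.d 1 (f j) = rightComb W h (fun k => QuadAlg.ofM W (relCoeff X Y j k))) ∧
    (∀ q ∈ Q.gr 2 2, ∃ c : {j // Y.src j = a} → ℂ,
      q = rightComb W f (fun j => algebraMap ℂ (QuadAlg W) (c j))) ∧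
    ∀ b, IsLeftFixed (fun j : {j // Y.src j = a} => Y.tgt j) b → rightComb W f b = 0 → b = 0 := by
  obtain ⟨g, h, hgi, hh1, hhe, hhd, hhs, hhi⟩ := Q.exists_generators_one X
  have hx : ∀ k : {k // X.src k = a}, QuadAlg.ofR W (e a) * QuadAlg.ofM W (X.basis k) =
      QuadAlg.ofM W (X.basis k) := by
    rintro ⟨k, rfl⟩; exact ofR_e_mul_ofM_basis X k
  have hdd : ∀ b, Q.d 0 (rightComb W h b) =
      op (∑ k : {k // X.src k = a}, QuadAlg.ofM W (X.basis k) * b k) • g := by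
    intro b
    simp only [rightComb_apply, map_sum, map_smul, hhd, smul_smul, ← MulOpposite.op_mul,
      ← Finset.sum_smul, ← Finset.op_sum]
  refine Exists.elim (exists_free_generators (t := fun j : {j // Y.src j = a} => Y.tgt j)
    (Q.smul_mem 2) X (Q.d 1) (Q.generated 2) (fun q hq h => Q.eq_zero_of_d hq h)
    (v := fun j => rightComb W h (fun k => QuadAlg.ofM W (relCoeff X Y j k))) ?_ ?_ ?_ ?_)
    (fun f hf => ⟨h, f, hhi, hf.2⟩)
  · intro j
    rw [← map_smul]
    congr 1
    funext k
    exact relCoeff_mul_ofR_e X Y j k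
  · intro j
    refine Q.exists_lift ?_ ?_
    · rw [rightComb_apply]
      exact sum_mem fun k _ => Q.smul_mem 1 1 1 _ (hh1 k) _
        (QuadAlg.gr_eq W 1 ▸ QuadAlg.ofM_mem W _)
    · rw [hdd, sum_subtype_relCoeff, MulOpposite.op_zero, zero_smul]
  · intro q hq
    obtain ⟨b, hb, hb1, hbq⟩ := exists_rightComb_of_mem (Q.isInternal 1) (Q.smul_mem 1)
      (Q.generated 1) hhe hhs (n := 1) (p := Q.d 1 q) (Q.d_mem 1 2 q hq)
    choose n' hn' using fun k => QuadAlg.exists_ofM_of_mem_one W X (hb1 k)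
    have hne : ∀ k : {k // X.src k = a}, e (X.tgt k) • n' k = n' k := fun k => QuadAlg.ofM_injective W (by
      rw [QuadAlg.ofM_left, ← hn']; exact hb k)
    -- The coefficients are extended by zero to all arrows, so that the contraction formulas over
    -- the whole basis apply.
    let n : X.ι → M := fun k => if hk : X.src k = a then n' ⟨k, hk⟩ else 0
    have hn : ∀ k : {k // X.src k = a}, n k = n' k := fun k => dif_pos k.2
    have hn0 : ∀ k, X.src k ≠ a → n k = 0 := fun k hk => dif_neg hk
    have hne' : ∀ k, e (X.tgt k) • n k = n k := fun k => by
      by_cases hk : X.src k = a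
      · rw [show n k = n' ⟨k, hk⟩ from hn ⟨k, hk⟩]; exact hne ⟨k, hk⟩
      · rw [hn0 k hk, smul_zero]
    have h1 : op (∑ k : {k // X.src k = a}, QuadAlg.ofM W (X.basis k) * b k) • g = 0 := by
      rw [← hdd, ← hbq]
      exact (Q.exact_succ 0 _).2 ⟨q, rfl⟩
    have h2 := hgi _ (by
      rw [Finset.mul_sum]
      exact Finset.sum_congr rfl fun k _ => by rw [← mul_assoc, hx]) h1
    have h3 : ∑ k, tmul I (X.basis k) (n k) ∈ W.toSubmodule := by
      rw [← QuadAlg.mk_ofTens_eq_zero_iff, ← h2]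
      simp only [map_sum, mk_ofTens_tmul]
      rw [← sum_subtype_of_src X.src a]
      · exact Finset.sum_congr rfl fun k _ => by rw [hn, hn']
      · intro k hk
        rw [hn0 k hk, map_zero, mul_zero]
    set t : W.toSubmodule := ⟨_, h3⟩ with ht
    have ht' : (t : Tens I M) = ∑ j, Y.basis.repr t j • (Y.basis j : Tens I M) := by
      conv_lhs => rw [← Y.basis.sum_repr t]
      push_cast
      rfl
    refine ⟨fun j => Y.basis.repr t j, ?_⟩
    -- Contracting the relation `t` with each arrow expresses the coefficients through the basic
    -- relations; those not starting at `a` do not contribute.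
    have h4 : ∀ k : {k // X.src k = a}, n' k =
        ∑ j : {j // Y.src j = a}, Y.basis.repr t j • relCoeff X Y j k := by
      intro k
      rw [← hn, ← ArrowBasis.contr_sum X n hne' k, show ∑ k, tmul I (X.basis k) (n k) = t from rfl,
        ht', map_sum, ← sum_subtype_of_src Y.src a]
      · simp only [map_smul]; rfl
      · intro j hj
        rw [map_smul, show ArrowBasis.contr X k (Y.basis j : Tens I M) = relCoeff X Y j k from rfl,
          relCoeff_of_ne X Y (by rw [k.2]; exact hj.symm), smul_zero]
    rw [hbq, rightComb_apply, rightComb_apply]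
    simp only [rightComb_apply, Finset.smul_sum, smul_smul, ← MulOpposite.op_mul]
    rw [Finset.sum_comm]
    refine Finset.sum_congr rfl fun k _ => ?_
    rw [← Finset.sum_smul, ← Finset.op_sum, hn', h4, map_sum]
    congr 2
    refine Finset.sum_congr rfl fun j _ => ?_
    rw [map_smul, Algebra.smul_def, Algebra.commutes]
  · intro b hb h0
    have h1 : rightComb W h (fun k => ∑ j : {j // Y.src j = a},
        QuadAlg.ofM W (relCoeff X Y j k) * b j) = 0 := by
      rw [← h0]
      simp only [rightComb_apply, Finset.smul_sum, smul_smul, ← MulOpposite.op_mul,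
        Finset.op_sum, Finset.sum_smul]
      rw [Finset.sum_comm]
    have h2 := hhi _ (fun k => by
      rw [Finset.mul_sum]
      exact Finset.sum_congr rfl fun j _ => by rw [← mul_assoc, ofR_e_mul_relCoeff]) h1
    -- Minimality: the degree one part of the equations says that the combination of basic relations
    -- with the augmentations as coefficients has all contractions zero, hence is zero.
    have h3 : ∀ k : X.ι, ArrowBasis.contr X k (∑ j : {j // Y.src j = a},
        QuadAlg.aug W (b j) (Y.tgt j) • (Y.basis j : Tens I M)) = 0 := by
      intro k
      rw [map_sum]
      by_cases hk : X.src k = a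
      · have h4 := congrArg (comp (QuadAlg.deg W) 1) (congrFun h2 ⟨k, hk⟩)
        simp only [map_sum, comp_one_ofM_mul, relCoeff_right, Pi.zero_apply, map_zero] at h4
        rw [← map_sum, map_eq_zero_iff _ (QuadAlg.ofM_injective W)] at h4
        rw [← h4]
        simp only [map_smul]; rfl
      · refine Finset.sum_eq_zero fun j _ => ?_
        rw [map_smul, show ArrowBasis.contr X k (Y.basis j : Tens I M) = relCoeff X Y j k from rfl,
          relCoeff_of_ne X Y (by rw [j.2]; exact hk), smul_zero]
    have h5 : ∑ j : {j // Y.src j = a}, QuadAlg.aug W (b j) (Y.tgt j) • Y.basis j = 0 := by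
      refine Subtype.ext ?_
      push_cast
      rw [← ArrowBasis.sum_tmul_contr X
        (∑ j : {j // Y.src j = a}, QuadAlg.aug W (b j) (Y.tgt j) • (Y.basis j : Tens I M))]
      simp only [h3]
      simp [← tmulBil_apply]
    intro j
    have h6 := (Fintype.linearIndependent_iff.1
      (Y.basis.linearIndependent.comp (Subtype.val : {j // Y.src j = a} → Y.ι)
        Subtype.val_injective)) _ h5 j
    rw [aug_eq_of_fixed (hb j), h6, zero_smul]

end Resolution

/-- The families `(c_j b)_j`, for linear syzygies `c` between the relations. -/
def linearSyzygies : Set (Y.ι → QuadAlg W) :=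
  {z | ∃ (c : Y.ι → M) (b : QuadAlg W), (∀ j, e (Y.tgt j) • c j = c j) ∧
    (∀ k, ∑ j, QuadAlg.ofM W (relCoeff X Y j k) * QuadAlg.ofM W (c j) = 0) ∧
    z = fun j => QuadAlg.ofM W (c j) * b}

/-- Under the identification of `P 2` and `P 1` with free-type modules, `z` is a cycle in `P 2`,
hence a boundary from `P 3`. Freeness of `P 2` turns equality of images into equality of coefficient
families. -/
theorem mem_span_linearSyzygies_of_resolution {a : I} (Q : LinearResolution.{u, v, max u v} W a)
    {z : Y.ι → QuadAlg W} (hz : IsLeftFixed Y.tgt z) (hza : ∀ j, Y.src j ≠ a → z j = 0)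
    (h : ∀ k, ∑ j, QuadAlg.ofM W (relCoeff X Y j k) * z j = 0) :
    z ∈ Submodule.span ℂ (linearSyzygies X Y) := by
  obtain ⟨g, f, hgi, hfe, hfd, hfs, hfi⟩ := Q.exists_generators_two X Y
  have hd : ∀ b, Q.d 1 (rightComb W f b) = rightComb W g (fun k =>
      ∑ j : {j // Y.src j = a}, QuadAlg.ofM W (relCoeff X Y j k) * b j) := by
    intro b
    simp only [rightComb_apply, map_sum, map_smul, hfd, Finset.smul_sum, smul_smul,
      ← MulOpposite.op_mul, Finset.op_sum, Finset.sum_smul]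
    rw [Finset.sum_comm]
  have h0 : Q.d 1 (rightComb W f fun j => z j) = 0 := by
    rw [hd]
    have : (fun k : {k // X.src k = a} => ∑ j : {j // Y.src j = a},
        QuadAlg.ofM W (relCoeff X Y j k) * z j) = 0 := by
      funext k
      rw [Pi.zero_apply, ← h k]
      refine sum_subtype_of_src Y.src a
        (fun j => QuadAlg.ofM W (relCoeff X Y j k) * z j) fun j hj => ?_
      rw [hza j hj, mul_zero]
    rw [this, map_zero]
  obtain ⟨p, hp⟩ := (Q.exact_succ 1 _).1 h0
  have key : ∀ p : Q.P 3, ∃ z' ∈ Submodule.span ℂ (linearSyzygies X Y), IsLeftFixed Y.tgt z' ∧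
      (∀ j, Y.src j ≠ a → z' j = 0) ∧ Q.d 2 p = rightComb W f fun j => z' j := by
    intro p
    have hp : p ∈ Submodule.span (QuadAlg W)ᵐᵒᵖ (Q.gr 3 3 : Set (Q.P 3)) := Q.generated 3 ▸ trivial
    induction hp using Submodule.closure_induction with
    | zero => exact ⟨0, zero_mem _, fun j => by simp, fun _ _ => rfl, by
        rw [map_zero]; exact (map_zero (rightComb W f)).symm⟩
    | add x y _ _ hx hy =>
      obtain ⟨z, hz, hz1, hz2, hz3⟩ := hx
      obtain ⟨z', hz', hz1', hz2', hz3'⟩ := hy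
      refine ⟨z + z', add_mem hz hz', fun j => ?_, fun j hj => ?_, ?_⟩
      · rw [Pi.add_apply, mul_add, hz1, hz1']
      · rw [Pi.add_apply, hz2 j hj, hz2' j hj, add_zero]
      · rw [map_add, hz3, hz3', ← map_add]; rfl
    | smul_mem r x hx =>
      -- A generator `x` of `P 3` has degree three and `P 2` is generated in degree two, so the
      -- coefficients of its image have degree one. They form a syzygy because `d ∘ d = 0` and the
      -- generators of `P 1` are free.
      obtain ⟨b, hb, hb1, hbx⟩ := exists_rightComb_of_mem (Q.isInternal 2) (Q.smul_mem 2)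
        (Q.generated 2) hfe hfs (n := 1) (p := Q.d 2 x) (Q.d_mem 2 3 x hx)
      choose c' hc' using fun j => QuadAlg.exists_ofM_of_mem_one W X (hb1 j)
      have hce : ∀ j : {j // Y.src j = a}, e (Y.tgt j) • c' j = c' j := fun j => QuadAlg.ofM_injective W (by
        rw [QuadAlg.ofM_left, ← hc']; exact hb j)
      let c : Y.ι → M := fun j => if hj : Y.src j = a then c' ⟨j, hj⟩ else 0
      have hc : ∀ j : {j // Y.src j = a}, c j = c' j := fun j => dif_pos j.2
      have hc0 : ∀ j, Y.src j ≠ a → c j = 0 := fun j hj => dif_neg hj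
      have hce' : ∀ j, e (Y.tgt j) • c j = c j := fun j => by
        by_cases hj : Y.src j = a
        · rw [show c j = c' ⟨j, hj⟩ from hc ⟨j, hj⟩]; exact hce ⟨j, hj⟩
        · rw [hc0 j hj, smul_zero]
      refine ⟨fun j => QuadAlg.ofM W (c j) * r.unop, Submodule.subset_span
        ⟨c, r.unop, hce', fun k => ?_, rfl⟩, fun j => ?_, fun j hj => ?_, ?_⟩
      · by_cases hk : X.src k = a
        · have h1 : Q.d 1 (rightComb W f b) = 0 := by
            rw [← hbx]; exact (Q.exact_succ 1 _).2 ⟨x, rfl⟩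
          rw [hd] at h1
          have h2 := congrFun (hgi _ (fun k => by
            rw [Finset.mul_sum]
            exact Finset.sum_congr rfl fun j _ => by rw [← mul_assoc, ofR_e_mul_relCoeff]) h1)
            ⟨k, hk⟩
          rw [Pi.zero_apply] at h2
          rw [← h2, ← sum_subtype_of_src Y.src a]
          · exact Finset.sum_congr rfl fun j _ => by rw [hc, hc']
          · intro j hj
            rw [hc0 j hj, map_zero, mul_zero]
        · refine Finset.sum_eq_zero fun j _ => ?_
          by_cases hj : Y.src j = a
          · rw [relCoeff_of_ne X Y (by rw [hj]; exact hk), map_zero, zero_mul]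
          · rw [hc0 j hj, map_zero, mul_zero]
      · rw [← mul_assoc, ← QuadAlg.ofM_left, hce']
      · beta_reduce
        rw [hc0 j hj, map_zero, zero_mul]
      · rw [map_smul, hbx, ← map_smul]
        congr 1
        funext j
        beta_reduce
        rw [Pi.smul_apply, MulOpposite.smul_eq_mul_unop, hc', hc]
  obtain ⟨z', hz', hz1', hz2', hz3'⟩ := key p
  rw [hp, ← sub_eq_zero, ← map_sub] at hz3'
  have h1 := hfi _ (fun j => by
    rw [Pi.sub_apply, mul_sub, hz, hz1']) hz3'
  have : z = z' := by
    funext j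
    by_cases hj : Y.src j = a
    · exact sub_eq_zero.1 (congrFun h1 ⟨j, hj⟩)
    · rw [hza j hj, hz2' j hj]
  rw [this]
  exact hz'

/-- For a Koszul algebra the syzygies between the relations are generated by the linear ones. -/
theorem mem_span_linearSyzygies (hA : IsKoszul W)
    {z : Y.ι → QuadAlg W} (hz : IsLeftFixed Y.tgt z)
    (h : ∀ k, ∑ j, QuadAlg.ofM W (relCoeff X Y j k) * z j = 0) :
    z ∈ Submodule.span ℂ (linearSyzygies X Y) := by
  -- Syzygies split according to the source vertex of the relations, and each piece is handled by
  -- the resolution of the corresponding simple module.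
  have hsum : z = ∑ a : I, fun j => if Y.src j = a then z j else 0 := by
    funext j
    rw [Finset.sum_apply]
    simp
  rw [hsum]
  refine sum_mem fun a _ => ?_
  obtain ⟨Q⟩ := hA a
  refine mem_span_linearSyzygies_of_resolution X Y Q (fun j => ?_) (fun j hj => if_neg hj)
    fun k => ?_
  · split_ifs
    · exact hz j
    · rw [mul_zero]
  · by_cases hk : X.src k = a
    · rw [← h k]
      refine Finset.sum_congr rfl fun j _ => ?_
      split_ifs with hj
      · rfl
      · rw [relCoeff_of_ne X Y (by rw [hk]; exact fun h => hj h.symm), map_zero, zero_mul,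
          zero_mul]
    · refine Finset.sum_eq_zero fun j _ => ?_
      split_ifs with hj
      · rw [relCoeff_of_ne X Y (by rw [hj]; exact hk), map_zero, zero_mul]
      · rw [mul_zero]

end KoszulComplex

end QuadKoszul

end

noncomputable section

namespace QuadKoszul

universe u v w x

/-! ### The Poincaré–Birkhoff–Witt argument -/

section PBW

variable {I : Type u} [Fintype I] [DecidableEq I]
variable {M : Type v} [AddCommGroup M] [Module ℂ M] [Module (I → ℂ) M] [Module (I → ℂ)ᵐᵒᵖ M]
  [SMulCommClass (I → ℂ) (I → ℂ)ᵐᵒᵖ M] [IsScalarTower ℂ (I → ℂ) M]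
  [IsScalarTower ℂ (I → ℂ)ᵐᵒᵖ M] [FiniteDimensional ℂ M]
variable {W : Relations I M}
variable {U : Type w} [AddCommGroup U] [Module ℂ U]

variable (I M U) in
/-- The inclusion `T_R(M) → S ⊗ T_R(M)`. -/
abbrev inc : TensAlg I M →ₐ[ℂ] SymmetricAlgebra ℂ U ⊗[ℂ] TensAlg I M :=
  Algebra.TensorProduct.includeRight

theorem inc_apply (t : TensAlg I M) :
    inc I M U t = (1 : SymmetricAlgebra ℂ U) ⊗ₜ[ℂ] t := rfl

theorem ofRU_tmul (r : I → ℂ) (z : U) :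
    ofRU I M U (r ⊗ₜ z) = SymmetricAlgebra.ι ℂ U z • inc I M U (TensAlg.ofR I M r) := by
  simp [ofRU, TensorProduct.smul_tmul']

theorem ofRU_left (r : I → ℂ) (p : (I → ℂ) ⊗[ℂ] U) :
    ofRU I M U (r • p) = inc I M U (TensAlg.ofR I M r) * ofRU I M U p := by
  induction p using TensorProduct.induction_on with
  | zero => simp
  | tmul s z =>
    rw [TensorProduct.smul_tmul', ofRU_tmul, ofRU_tmul, smul_eq_mul, map_mul, map_mul,
      mul_smul_comm]
  | add p q hp hq => rw [smul_add, map_add, map_add, mul_add, hp, hq]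

theorem ofRU_right (r : I → ℂ) (p : (I → ℂ) ⊗[ℂ] U) :
    ofRU I M U (op r • p) = ofRU I M U p * inc I M U (TensAlg.ofR I M r) := by
  induction p using TensorProduct.induction_on with
  | zero => simp
  | tmul s z =>
    rw [TensorProduct.smul_tmul', ofRU_tmul, ofRU_tmul, MulOpposite.smul_eq_mul_unop, map_mul,
      map_mul, smul_mul_assoc]
    rfl
  | add p q hp hq => rw [smul_add, map_add, map_add, add_mul, hp, hq]

variable (Ψ : W.toSubmodule →ₗ[ℂ] (I → ℂ) ⊗[ℂ] U)

/-- The map `w ↦ Ψ(w)` from `W` to `S ⊗ T_R(M)`. -/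
def psiHat : W.toSubmodule →ₗ[ℂ] SymmetricAlgebra ℂ U ⊗[ℂ] TensAlg I M := ofRU I M U ∘ₗ Ψ

/-- The relators `1 ⊗ w - Ψ(w)` of `Ã_Ψ`. -/
def relator : W.toSubmodule →ₗ[ℂ] SymmetricAlgebra ℂ U ⊗[ℂ] TensAlg I M :=
  (inc I M U).toLinearMap ∘ₗ TensAlg.ofTens I M ∘ₗ W.toSubmodule.subtype - psiHat Ψ

theorem relator_apply (t : W.toSubmodule) :
    relator Ψ t = inc I M U (TensAlg.ofTens I M t) - psiHat Ψ t := rfl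

variable {Ψ}

theorem psiHat_lMap (hΨ : IsBimoduleMap W Ψ) (r : I → ℂ) (t : W.toSubmodule) :
    psiHat Ψ (W.lMap r t) = inc I M U (TensAlg.ofR I M r) * psiHat Ψ t := by
  rw [psiHat, LinearMap.comp_apply, LinearMap.comp_apply, ← ofRU_left, ← (hΨ r t).1]
  rfl

theorem psiHat_rMap (hΨ : IsBimoduleMap W Ψ) (r : I → ℂ) (t : W.toSubmodule) :
    psiHat Ψ (W.rMap r t) = psiHat Ψ t * inc I M U (TensAlg.ofR I M r) := by
  rw [psiHat, LinearMap.comp_apply, LinearMap.comp_apply, ← ofRU_right, ← (hΨ r t).2]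
  rfl

theorem relator_lMap (hΨ : IsBimoduleMap W Ψ) (r : I → ℂ) (t : W.toSubmodule) :
    relator Ψ (W.lMap r t) = inc I M U (TensAlg.ofR I M r) * relator Ψ t := by
  rw [relator_apply, relator_apply, mul_sub, psiHat_lMap hΨ, Relations.coe_lMap,
    TensAlg.ofTens_tensL, map_mul]

theorem relator_rMap (hΨ : IsBimoduleMap W Ψ) (r : I → ℂ) (t : W.toSubmodule) :
    relator Ψ (W.rMap r t) = relator Ψ t * inc I M U (TensAlg.ofR I M r) := by
  rw [relator_apply, relator_apply, sub_mul, psiHat_rMap hΨ, Relations.coe_rMap,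
    TensAlg.ofTens_tensR, map_mul]

variable (W) in
/-- The map `W ⊗ M → T_R(M)`. -/
def relM : W.toSubmodule ⊗[ℂ] M →ₗ[ℂ] TensAlg I M :=
  TensorProduct.lift ((LinearMap.mul ℂ (TensAlg I M)).compl₁₂
    (TensAlg.ofTens I M ∘ₗ W.toSubmodule.subtype) (TensAlg.ofM I M))

variable (W) in
/-- The map `M ⊗ W → T_R(M)`. -/
def mRel : M ⊗[ℂ] W.toSubmodule →ₗ[ℂ] TensAlg I M :=
  TensorProduct.lift ((LinearMap.mul ℂ (TensAlg I M)).compl₁₂ (TensAlg.ofM I M)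
    (TensAlg.ofTens I M ∘ₗ W.toSubmodule.subtype))

variable (Ψ) in
/-- The map `Ψ ⊗ 1` from `W ⊗ M` to `S ⊗ T_R(M)`. -/
def psiM : W.toSubmodule ⊗[ℂ] M →ₗ[ℂ] SymmetricAlgebra ℂ U ⊗[ℂ] TensAlg I M :=
  TensorProduct.lift ((LinearMap.mul ℂ (SymmetricAlgebra ℂ U ⊗[ℂ] TensAlg I M)).compl₁₂
    (psiHat Ψ) ((inc I M U).toLinearMap ∘ₗ TensAlg.ofM I M))

variable (Ψ) in
/-- The map `1 ⊗ Ψ` from `M ⊗ W` to `S ⊗ T_R(M)`. -/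
def mPsi : M ⊗[ℂ] W.toSubmodule →ₗ[ℂ] SymmetricAlgebra ℂ U ⊗[ℂ] TensAlg I M :=
  TensorProduct.lift ((LinearMap.mul ℂ (SymmetricAlgebra ℂ U ⊗[ℂ] TensAlg I M)).compl₁₂
    ((inc I M U).toLinearMap ∘ₗ TensAlg.ofM I M) (psiHat Ψ))

@[simp] theorem relM_tmul (t : W.toSubmodule) (m : M) :
    relM W (t ⊗ₜ m) = TensAlg.ofTens I M t * TensAlg.ofM I M m := rfl

@[simp] theorem mRel_tmul (t : W.toSubmodule) (m : M) :
    mRel W (m ⊗ₜ t) = TensAlg.ofM I M m * TensAlg.ofTens I M t := rfl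

@[simp] theorem psiM_tmul (t : W.toSubmodule) (m : M) :
    psiM Ψ (t ⊗ₜ m) = psiHat Ψ t * inc I M U (TensAlg.ofM I M m) := rfl

@[simp] theorem mPsi_tmul (t : W.toSubmodule) (m : M) :
    mPsi Ψ (m ⊗ₜ t) = inc I M U (TensAlg.ofM I M m) * psiHat Ψ t := rfl

variable (Ψ) in
/-- The condition that `Ψ ⊗ 1 = 1 ⊗ Ψ` on `W ⊗ M ∩ M ⊗ W`. -/
def IsPBW : Prop :=
  ∀ (p : W.toSubmodule ⊗[ℂ] M) (q : M ⊗[ℂ] W.toSubmodule), relM W p = mRel W q →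
    psiM Ψ p = mPsi Ψ q

variable (I M U) in
/-- The diagonal map `T_R(M) → T_R(M) × (S ⊗ T_R(M))`. -/
def diag : TensAlg I M →ₐ[ℂ] TensAlg I M × (SymmetricAlgebra ℂ U ⊗[ℂ] TensAlg I M) :=
  (AlgHom.id ℂ _).prod (inc I M U)

theorem diag_apply (t : TensAlg I M) : diag I M U t = (t, inc I M U t) := rfl

variable (Ψ) in
/-- The pairs `(w, w - Ψ(w))`. -/
def relPair : W.toSubmodule →ₗ[ℂ] TensAlg I M × (SymmetricAlgebra ℂ U ⊗[ℂ] TensAlg I M) :=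
  (TensAlg.ofTens I M ∘ₗ W.toSubmodule.subtype).prod (relator Ψ)

theorem relPair_apply (t : W.toSubmodule) :
    relPair Ψ t = (TensAlg.ofTens I M t, relator Ψ t) := rfl

theorem relPair_lMap (hΨ : IsBimoduleMap W Ψ) (r : I → ℂ) (t : W.toSubmodule) :
    relPair Ψ (W.lMap r t) = diag I M U (TensAlg.ofR I M r) * relPair Ψ t := by
  rw [relPair_apply, relPair_apply, diag_apply, Prod.mk_mul_mk, relator_lMap hΨ,
    Relations.coe_lMap, TensAlg.ofTens_tensL]

theorem relPair_rMap (hΨ : IsBimoduleMap W Ψ) (r : I → ℂ) (t : W.toSubmodule) :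
    relPair Ψ (W.rMap r t) = relPair Ψ t * diag I M U (TensAlg.ofR I M r) := by
  rw [relPair_apply, relPair_apply, diag_apply, Prod.mk_mul_mk, relator_rMap hΨ,
    Relations.coe_rMap, TensAlg.ofTens_tensR]

variable (Ψ) in
/-- The span of the pairs `(a w b, a (w - Ψ(w)) b)` with `a w b` of degree `n`. -/
def relPairs (n : ℕ) : Submodule ℂ (TensAlg I M × (SymmetricAlgebra ℂ U ⊗[ℂ] TensAlg I M)) :=
  Submodule.span ℂ {z | ∃ p q, p + q + 2 = n ∧ ∃ a ∈ homog (TensAlg.deg I M) p,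
    ∃ b ∈ homog (TensAlg.deg I M) q, ∃ t, z = diag I M U a * relPair Ψ t * diag I M U b}

variable (Ψ) in
/-- The `S`-span of the elements `a (w - Ψ(w)) b` with `a w b` of degree less than `n`. -/
def lowIdeal (n : ℕ) :
    Submodule (SymmetricAlgebra ℂ U) (SymmetricAlgebra ℂ U ⊗[ℂ] TensAlg I M) :=
  Submodule.span _ {z | ∃ p q, p + q + 2 < n ∧ ∃ a ∈ homog (TensAlg.deg I M) p,
    ∃ b ∈ homog (TensAlg.deg I M) q, ∃ t, z = inc I M U a * relator Ψ t * inc I M U b}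

theorem lowIdeal_mono {m n : ℕ} (h : m ≤ n) : lowIdeal Ψ m ≤ lowIdeal Ψ n := by
  refine Submodule.span_mono ?_
  rintro _ ⟨p, q, hpq, a, ha, b, hb, t, rfl⟩
  exact ⟨p, q, by omega, a, ha, b, hb, t, rfl⟩

theorem inc_mul_mem_lowIdeal {k n : ℕ} {c : TensAlg I M} (hc : c ∈ homog (TensAlg.deg I M) k)
    {f : SymmetricAlgebra ℂ U ⊗[ℂ] TensAlg I M} (hf : f ∈ lowIdeal Ψ n) :
    inc I M U c * f ∈ lowIdeal Ψ (n + k) := by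
  induction hf using Submodule.span_induction with
  | mem f hf =>
    obtain ⟨p, q, hpq, a, ha, b, hb, t, rfl⟩ := hf
    exact Submodule.subset_span ⟨k + p, q, by omega, c * a, mul_mem_homog hc ha, b, hb, t, by
      rw [map_mul]; simp only [mul_assoc]⟩
  | zero => simp
  | add x y _ _ hx hy => rw [mul_add]; exact add_mem hx hy
  | smul s x _ hx => rw [mul_smul_comm]; exact Submodule.smul_mem _ _ hx

theorem diag_mul_mem_relPairs {k n : ℕ} {c : TensAlg I M} (hc : c ∈ homog (TensAlg.deg I M) k)
    {f : TensAlg I M × (SymmetricAlgebra ℂ U ⊗[ℂ] TensAlg I M)} (hf : f ∈ relPairs Ψ n) :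
    diag I M U c * f ∈ relPairs Ψ (n + k) := by
  induction hf using Submodule.span_induction with
  | mem f hf =>
    obtain ⟨p, q, hpq, a, ha, b, hb, t, rfl⟩ := hf
    exact Submodule.subset_span ⟨k + p, q, by omega, c * a, mul_mem_homog hc ha, b, hb, t, by
      rw [map_mul]; simp only [mul_assoc]⟩
  | zero => simp
  | add x y _ _ hx hy => rw [mul_add]; exact add_mem hx hy
  | smul s x _ hx => rw [mul_smul_comm]; exact Submodule.smul_mem _ _ hx

theorem mk_fst_of_mem_relPairs {n : ℕ}
    {f : TensAlg I M × (SymmetricAlgebra ℂ U ⊗[ℂ] TensAlg I M)} (hf : f ∈ relPairs Ψ n) :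
    QuadAlg.mk W f.1 = 0 := by
  induction hf using Submodule.span_induction with
  | mem f hf =>
    obtain ⟨p, q, hpq, a, ha, b, hb, t, rfl⟩ := hf
    simp only [diag_apply, relPair_apply, Prod.mk_mul_mk, map_mul]
    rw [QuadAlg.mk_ofTens W t.2, mul_zero, zero_mul]
  | zero => simp
  | add x y _ _ hx hy => rw [Prod.fst_add, map_add, hx, hy, add_zero]
  | smul s x _ hx => rw [Prod.smul_fst, map_smul, hx, smul_zero]

/-- Elements of `R ⊗ U` contribute degree zero in `T_R(M)` and a scalar from `S`, so only the
remaining relator and its two factors count towards the filtration degree. -/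
theorem relator_mul_ofRU_mem {n p q : ℕ} (h : p + q + 2 < n) {a b : TensAlg I M}
    (ha : a ∈ homog (TensAlg.deg I M) p) (hb : b ∈ homog (TensAlg.deg I M) q)
    (t : W.toSubmodule) (z : (I → ℂ) ⊗[ℂ] U) :
    relator Ψ t * inc I M U a * ofRU I M U z * inc I M U b ∈ lowIdeal Ψ n := by
  induction z using TensorProduct.induction_on with
  | zero => simp
  | tmul r z =>
    rw [ofRU_tmul, mul_smul_comm, smul_mul_assoc]
    refine Submodule.smul_mem _ _ (Submodule.subset_span ⟨0, p + q, by omega, 1, one_mem_homog,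
      a * TensAlg.ofR I M r * b, ?_, t, ?_⟩)
    · exact mul_mem_homog (mul_mem_homog ha (TensAlg.ofR_mem r)) hb
    · simp only [map_mul, map_one, one_mul, mul_assoc]
  | add x y hx hy => rw [map_add, mul_add, add_mul]; exact add_mem hx hy

theorem ofRU_mul_relator_mem {n p q : ℕ} (h : p + q + 2 < n) {a b : TensAlg I M}
    (ha : a ∈ homog (TensAlg.deg I M) p) (hb : b ∈ homog (TensAlg.deg I M) q)
    (t : W.toSubmodule) (z : (I → ℂ) ⊗[ℂ] U) :
    ofRU I M U z * inc I M U a * relator Ψ t * inc I M U b ∈ lowIdeal Ψ n := by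
  induction z using TensorProduct.induction_on with
  | zero => simp
  | tmul r z =>
    rw [ofRU_tmul, smul_mul_assoc, smul_mul_assoc, smul_mul_assoc]
    refine Submodule.smul_mem _ _ (Submodule.subset_span ⟨0 + p, q, by omega,
      TensAlg.ofR I M r * a, mul_mem_homog (TensAlg.ofR_mem r) ha, b, hb, t, ?_⟩)
    simp only [map_mul]
  | add x y hx hy => rw [map_add, add_mul, add_mul, add_mul]; exact add_mem hx hy

variable (X : ArrowBasis I M) (Y : RelBasis W)

variable (Ψ) in
/-- The products of arrows with `relPairs`. -/
def arrowMul (n : ℕ) : Submodule ℂ (TensAlg I M × (SymmetricAlgebra ℂ U ⊗[ℂ] TensAlg I M)) :=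
  Submodule.span ℂ {z | ∃ m, ∃ f ∈ relPairs Ψ n, z = diag I M U (TensAlg.ofM I M m) * f}

theorem exists_of_mem_arrowMul {n : ℕ}
    {z : TensAlg I M × (SymmetricAlgebra ℂ U ⊗[ℂ] TensAlg I M)} (hz : z ∈ arrowMul Ψ n) :
    ∃ f : X.ι → TensAlg I M × (SymmetricAlgebra ℂ U ⊗[ℂ] TensAlg I M),
      (∀ k, f k ∈ relPairs Ψ n) ∧ (∀ k, diag I M U (TensAlg.ofR I M (e (X.tgt k))) * f k = f k) ∧
      z = ∑ k, diag I M U (TensAlg.ofM I M (X.basis k)) * f k := by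
  induction hz using Submodule.span_induction with
  | mem z hz =>
    obtain ⟨m, f, hf, rfl⟩ := hz
    refine ⟨fun k => ArrowBasis.coord X k m • (diag I M U (TensAlg.ofR I M (e (X.tgt k))) * f),
      fun k => Submodule.smul_mem _ _ (diag_mul_mem_relPairs (TensAlg.ofR_mem _) hf),
      fun k => ?_, ?_⟩
    · rw [mul_smul_comm, ← mul_assoc, ← map_mul, ← map_mul, e_mul_e]
    · conv_lhs => rw [← ArrowBasis.sum_coord X m, map_sum, map_sum, Finset.sum_mul]
      refine Finset.sum_congr rfl fun k _ => ?_
      rw [map_smul, map_smul, smul_mul_assoc, mul_smul_comm, ← mul_assoc, ← map_mul,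
        ArrowBasis.ofM_basis_mul_e]
  | zero => exact ⟨0, fun k => zero_mem _, fun k => by simp, by simp⟩
  | add x y _ _ hx hy =>
    obtain ⟨f, hf, hf1, rfl⟩ := hx
    obtain ⟨g, hg, hg1, rfl⟩ := hy
    exact ⟨f + g, fun k => add_mem (hf k) (hg k), fun k => by rw [Pi.add_apply, mul_add, hf1, hg1],
      by simp only [Pi.add_apply, mul_add, Finset.sum_add_distrib]⟩
  | smul c x _ hx =>
    obtain ⟨f, hf, hf1, rfl⟩ := hx
    exact ⟨c • f, fun k => Submodule.smul_mem _ _ (hf k),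
      fun k => by rw [Pi.smul_apply, mul_smul_comm, hf1],
      by simp only [Pi.smul_apply, mul_smul_comm, Finset.smul_sum]⟩

theorem relPair_basis_mul_e (hΨ : IsBimoduleMap W Ψ) (j : Y.ι) :
    relPair Ψ (Y.basis j) * diag I M U (TensAlg.ofR I M (e (Y.tgt j))) =
      relPair Ψ (Y.basis j) := by
  rw [← relPair_rMap hΨ, Y.right, e_self, one_smul]

/-- The spanning elements `a w b` are of two kinds. If `a` has degree zero it is absorbed into `w`,
which is then expanded in the basic relations; otherwise the first arrow of `a` can be pulled out.
-/
theorem exists_of_mem_relPairs (X : ArrowBasis I M) (hΨ : IsBimoduleMap W Ψ) {n : ℕ}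
    {z : TensAlg I M × (SymmetricAlgebra ℂ U ⊗[ℂ] TensAlg I M)} (hz : z ∈ relPairs Ψ (n + 2)) :
    ∃ t : Y.ι → TensAlg I M, (∀ j, t j ∈ homog (TensAlg.deg I M) n) ∧
      (∀ j, TensAlg.ofR I M (e (Y.tgt j)) * t j = t j) ∧
      z - ∑ j, relPair Ψ (Y.basis j) * diag I M U (t j) ∈ arrowMul Ψ (n + 1) := by
  induction hz using Submodule.span_induction with
  | mem z hz =>
    obtain ⟨p, q, hpq, a, ha, b, hb, w, rfl⟩ := hz
    rcases p with _ | p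
    · obtain rfl : q = n := by omega
      set r := TensAlg.aug I M a
      refine ⟨fun j => Y.basis.repr (W.lMap r w) j • (TensAlg.ofR I M (e (Y.tgt j)) * b),
        fun j => Submodule.smul_mem _ _ ?_, fun j => ?_, ?_⟩
      · rw [← zero_add q]; exact mul_mem_homog (TensAlg.ofR_mem _) hb
      · rw [mul_smul_comm, ← mul_assoc, ← map_mul, e_mul_e]
      · have h1 : diag I M U a * relPair Ψ w * diag I M U b = ∑ j, relPair Ψ (Y.basis j) *
            diag I M U (Y.basis.repr (W.lMap r w) j • (TensAlg.ofR I M (e (Y.tgt j)) * b)) := by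
          rw [TensAlg.eq_ofR_of_mem_zero X ha, ← relPair_lMap hΨ]
          conv_lhs => rw [← Y.basis.sum_repr (W.lMap _ w), map_sum, Finset.sum_mul]
          refine Finset.sum_congr rfl fun j _ => ?_
          rw [map_smul, map_smul, smul_mul_assoc, mul_smul_comm, map_mul, ← mul_assoc,
            relPair_basis_mul_e Y hΨ]
        rw [h1, sub_self]
        exact zero_mem _
    · refine ⟨0, fun j => zero_mem _, fun j => by simp, ?_⟩
      simp only [Pi.zero_apply, map_zero, mul_zero, Finset.sum_const_zero, sub_zero]
      rw [ArrowBasis.eq_sum_of_mem_succ X ha, map_sum, Finset.sum_mul, Finset.sum_mul]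
      refine sum_mem fun k _ => Submodule.subset_span ⟨X.basis k,
        diag I M U (ArrowBasis.deriv X k a) * relPair Ψ w * diag I M U b, ?_, ?_⟩
      · exact Submodule.subset_span ⟨p, q, by omega, _, ArrowBasis.deriv_mem X ha k, b, hb, w, rfl⟩
      · rw [map_mul]; simp only [mul_assoc]
  | zero => exact ⟨0, fun j => zero_mem _, fun j => by simp, by simp⟩
  | add x y _ _ hx hy =>
    obtain ⟨s, hs, hs1, hs2⟩ := hx
    obtain ⟨t, ht, ht1, ht2⟩ := hy
    refine ⟨s + t, fun j => add_mem (hs j) (ht j),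
      fun j => by rw [Pi.add_apply, mul_add, hs1, ht1], ?_⟩
    simp only [Pi.add_apply, map_add, mul_add, Finset.sum_add_distrib]
    rw [add_sub_add_comm]
    exact add_mem hs2 ht2
  | smul c x _ hx =>
    obtain ⟨s, hs, hs1, hs2⟩ := hx
    refine ⟨c • s, fun j => Submodule.smul_mem _ _ (hs j),
      fun j => by rw [Pi.smul_apply, mul_smul_comm, hs1], ?_⟩
    simp only [Pi.smul_apply, map_smul, mul_smul_comm]
    rw [← Finset.smul_sum, ← smul_sub]
    exact Submodule.smul_mem _ _ hs2

variable (I M) in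
/-- The pairs `(0, f)`. -/
abbrev sndIncl : (SymmetricAlgebra ℂ U ⊗[ℂ] TensAlg I M) →ₗ[ℂ]
    TensAlg I M × (SymmetricAlgebra ℂ U ⊗[ℂ] TensAlg I M) := LinearMap.inr ℂ _ _

/-- When `s` lies in the ideal of relations, each term contains two disjoint relations. It may be
rewritten at the second one instead of the first at the cost of lower terms, and the first relation
then begins with an arrow that can be pulled out. -/
theorem relPair_mul_mem_of_mk_eq_zero (X : ArrowBasis I M) {n : ℕ} {s : TensAlg I M}
    (hs : s ∈ homog (TensAlg.deg I M) n) (h0 : QuadAlg.mk W s = 0) (w : W.toSubmodule) :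
    relPair Ψ w * diag I M U s ∈ arrowMul Ψ (n + 1) ⊔
      ((lowIdeal Ψ (n + 2)).restrictScalars ℂ).map (sndIncl I M) := by
  have h := QuadAlg.mem_span_of_mk_eq_zero_of_mem W h0 hs
  clear hs h0
  induction h using Submodule.span_induction with
  | mem s hs =>
    obtain ⟨p, q, hpq, a, ha, b, hb, t, ht, rfl⟩ := hs
    -- The second component is the identity `(w - Ψw) a t b = w a (t - Ψt) b + (w - Ψw) a Ψt b - Ψw
    -- a (t - Ψt) b`.
    have key : relPair Ψ w * diag I M U (a * TensAlg.ofTens I M t * b) =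
        diag I M U (TensAlg.ofTens I M w) *
          (diag I M U a * relPair Ψ ⟨t, ht⟩ * diag I M U b) +
        sndIncl I M (relator Ψ w * inc I M U a * ofRU I M U (Ψ ⟨t, ht⟩) * inc I M U b -
          ofRU I M U (Ψ w) * inc I M U a * relator Ψ ⟨t, ht⟩ * inc I M U b) := by
      rw [relPair_apply, relPair_apply]
      simp only [diag_apply, LinearMap.inr_apply, Prod.mk_mul_mk, Prod.mk_add_mk, add_zero,
        Prod.mk.injEq]
      refine ⟨by simp only, ?_⟩
      have e1 : inc I M U (TensAlg.ofTens I M t) =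
          relator Ψ ⟨t, ht⟩ + ofRU I M U (Ψ ⟨t, ht⟩) := by
        rw [relator_apply]; simp [psiHat]
      have e2 : inc I M U (TensAlg.ofTens I M (w : Tens I M)) = relator Ψ w + ofRU I M U (Ψ w) := by
        rw [relator_apply]; simp [psiHat]
      simp only [map_mul]
      rw [e1, e2]
      noncomm_ring
    rw [key]
    refine Submodule.add_mem_sup ?_ ⟨_, ?_, rfl⟩
    · rw [← ArrowBasis.sum_tmul_contr X (w : Tens I M), map_sum, map_sum, Finset.sum_mul]
      refine sum_mem fun k _ => Submodule.subset_span ⟨X.basis k, diag I M U (TensAlg.ofM I M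
        (ArrowBasis.contr X k w)) * (diag I M U a * relPair Ψ ⟨t, ht⟩ * diag I M U b), ?_, ?_⟩
      · exact diag_mul_mem_relPairs (TensAlg.ofM_mem _)
          (Submodule.subset_span ⟨p, q, hpq, a, ha, b, hb, _, rfl⟩)
      · rw [TensAlg.ofTens_tmul, map_mul, mul_assoc]
    · exact sub_mem (relator_mul_ofRU_mem (by omega) ha hb _ _)
        (ofRU_mul_relator_mem (by omega) ha hb _ _)
  | zero => simp
  | add x y _ _ hx hy => rw [map_add, mul_add]; exact add_mem hx hy
  | smul c x _ hx => rw [map_smul, mul_smul_comm]; exact Submodule.smul_mem _ _ hx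

/-- Linear syzygies lift to relations among the relators. -/
theorem sum_relPair_mul_syzygy (hP : IsPBW Ψ) {c : Y.ι → M}
    (hc0 : ∀ k, ∑ j, QuadAlg.ofM W (relCoeff X Y j k) * QuadAlg.ofM W (c j) = 0) :
    ∃ v : X.ι → W.toSubmodule, ∑ j, relPair Ψ (Y.basis j) * diag I M U (TensAlg.ofM I M (c j)) =
      ∑ k, diag I M U (TensAlg.ofM I M (X.basis k)) * relPair Ψ (v k) := by
  -- A linear syzygy exhibits `∑ w_j c_j` also as `∑ x_k v_k` with `v_k ∈ W`, that is, as an element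
  -- of `W ⊗_R M ∩ M ⊗_R W`.
  have hv : ∀ k, ∑ j, tmul I (relCoeff X Y j k) (c j) ∈ W.toSubmodule := by
    intro k
    rw [← QuadAlg.mk_ofTens_eq_zero_iff, ← hc0 k]
    simp only [map_sum, mk_ofTens_tmul]
  let v : X.ι → W.toSubmodule := fun k => ⟨_, hv k⟩
  have h1 : ∑ j, TensAlg.ofTens I M (Y.basis j : Tens I M) * TensAlg.ofM I M (c j) =
      ∑ k, TensAlg.ofM I M (X.basis k) * TensAlg.ofTens I M (v k : Tens I M) := by
    simp only [v, map_sum, TensAlg.ofTens_tmul, Finset.mul_sum]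
    rw [Finset.sum_comm]
    refine Finset.sum_congr rfl fun j _ => ?_
    rw [← sum_tmul_relCoeff X Y j, map_sum, Finset.sum_mul]
    exact Finset.sum_congr rfl fun k _ => by rw [TensAlg.ofTens_tmul, mul_assoc]
  -- The condition on `Ψ` makes the two rewritings agree exactly, with no lower correction.
  have h2 := hP (∑ j, Y.basis j ⊗ₜ c j) (∑ k, X.basis k ⊗ₜ v k) (by
    simpa only [map_sum, relM_tmul, mRel_tmul] using h1)
  simp only [map_sum, psiM_tmul, mPsi_tmul] at h2
  refine ⟨v, Prod.ext ?_ ?_⟩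
  · simpa only [Prod.fst_sum, Prod.fst_mul, relPair_apply, diag_apply] using h1
  · simp only [Prod.snd_sum, Prod.snd_mul, relPair_apply, diag_apply, relator_apply, sub_mul,
      mul_sub, Finset.sum_sub_distrib]
    rw [h2]
    congr 1
    simp only [← map_mul, ← map_sum]
    rw [h1]

/-- A relation `∑ a w b = 0` in `T_R(M)` in degree `n` yields an element `∑ a (w - Ψ(w)) b` of
lower degree. -/
theorem snd_mem_lowIdeal (hA : IsKoszul W) (hΨ : IsBimoduleMap W Ψ) (hP : IsPBW Ψ) (n : ℕ) :
    ∀ z ∈ relPairs Ψ n, z.1 = 0 → z.2 ∈ lowIdeal Ψ n := by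
  obtain ⟨X⟩ := exists_arrowBasis I M
  obtain ⟨Y⟩ := exists_relBasis W
  induction n with
  | zero =>
    intro z hz _
    have : {z | ∃ p q, p + q + 2 = 0 ∧ ∃ a ∈ homog (TensAlg.deg I M) p,
        ∃ b ∈ homog (TensAlg.deg I M) q, ∃ t,
          z = diag I M U a * relPair Ψ t * diag I M U b} = ∅ := by
      ext z
      simp
    rw [relPairs, this, Submodule.span_empty, Submodule.mem_bot] at hz
    rw [hz]
    exact zero_mem _
  | succ n ih =>
    rcases n with _ | n
    · intro z hz _
      have : {z | ∃ p q, p + q + 2 = 0 + 1 ∧ ∃ a ∈ homog (TensAlg.deg I M) p,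
          ∃ b ∈ homog (TensAlg.deg I M) q, ∃ t,
            z = diag I M U a * relPair Ψ t * diag I M U b} = ∅ := by
        ext z
        simp only [Set.mem_ofPred_eq, Set.mem_empty_iff_false, iff_false]
        rintro ⟨p, q, h, _⟩
        omega
      rw [relPairs, this, Submodule.span_empty, Submodule.mem_bot] at hz
      rw [hz]
      exact zero_mem _
    intro z hz hz0
    obtain ⟨t, ht, hte, htz⟩ := exists_of_mem_relPairs Y X hΨ hz
    obtain ⟨f, hf, hfe, hfz⟩ := exists_of_mem_arrowMul X htz
    have hfe1 : ∀ k, TensAlg.ofR I M (e (X.tgt k)) * (f k).1 = (f k).1 := fun k =>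
      congrArg Prod.fst (hfe k)
    -- Applying `∂_k` to the vanishing first component leaves `∑ y_jk t_j` up to an element of the
    -- ideal of relations, so the classes of the `t j` form a syzygy over `A`.
    have h1 : ∀ k, ∑ j, QuadAlg.ofM W (relCoeff X Y j k) * QuadAlg.mk W (t j) = 0 := by
      intro k
      have h2 := congrArg (fun y => ArrowBasis.deriv X k y.1) hfz
      simp only [Prod.fst_sub, hz0, zero_sub, Prod.fst_sum, Prod.fst_mul, relPair_apply,
        diag_apply, map_neg, ArrowBasis.deriv_sum X (fun k => (f k).1) hfe1 k] at h2
      rw [map_sum] at h2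
      simp only [ArrowBasis.deriv_mul, TensAlg.aug_ofTens, Pi.zero_apply, zero_smul, add_zero,
        ArrowBasis.deriv_ofTens] at h2
      have h3 := congrArg (QuadAlg.mk W) h2
      rw [mk_fst_of_mem_relPairs (hf k), map_neg, neg_eq_zero, map_sum] at h3
      simp only [map_mul] at h3
      exact h3
    -- This is where Koszulness enters.
    have h2 := mem_span_linearSyzygies X Y hA (z := fun j => QuadAlg.mk W (t j)) (fun j => by
      rw [← QuadAlg.mk_ofR, ← map_mul, hte]) h1
    -- The linear syzygies may carry inhomogeneous factors on the right, so lifts to `T_R(M)` are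
    -- truncated to degree `n`. The truncated sum can be rewritten to start with arrows, by
    -- `sum_relPair_mul_syzygy`.
    have key : ∀ y ∈ Submodule.span ℂ (linearSyzygies X Y), ∃ s : Y.ι → TensAlg I M,
        (∀ j, QuadAlg.mk W (s j) = y j) ∧
        ∑ j, relPair Ψ (Y.basis j) * diag I M U (comp (TensAlg.deg I M) n (s j)) ∈
          arrowMul Ψ (n + 1) := by
      intro y hy
      induction hy using Submodule.span_induction with
      | mem y hy =>
        obtain ⟨c, b, hce, hc0, rfl⟩ := hy
        obtain ⟨b, rfl⟩ := QuadAlg.mk_surjective W b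
        refine ⟨fun j => TensAlg.ofM I M (c j) * b, fun j => by rw [map_mul]; rfl, ?_⟩
        rcases n with _ | m
        · simp only [comp_mul_left_of_lt (TensAlg.ofM_mem _) _ one_pos, map_zero, mul_zero,
            Finset.sum_const_zero]
          exact zero_mem _
        · have h3 : ∀ j, comp (TensAlg.deg I M) (m + 1) (TensAlg.ofM I M (c j) * b) =
              TensAlg.ofM I M (c j) * comp (TensAlg.deg I M) m b := fun j => by
            rw [add_comm]; exact comp_mul_left (TensAlg.ofM_mem _) _ _
          obtain ⟨v, hv⟩ := sum_relPair_mul_syzygy X Y hP hc0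
          simp only [h3, map_mul, ← mul_assoc]
          rw [← Finset.sum_mul, hv, Finset.sum_mul]
          refine sum_mem fun k _ => Submodule.subset_span ⟨X.basis k,
            relPair Ψ (v k) * diag I M U (comp (TensAlg.deg I M) m b), ?_, by rw [mul_assoc]⟩
          exact Submodule.subset_span ⟨0, m, by omega, 1, one_mem_homog, _,
            comp_mem TensAlg.iSup_homog _ _, v k, by rw [map_one, one_mul]⟩
      | zero => exact ⟨0, fun j => by simp, by simp⟩
      | add x y _ _ hx hy =>
        obtain ⟨s, hs, hs1⟩ := hx
        obtain ⟨s', hs', hs1'⟩ := hy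
        refine ⟨s + s', fun j => by simp [hs, hs'], ?_⟩
        simp only [Pi.add_apply, map_add, mul_add, Finset.sum_add_distrib]
        exact add_mem hs1 hs1'
      | smul c x _ hx =>
        obtain ⟨s, hs, hs1⟩ := hx
        refine ⟨c • s, fun j => by simp [hs], ?_⟩
        simp only [Pi.smul_apply, map_smul, mul_smul_comm]
        rw [← Finset.smul_sum]
        exact Submodule.smul_mem _ _ hs1
    obtain ⟨s, hs, hs1⟩ := key _ h2
    -- The truncated lift and `t j` agree in `A`, so their difference lies in the ideal of
    -- relations.
    have h3 : ∀ j, relPair Ψ (Y.basis j) * diag I M U (t j - comp (TensAlg.deg I M) n (s j)) ∈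
        arrowMul Ψ (n + 1) ⊔ ((lowIdeal Ψ (n + 2)).restrictScalars ℂ).map (sndIncl I M) := by
      intro j
      refine relPair_mul_mem_of_mk_eq_zero X
        (sub_mem (ht j) (comp_mem TensAlg.iSup_homog _ _)) ?_ _
      rw [map_sub, QuadAlg.mk_comp, hs, comp_same (QuadAlg.mk_mem W (ht j)), sub_self]
    have h4 : z ∈ arrowMul Ψ (n + 1) ⊔
        ((lowIdeal Ψ (n + 2)).restrictScalars ℂ).map (sndIncl I M) := by
      have h5 : z = (z - ∑ j, relPair Ψ (Y.basis j) * diag I M U (t j)) +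
          ∑ j, relPair Ψ (Y.basis j) * diag I M U (comp (TensAlg.deg I M) n (s j)) +
          ∑ j, relPair Ψ (Y.basis j) * diag I M U (t j - comp (TensAlg.deg I M) n (s j)) := by
        simp only [map_sub, mul_sub, Finset.sum_sub_distrib]
        abel
      rw [h5]
      exact add_mem (Submodule.mem_sup_left (add_mem htz hs1)) (sum_mem fun j _ => h3 j)
    obtain ⟨y, hy, _, ⟨g, hg, rfl⟩, rfl⟩ := Submodule.mem_sup.1 h4
    obtain ⟨f', hf', hfe', rfl⟩ := exists_of_mem_arrowMul X hy
    have hfe1' : ∀ k, TensAlg.ofR I M (e (X.tgt k)) * (f' k).1 = (f' k).1 := fun k =>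
      congrArg Prod.fst (hfe' k)
    -- After all rewriting only terms starting with an arrow remain, besides a pair with zero first
    -- component. Uniqueness of Fox coefficients forces each factor to have zero first component, so
    -- the induction hypothesis in degree `n + 1` applies to it.
    have h6 : ∀ k, (f' k).1 = 0 := by
      intro k
      rw [← ArrowBasis.deriv_sum X (fun k => (f' k).1) hfe1' k]
      have h7 := congrArg (ArrowBasis.deriv X k) hz0
      simpa [Prod.fst_sum, diag_apply] using h7
    rw [Prod.snd_add, Prod.snd_sum]
    refine add_mem (sum_mem fun k _ => ?_) hg
    exact inc_mul_mem_lowIdeal (TensAlg.ofM_mem _) (ih _ (hf' k) (h6 k))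

end PBW

end QuadKoszul

end

noncomputable section

namespace QuadKoszul

universe u v w x

/-! ### Flatness of `Ã_Ψ` -/

section Flatness

variable {I : Type u} [Fintype I] [DecidableEq I]
variable {M : Type v} [AddCommGroup M] [Module ℂ M] [Module (I → ℂ) M] [Module (I → ℂ)ᵐᵒᵖ M]
  [SMulCommClass (I → ℂ) (I → ℂ)ᵐᵒᵖ M] [IsScalarTower ℂ (I → ℂ) M]
  [IsScalarTower ℂ (I → ℂ)ᵐᵒᵖ M] [FiniteDimensional ℂ M]
variable {W : Relations I M}
variable {U : Type w} [AddCommGroup U] [Module ℂ U]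
variable (Ψ : W.toSubmodule →ₗ[ℂ] (I → ℂ) ⊗[ℂ] U)

theorem Deform.mk_surjective : Function.Surjective (Deform.mk Ψ) :=
  RingQuot.mkAlgHom_surjective ℂ _

/-- The quotient map `S ⊗ T_R(M) → Ã_Ψ`, as a homomorphism of `S`-algebras. -/
def Deform.mkS : SymmetricAlgebra ℂ U ⊗[ℂ] TensAlg I M →ₐ[SymmetricAlgebra ℂ U] Deform Ψ :=
  { (Deform.mk Ψ : SymmetricAlgebra ℂ U ⊗[ℂ] TensAlg I M →+* Deform Ψ) with
    commutes' := fun s => by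
      have h := (RingQuot.mkAlgHom (SymmetricAlgebra ℂ U) (DefRel Ψ)).commutes s
      rw [← AlgHom.coe_toRingHom, RingQuot.mkAlgHom_coe, ← RingQuot.mkAlgHom_coe ℂ] at h
      exact h }

theorem Deform.mk_smul (s : SymmetricAlgebra ℂ U) (z : SymmetricAlgebra ℂ U ⊗[ℂ] TensAlg I M) :
    Deform.mk Ψ (s • z) = s • Deform.mk Ψ z := map_smul (Deform.mkS Ψ) s z

theorem Deform.mk_relator (t : W.toSubmodule) : Deform.mk Ψ (relator Ψ t) = 0 := by
  rw [relator_apply, map_sub, sub_eq_zero]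
  exact RingQuot.mkAlgHom_rel ℂ (s := DefRel Ψ) ⟨t, rfl, rfl⟩

theorem tmul_eq_smul_inc (s : SymmetricAlgebra ℂ U) (t : TensAlg I M) :
    s ⊗ₜ[ℂ] t = s • inc I M U t := by
  rw [inc_apply, TensorProduct.smul_tmul', smul_eq_mul, mul_one]

/-- The kernel of `S ⊗ T_R(M) → Ã_Ψ`. -/
theorem Deform.exists_mem_lowIdeal {z : SymmetricAlgebra ℂ U ⊗[ℂ] TensAlg I M}
    (hz : Deform.mk Ψ z = 0) : ∃ n, z ∈ lowIdeal Ψ n := by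
  rw [← Submodule.mem_iSup_of_directed _ (directed_of_isDirected_le fun _ _ h => lowIdeal_mono h)]
  have key : ∀ (a c : SymmetricAlgebra ℂ U ⊗[ℂ] TensAlg I M) (t : W.toSubmodule),
      a * relator Ψ t * c ∈ ⨆ n, lowIdeal Ψ n := by
    intro a c t
    induction a using TensorProduct.induction_on with
    | zero => simp
    | add a a' ha ha' => rw [add_mul, add_mul]; exact add_mem ha ha'
    | tmul s a =>
      rw [tmul_eq_smul_inc, smul_mul_assoc, smul_mul_assoc]
      refine Submodule.smul_mem _ _ ?_
      induction c using TensorProduct.induction_on with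
      | zero => simp
      | add c c' hc hc' => rw [mul_add]; exact add_mem hc hc'
      | tmul s c =>
        rw [tmul_eq_smul_inc, mul_smul_comm]
        refine Submodule.smul_mem _ _ ?_
        rw [← sum_comp TensAlg.iSup_homog a, ← sum_comp TensAlg.iSup_homog c, map_sum, map_sum,
          Finset.sum_mul, Finset.sum_mul]
        refine sum_mem fun p _ => ?_
        rw [Finset.mul_sum]
        -- The defining inequality of `lowIdeal` is strict, hence `p + q + 3` for an element of
        -- degree `p + q + 2`.
        exact sum_mem fun q _ => Submodule.mem_iSup_of_mem (p + q + 3) (Submodule.subset_span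
          ⟨p, q, by omega, _, comp_mem TensAlg.iSup_homog _ _, _, comp_mem TensAlg.iSup_homog _ _,
            t, rfl⟩)
  have h := mem_span_of_mkAlgHom_eq_zero hz
  have h2 : Submodule.span ℂ {z | ∃ a x y c, DefRel Ψ x y ∧ z = a * (x - y) * c} ≤
      (⨆ n, lowIdeal Ψ n).restrictScalars ℂ := by
    rw [Submodule.span_le]
    rintro _ ⟨a, _, _, c, ⟨t, rfl, rfl⟩, rfl⟩
    exact key a c t
  exact h2 h

variable (W) in
/-- A linear section of `T_R(M) → A` compatible with the gradings. -/
theorem QuadAlg.exists_graded_section : ∃ σ : QuadAlg W →ₗ[ℂ] TensAlg I M,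
    (∀ a, QuadAlg.mk W (σ a) = a) ∧
    ∀ n, ∀ a ∈ homog (QuadAlg.deg W) n, σ a ∈ homog (TensAlg.deg I M) n := by
  obtain ⟨σ, hσ⟩ := (QuadAlg.mk W).toLinearMap.exists_rightInverse_of_surjective
    (LinearMap.range_eq_top.2 (QuadAlg.mk_surjective W))
  have hσ' : ∀ a, QuadAlg.mk W (σ a) = a := fun a => LinearMap.congr_fun hσ a
  -- An arbitrary linear section need not be graded; on degree `n` it is replaced by its component
  -- of degree `n`.
  let τ : QuadAlg W →ₗ[ℂ] TensAlg I M :=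
    Polynomial.lsum (fun n => comp (TensAlg.deg I M) n ∘ₗ σ) ∘ₗ (QuadAlg.deg W).toLinearMap
  have hτ : ∀ n, ∀ a ∈ homog (QuadAlg.deg W) n, τ a = comp (TensAlg.deg I M) n (σ a) := by
    intro n a ha
    simp only [τ, LinearMap.comp_apply, AlgHom.toLinearMap_apply, mem_homog.1 ha]
    rw [Polynomial.lsum_apply]
    exact Polynomial.sum_monomial_index _ _ (map_zero (comp (TensAlg.deg I M) n ∘ₗ σ))
  refine ⟨τ, fun a => ?_, fun n a ha => ?_⟩
  · rw [← sum_comp (QuadAlg.iSup_homog W) a, map_sum, map_sum]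
    refine Finset.sum_congr rfl fun n _ => ?_
    have h := comp_mem (QuadAlg.iSup_homog W) n a
    rw [hτ n _ h, QuadAlg.mk_comp, hσ', comp_same h]
  · rw [hτ n a ha]
    exact comp_mem TensAlg.iSup_homog _ _

/-- The top degree component of an element of `lowIdeal`. -/
theorem exists_top_of_mem_lowIdeal {n : ℕ} {z : SymmetricAlgebra ℂ U ⊗[ℂ] TensAlg I M}
    (hz : z ∈ lowIdeal Ψ (n + 1)) : ∃ ζ : SymmetricAlgebra ℂ U ⊗[ℂ] relPairs Ψ n,
      (LinearMap.fst ℂ _ _ ∘ₗ (relPairs Ψ n).subtype).lTensor (SymmetricAlgebra ℂ U) ζ =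
        (comp (TensAlg.deg I M) n).lTensor (SymmetricAlgebra ℂ U) z ∧
      z - (LinearMap.snd ℂ _ _ ∘ₗ (relPairs Ψ n).subtype).liftBaseChange (SymmetricAlgebra ℂ U) ζ ∈ lowIdeal Ψ n := by
  induction hz using Submodule.span_induction with
  | mem z hz =>
    obtain ⟨p, q, hpq, a, ha, b, hb, t, rfl⟩ := hz
    have hab : ∀ {k : ℕ} {y : TensAlg I M}, y ∈ homog (TensAlg.deg I M) k →
        a * y * b ∈ homog (TensAlg.deg I M) (p + k + q) :=
      fun hy => mul_mem_homog (mul_mem_homog ha hy) hb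
    -- The term with `Ψ t` has degree only `p + q` in `T_R(M)`, which is below `n`, so it does not
    -- reach the top component.
    have hc1 : (comp (TensAlg.deg I M) n).lTensor (SymmetricAlgebra ℂ U)
        (inc I M U a * psiHat Ψ t * inc I M U b) = 0 := by
      rw [psiHat, LinearMap.comp_apply]
      induction Ψ t using TensorProduct.induction_on with
      | zero => simp
      | add x y hx hy => rw [map_add, mul_add, add_mul, map_add, hx, hy, add_zero]
      | tmul r z =>
        rw [ofRU_tmul, mul_smul_comm, smul_mul_assoc, ← map_mul, ← map_mul, ← tmul_eq_smul_inc,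
          LinearMap.lTensor_tmul, comp_of_mem (hab (TensAlg.ofR_mem r)), if_neg (by omega),
          TensorProduct.tmul_zero]
    have hc : (comp (TensAlg.deg I M) n).lTensor (SymmetricAlgebra ℂ U)
        (inc I M U a * relator Ψ t * inc I M U b) = 1 ⊗ₜ comp (TensAlg.deg I M) n
          (a * TensAlg.ofTens I M t * b) := by
      rw [relator_apply, mul_sub, sub_mul, map_sub, hc1, sub_zero, ← map_mul, ← map_mul, inc_apply,
        LinearMap.lTensor_tmul]
    rw [hc, comp_of_mem (hab (TensAlg.ofTens_mem _))]
    split_ifs with h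
    · refine ⟨1 ⊗ₜ ⟨diag I M U a * relPair Ψ t * diag I M U b,
        Submodule.subset_span ⟨p, q, by omega, a, ha, b, hb, t, rfl⟩⟩, rfl, ?_⟩
      rw [LinearMap.liftBaseChange_tmul, one_smul, LinearMap.comp_apply]
      refine (congrArg (· ∈ lowIdeal Ψ n) (sub_self _)).mpr (zero_mem _)
    · refine ⟨0, by simp, ?_⟩
      rw [map_zero, sub_zero]
      exact Submodule.subset_span ⟨p, q, by omega, a, ha, b, hb, t, rfl⟩
  | zero => exact ⟨0, by simp, by simp⟩
  | add x y _ _ hx hy =>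
    obtain ⟨ζ, h1, h2⟩ := hx
    obtain ⟨ξ, h3, h4⟩ := hy
    refine ⟨ζ + ξ, by rw [map_add, map_add, h1, h3], ?_⟩
    rw [map_add, add_sub_add_comm]
    exact add_mem h2 h4
  | smul s x _ hx =>
    obtain ⟨ζ, h1, h2⟩ := hx
    refine ⟨s • ζ, ?_, ?_⟩
    · exact (map_smul (LinearMap.baseChange (SymmetricAlgebra ℂ U) _) s ζ).trans
        ((congrArg (s • ·) h1).trans
          (map_smul ((comp (TensAlg.deg I M) n).baseChange (SymmetricAlgebra ℂ U)) s x).symm)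
    · rw [map_smul, ← smul_sub]
      exact Submodule.smul_mem _ _ h2

/-- Every module over `ℂ` is flat, so tensoring preserves exactness of `ker f → P → Q`. The additive
group structures are recovered from the action of `ℂ`. -/
theorem exists_lTensor_ker (S : Type*) {P Q : Type*} [AddCommMonoid S] [Module ℂ S]
    [AddCommMonoid P] [Module ℂ P] [AddCommMonoid Q] [Module ℂ Q] (f : P →ₗ[ℂ] Q) {ζ : S ⊗[ℂ] P}
    (h : f.lTensor S ζ = 0) : ∃ ξ, (LinearMap.ker f).subtype.lTensor S ξ = ζ := by
  let _ := Module.addCommMonoidToAddCommGroup ℂ (M := S)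
  let _ := Module.addCommMonoidToAddCommGroup ℂ (M := P)
  let _ := Module.addCommMonoidToAddCommGroup ℂ (M := Q)
  refine (Module.Flat.lTensor_exact S (fun y => ?_ : Function.Exact (LinearMap.ker f).subtype f)
    ζ).1 h
  rw [Submodule.coe_subtype, Subtype.range_coe, SetLike.mem_coe, LinearMap.mem_ker]

variable {Ψ}

/-- An element of `lowIdeal` without top degree component lies in the next lower step. -/
theorem mem_lowIdeal_of_comp_eq_zero (hA : IsKoszul W) (hΨ : IsBimoduleMap W Ψ) (hP : IsPBW Ψ)
    {n : ℕ} {z : SymmetricAlgebra ℂ U ⊗[ℂ] TensAlg I M} (hz : z ∈ lowIdeal Ψ (n + 1))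
    (h0 : (comp (TensAlg.deg I M) n).lTensor (SymmetricAlgebra ℂ U) z = 0) :
    z ∈ lowIdeal Ψ n := by
  obtain ⟨ζ, h1, h2⟩ := exists_top_of_mem_lowIdeal Ψ hz
  rw [h0] at h1
  obtain ⟨ξ, rfl⟩ := exists_lTensor_ker (SymmetricAlgebra ℂ U) (LinearMap.fst ℂ (TensAlg I M)
    (SymmetricAlgebra ℂ U ⊗[ℂ] TensAlg I M) ∘ₗ (relPairs Ψ n).subtype) h1
  -- The chosen representative is a combination of pairs with zero first component, and
  -- `snd_mem_lowIdeal` puts their second components in the lower step.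
  refine (Submodule.sub_mem_iff_left _ ?_).1 h2
  clear h1 h2
  induction ξ using TensorProduct.induction_on with
  | zero => simp
  | add y y' hy hy' => rw [map_add, map_add]; exact add_mem hy hy'
  | tmul s y =>
    rw [LinearMap.lTensor_tmul, LinearMap.liftBaseChange_tmul]
    exact Submodule.smul_mem _ _ (snd_mem_lowIdeal hA hΨ hP n _ y.1.2 y.2)

variable (Ψ) in
/-- Elements of `T_R(M)` agree in `Ã_Ψ` with elements in the `S`-span of a section of `A`. -/
theorem Deform.mk_inc_mem_range {σ : QuadAlg W →ₗ[ℂ] TensAlg I M}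
    (hσ : ∀ a, QuadAlg.mk W (σ a) = a)
    (hσ' : ∀ n, ∀ a ∈ homog (QuadAlg.deg W) n, σ a ∈ homog (TensAlg.deg I M) n)
    {N : Submodule (SymmetricAlgebra ℂ U) (Deform Ψ)}
    (hN : ∀ a, Deform.mk Ψ (inc I M U (σ a)) ∈ N) (n : ℕ) :
    ∀ t ∈ homog (TensAlg.deg I M) n, Deform.mk Ψ (inc I M U t) ∈ N := by
  induction n using Nat.strong_induction_on with
  | _ n ih =>
  intro t ht
  have h1 := QuadAlg.mem_span_of_mk_eq_zero_of_mem W (n := n) (t := t - σ (QuadAlg.mk W t))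
    (by rw [map_sub, hσ, sub_self]) (sub_mem ht (hσ' n _ (QuadAlg.mk_mem W ht)))
  have h2 : Deform.mk Ψ (inc I M U (t - σ (QuadAlg.mk W t))) ∈ N := by
    generalize t - σ (QuadAlg.mk W t) = y at h1 ⊢
    induction h1 using Submodule.span_induction with
    | mem z hz =>
      obtain ⟨p, q, hpq, a, ha, b, hb, s, hs, rfl⟩ := hz
      have h3 := Deform.mk_relator Ψ ⟨s, hs⟩
      rw [relator_apply, map_sub, sub_eq_zero] at h3
      rw [map_mul, map_mul, map_mul, map_mul, h3, ← map_mul, ← map_mul, psiHat,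
        LinearMap.comp_apply]
      induction Ψ ⟨s, hs⟩ using TensorProduct.induction_on with
      | zero => simp
      | add x y hx hy => rw [map_add, mul_add, add_mul, map_add]; exact add_mem hx hy
      | tmul r z =>
        -- Replacing `w` by `Ψ(w)` lowers the degree in `T_R(M)` from `p + q + 2` to `p + q`, so the
        -- rewriting terminates.
        rw [ofRU_tmul, mul_smul_comm, smul_mul_assoc, ← map_mul, ← map_mul, Deform.mk_smul]
        exact Submodule.smul_mem _ _ (ih (p + 0 + q) (by omega) _
          (mul_mem_homog (mul_mem_homog ha (TensAlg.ofR_mem r)) hb))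
    | zero => simp
    | add x y _ _ hx hy => rw [map_add, map_add]; exact add_mem hx hy
    | smul c x _ hx =>
      rw [map_smul, map_smul, ← algebraMap_smul (SymmetricAlgebra ℂ U)]
      exact Submodule.smul_mem _ _ hx
  rw [map_sub, map_sub] at h2
  exact (Submodule.sub_mem_iff_left _ (hN _)).1 h2

/-- The Poincaré–Birkhoff–Witt theorem for `Ã_Ψ`. -/
theorem Deform.flat_of_isPBW (hA : IsKoszul W) (hΨ : IsBimoduleMap W Ψ) (hP : IsPBW Ψ) :
    Module.Flat (SymmetricAlgebra ℂ U) (Deform Ψ) := by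
  obtain ⟨σ, hσ, hσ'⟩ := QuadAlg.exists_graded_section W
  -- Flatness comes from an isomorphism of `S`-modules `S ⊗ A ≅ Ã_Ψ`, the source being free as a
  -- module obtained by extension of scalars from a field.
  let F : SymmetricAlgebra ℂ U ⊗[ℂ] QuadAlg W →ₗ[SymmetricAlgebra ℂ U] Deform Ψ :=
    (Deform.mkS Ψ).toLinearMap ∘ₗ TensorProduct.AlgebraTensorModule.lTensor _ _ σ
  have hF : ∀ z, F z = Deform.mk Ψ (σ.lTensor (SymmetricAlgebra ℂ U) z) := fun z => rfl
  have hinj : Function.Injective F := by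
    rw [injective_iff_map_eq_zero]
    intro y hy
    rw [hF] at hy
    obtain ⟨n, hn⟩ := Deform.exists_mem_lowIdeal Ψ hy
    have hmk : ∀ y, (QuadAlg.mk W).toLinearMap.lTensor (SymmetricAlgebra ℂ U)
        (σ.lTensor (SymmetricAlgebra ℂ U) y) = y := by
      intro y
      rw [← LinearMap.comp_apply, ← LinearMap.lTensor_comp]
      have : (QuadAlg.mk W).toLinearMap ∘ₗ σ = LinearMap.id := LinearMap.ext hσ
      rw [this, LinearMap.lTensor_id, LinearMap.id_apply]
    have hcomp : ∀ n y, (comp (TensAlg.deg I M) n).lTensor (SymmetricAlgebra ℂ U)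
        (σ.lTensor (SymmetricAlgebra ℂ U) y) = σ.lTensor (SymmetricAlgebra ℂ U)
          ((comp (QuadAlg.deg W) n).lTensor (SymmetricAlgebra ℂ U) y) := by
      intro n y
      rw [← LinearMap.comp_apply, ← LinearMap.lTensor_comp, ← LinearMap.comp_apply,
        ← LinearMap.lTensor_comp]
      congr 2
      exact LinearMap.ext fun a => (map_comp (QuadAlg.iSup_homog W) σ hσ' n a).symm
    -- Descent through the filtration. The top component of an element of the ideal is killed in `S
    -- ⊗ A`; but here it is `σ` of a component of `y`, so that component is zero and the element
    -- lies one step lower.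
    have hbot : σ.lTensor (SymmetricAlgebra ℂ U) y ∈ lowIdeal Ψ 0 := by
      induction n with
      | zero => exact hn
      | succ n ih =>
        refine ih (mem_lowIdeal_of_comp_eq_zero hA hΨ hP hn ?_)
        obtain ⟨ζ, h1, -⟩ := exists_top_of_mem_lowIdeal Ψ hn
        have h2 : (QuadAlg.mk W).toLinearMap.lTensor (SymmetricAlgebra ℂ U)
            ((LinearMap.fst ℂ _ _ ∘ₗ (relPairs Ψ n).subtype).lTensor
              (SymmetricAlgebra ℂ U) ζ) = 0 := by
          rw [← LinearMap.comp_apply, ← LinearMap.lTensor_comp]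
          have : (QuadAlg.mk W).toLinearMap ∘ₗ LinearMap.fst ℂ _ _ ∘ₗ (relPairs Ψ n).subtype = 0 :=
            LinearMap.ext fun y => mk_fst_of_mem_relPairs y.2
          rw [this, LinearMap.lTensor_zero, LinearMap.zero_apply]
        rw [h1, hcomp, hmk] at h2
        rw [hcomp, h2, map_zero]
    have h0 : lowIdeal Ψ 0 = ⊥ := by
      rw [lowIdeal, Submodule.span_eq_bot]
      rintro _ ⟨p, q, h, -⟩
      exact absurd h (Nat.not_lt_zero _)
    rw [h0, Submodule.mem_bot] at hbot
    rw [← hmk y, hbot, map_zero]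
  have hsurj : Function.Surjective F := by
    rw [← LinearMap.range_eq_top, eq_top_iff]
    rintro b -
    obtain ⟨z, rfl⟩ := Deform.mk_surjective Ψ b
    induction z using TensorProduct.induction_on with
    | zero => simp
    | add x y hx hy => rw [map_add]; exact add_mem hx hy
    | tmul s t =>
      rw [tmul_eq_smul_inc, Deform.mk_smul]
      refine Submodule.smul_mem _ _ ?_
      rw [← sum_comp TensAlg.iSup_homog t, map_sum, map_sum]
      exact sum_mem fun n _ => Deform.mk_inc_mem_range Ψ hσ hσ' (N := LinearMap.range F) (fun a => ⟨1 ⊗ₜ a, rfl⟩) n _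
        (comp_mem TensAlg.iSup_homog _ _)
  exact Module.Flat.of_linearEquiv (LinearEquiv.ofBijective F ⟨hinj, hsurj⟩).symm

end Flatness

end QuadKoszul

end

noncomputable section

namespace QuadKoszul

universe u v w x

/-! ### `Ã_Ψ` is a graded deformation -/

section GradedDeformation

open Polynomial

variable {I : Type u} [Fintype I] [DecidableEq I]
variable {M : Type v} [AddCommGroup M] [Module ℂ M] [Module (I → ℂ) M] [Module (I → ℂ)ᵐᵒᵖ M]
  [SMulCommClass (I → ℂ) (I → ℂ)ᵐᵒᵖ M] [IsScalarTower ℂ (I → ℂ) M]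
  [IsScalarTower ℂ (I → ℂ)ᵐᵒᵖ M] [FiniteDimensional ℂ M]
variable {W : Relations I M}
variable {U : Type w} [AddCommGroup U] [Module ℂ U]
variable (Ψ : W.toSubmodule →ₗ[ℂ] (I → ℂ) ⊗[ℂ] U)

theorem Deform.mk_inc_ofR (r : I → ℂ) :
    Deform.mk Ψ (inc I M U (TensAlg.ofR I M r)) = Deform.ofR Ψ r := rfl

theorem Deform.mk_inc_ofM (m : M) :
    Deform.mk Ψ (inc I M U (TensAlg.ofM I M m)) = Deform.ofM Ψ m := rfl

theorem Deform.mk_tmul_one (s : SymmetricAlgebra ℂ U) :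
    Deform.mk Ψ (s ⊗ₜ 1) = algebraMap (SymmetricAlgebra ℂ U) (Deform Ψ) s :=
  (Deform.mkS Ψ).commutes s

theorem Deform.ofU_eq (z : U) : Deform.ofU Ψ z =
    algebraMap (SymmetricAlgebra ℂ U) (Deform Ψ) (SymmetricAlgebra.ι ℂ U z) :=
  Deform.mk_tmul_one Ψ _

theorem Deform.mk_tmul (s : SymmetricAlgebra ℂ U) (t : TensAlg I M) :
    Deform.mk Ψ (s ⊗ₜ t) = algebraMap (SymmetricAlgebra ℂ U) (Deform Ψ) s *
      Deform.mk Ψ (inc I M U t) := by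
  rw [← Deform.mk_tmul_one, ← map_mul, inc_apply, Algebra.TensorProduct.tmul_mul_tmul, one_mul,
    mul_one]

variable {Ψ} in
/-- Universal property of `Ã_Ψ`. -/
def Deform.lift {B : Type*} [Ring B] [Algebra ℂ B] (j : SymmetricAlgebra ℂ U →ₐ[ℂ] B)
    (f : TensAlg I M →ₐ[ℂ] B) (hc : ∀ s t, Commute (j s) (f t))
    (h : ∀ t : W.toSubmodule, f (TensAlg.ofTens I M t) =
      Algebra.TensorProduct.lift j f hc (ofRU I M U (Ψ t))) : Deform Ψ →ₐ[ℂ] B :=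
  RingQuot.liftAlgHom ℂ ⟨Algebra.TensorProduct.lift j f hc, by
    rintro _ _ ⟨t, rfl, rfl⟩
    rw [← h, Algebra.TensorProduct.lift_tmul, map_one, one_mul]⟩

variable {Ψ} in
theorem Deform.lift_mk {B : Type*} [Ring B] [Algebra ℂ B] (j : SymmetricAlgebra ℂ U →ₐ[ℂ] B)
    (f : TensAlg I M →ₐ[ℂ] B) (hc : ∀ s t, Commute (j s) (f t))
    (h : ∀ t : W.toSubmodule, f (TensAlg.ofTens I M t) =
      Algebra.TensorProduct.lift j f hc (ofRU I M U (Ψ t))) (s : SymmetricAlgebra ℂ U)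
    (t : TensAlg I M) : Deform.lift j f hc h (Deform.mk Ψ (s ⊗ₜ t)) = j s * f t :=
  (RingQuot.liftAlgHom_mkAlgHom_apply ℂ _ _ _).trans (Algebra.TensorProduct.lift_tmul _ _ _ _ _)

variable {Ψ} in
theorem Deform.hom_ext {B : Type*} [Ring B] [Algebra ℂ B] {f g : Deform Ψ →ₐ[ℂ] B}
    (hU : ∀ z, f (Deform.ofU Ψ z) = g (Deform.ofU Ψ z))
    (hR : ∀ r, f (Deform.ofR Ψ r) = g (Deform.ofR Ψ r))
    (hM : ∀ m, f (Deform.ofM Ψ m) = g (Deform.ofM Ψ m)) : f = g := by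
  have hS : ∀ s, f (algebraMap (SymmetricAlgebra ℂ U) (Deform Ψ) s) =
      g (algebraMap (SymmetricAlgebra ℂ U) (Deform Ψ) s) := by
    intro s
    induction s using SymmetricAlgebra.induction with
    | algebraMap r => rw [← IsScalarTower.algebraMap_apply, AlgHom.commutes, AlgHom.commutes]
    | ι z => rw [← Deform.ofU_eq, hU]
    | mul a b ha hb => rw [map_mul, map_mul, map_mul, ha, hb]
    | add a b ha hb => rw [map_add, map_add, map_add, ha, hb]
  have hT : ∀ t, f (Deform.mk Ψ (inc I M U t)) = g (Deform.mk Ψ (inc I M U t)) := by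
    intro t
    induction t using TensAlg.induction with
    | hR r => exact hR r
    | hM m => exact hM m
    | ha a b ha hb => simp only [map_add, ha, hb]
    | hm a b ha hb => simp only [map_mul, ha, hb]
  refine AlgHom.ext fun b => ?_
  obtain ⟨z, rfl⟩ := Deform.mk_surjective Ψ b
  induction z using TensorProduct.induction_on with
  | zero => simp
  | add x y hx hy => rw [map_add, map_add, map_add, hx, hy]
  | tmul s t => rw [Deform.mk_tmul, map_mul, map_mul, hS, hT]

theorem Deform.mk_ofTens (t : W.toSubmodule) :
    Deform.mk Ψ (inc I M U (TensAlg.ofTens I M t)) = Deform.mk Ψ (ofRU I M U (Ψ t)) := by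
  have h := Deform.mk_relator Ψ t
  rwa [relator_apply, map_sub, sub_eq_zero] at h

theorem Deform.mk_ofRU_tmul (r : I → ℂ) (z : U) :
    Deform.mk Ψ (ofRU I M U (r ⊗ₜ z)) = Deform.ofU Ψ z * Deform.ofR Ψ r := by
  rw [ofRU_tmul, ← tmul_eq_smul_inc, Deform.mk_tmul, ← Deform.ofU_eq, Deform.mk_inc_ofR]

variable (U) in
/-- The grading of `Sym U` with `U` in degree two. -/
def symDeg : SymmetricAlgebra ℂ U →ₐ[ℂ] (SymmetricAlgebra ℂ U)[X] :=
  SymmetricAlgebra.lift (((monomial 2).restrictScalars ℂ) ∘ₗ SymmetricAlgebra.ι ℂ U)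

theorem commute_map_algebraMap {S B : Type*} [CommRing S] [Ring B] [Algebra S B] (p : S[X])
    (q : B[X]) : Commute (p.map (algebraMap S B)) q := by
  induction p using Polynomial.induction_on' with
  | add p p' hp hp' => rw [Polynomial.map_add]; exact hp.add_left hp'
  | monomial n s =>
    induction q using Polynomial.induction_on' with
    | add q q' hq hq' => exact hq.add_right hq'
    | monomial m b =>
      rw [map_monomial, commute_iff_eq, monomial_mul_monomial, monomial_mul_monomial, add_comm,
        Algebra.commutes]

theorem Deform.commute_deg (s : SymmetricAlgebra ℂ U) (t : TensAlg I M) :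
    Commute (((mapAlgHom (IsScalarTower.toAlgHom ℂ (SymmetricAlgebra ℂ U) (Deform Ψ))).comp
      (symDeg U)) s)
      (((mapAlgHom ((Deform.mk Ψ).comp (inc I M U))).comp (TensAlg.deg I M)) t) :=
  commute_map_algebraMap _ _

/-- The grading of `Ã_Ψ`. -/
def Deform.deg : Deform Ψ →ₐ[ℂ] (Deform Ψ)[X] :=
  Deform.lift
    ((mapAlgHom (IsScalarTower.toAlgHom ℂ (SymmetricAlgebra ℂ U) (Deform Ψ))).comp (symDeg U))
    ((mapAlgHom ((Deform.mk Ψ).comp (inc I M U))).comp (TensAlg.deg I M))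
    (Deform.commute_deg Ψ) (by
      intro t
      rw [AlgHom.comp_apply, mem_homog.1 (TensAlg.ofTens_mem _), coe_mapAlgHom, map_monomial,
        RingHom.coe_coe, AlgHom.comp_apply, Deform.mk_ofTens]
      induction Ψ t using TensorProduct.induction_on with
      | zero => simp
      | add x y hx hy => simp only [map_add, hx, hy]
      | tmul r z =>
        rw [Deform.mk_ofRU_tmul, ofRU_tmul, ← tmul_eq_smul_inc, Algebra.TensorProduct.lift_tmul,
          AlgHom.comp_apply, AlgHom.comp_apply, mem_homog.1 (TensAlg.ofR_mem r), symDeg,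
          SymmetricAlgebra.lift_ι_apply, LinearMap.comp_apply, LinearMap.restrictScalars_apply,
          coe_mapAlgHom, coe_mapAlgHom, map_monomial, map_monomial, monomial_mul_monomial,
          Deform.ofU_eq]
        rfl)

theorem Deform.deg_mk (s : SymmetricAlgebra ℂ U) (t : TensAlg I M) :
    Deform.deg Ψ (Deform.mk Ψ (s ⊗ₜ t)) =
      (symDeg U s).map (algebraMap (SymmetricAlgebra ℂ U) (Deform Ψ)) *
        (TensAlg.deg I M t).map ((Deform.mk Ψ).comp (inc I M U)).toRingHom :=
  Deform.lift_mk _ _ _ _ _ _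

theorem Deform.mk_inc_mem {n : ℕ} {t : TensAlg I M} (ht : t ∈ homog (TensAlg.deg I M) n) :
    Deform.mk Ψ (inc I M U t) ∈ homog (Deform.deg Ψ) n := by
  rw [mem_homog, inc_apply, Deform.deg_mk, map_one, Polynomial.map_one, one_mul, mem_homog.1 ht,
    map_monomial]
  rfl

theorem Deform.ofR_mem (r : I → ℂ) : Deform.ofR Ψ r ∈ homog (Deform.deg Ψ) 0 :=
  Deform.mk_inc_mem Ψ (TensAlg.ofR_mem r)

theorem Deform.ofM_mem (m : M) : Deform.ofM Ψ m ∈ homog (Deform.deg Ψ) 1 :=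
  Deform.mk_inc_mem Ψ (TensAlg.ofM_mem m)

theorem Deform.ofU_mem (z : U) : Deform.ofU Ψ z ∈ homog (Deform.deg Ψ) 2 := by
  have h := Deform.deg_mk Ψ (SymmetricAlgebra.ι ℂ U z) 1
  rw [map_one, Polynomial.map_one, mul_one, symDeg, SymmetricAlgebra.lift_ι_apply,
    LinearMap.comp_apply, LinearMap.restrictScalars_apply, map_monomial, ← Deform.ofU_eq] at h
  exact h

variable {Ψ} in
/-- A homomorphism that respects degrees on generators is graded. -/
theorem Deform.map_mem {B : Type*} [Ring B] [Algebra ℂ B] {gr : ℕ → Submodule ℂ B}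
    (one_mem : (1 : B) ∈ gr 0) (mul_mem : ∀ m n, ∀ x ∈ gr m, ∀ y ∈ gr n, x * y ∈ gr (m + n))
    {f : Deform Ψ →ₐ[ℂ] B} (hU : ∀ z, f (Deform.ofU Ψ z) ∈ gr 2)
    (hR : ∀ r, f (Deform.ofR Ψ r) ∈ gr 0) (hM : ∀ m, f (Deform.ofM Ψ m) ∈ gr 1) {n : ℕ}
    {b : Deform Ψ} (hb : b ∈ Deform.gr Ψ n) : f b ∈ gr n := by
  have hpow : ∀ (N : Submodule ℂ (Deform Ψ)) (d : ℕ), N ≤ (gr d).comap f.toLinearMap →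
      ∀ n, N ^ n ≤ (gr (d * n)).comap f.toLinearMap := by
    intro N d hN n
    induction n with
    | zero =>
      rw [pow_zero, Submodule.one_le]
      exact (congrArg (· ∈ gr 0) (map_one f)).mpr one_mem
    | succ n ih =>
      rw [pow_succ, Submodule.mul_le]
      intro a ha b hb
      exact (congrArg (· ∈ gr _) (map_mul f a b)).mpr (mul_mem _ _ _ (ih ha) _ (hN hb))
  refine (?_ : Deform.gr Ψ n ≤ (gr n).comap f.toLinearMap) hb
  refine iSup_le fun i => iSup_le fun k => iSup_le fun h => ?_
  rw [mul_assoc, Submodule.mul_le]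
  intro a ha b hb
  rw [← h, add_comm, ← zero_add (i : ℕ), ← one_mul i]
  refine (congrArg (· ∈ gr _) (map_mul f a b)).mpr (mul_mem _ _ _
    (hpow _ 2 (by rintro _ ⟨z, rfl⟩; exact hU z) k ha) _ ?_)
  refine (Submodule.mul_le.2 ?_ : _ ≤ (gr (0 + 1 * i)).comap f.toLinearMap) hb
  rintro _ ⟨r, rfl⟩ b hb
  exact (congrArg (· ∈ gr _) (map_mul f _ b)).mpr (mul_mem _ _ _ (hR r) _
    (hpow _ 1 (by rintro _ ⟨z, rfl⟩; exact hM z) i hb))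

theorem Deform.gr_le (n : ℕ) : Deform.gr Ψ n ≤ homog (Deform.deg Ψ) n := fun _ hb =>
  Deform.map_mem (f := AlgHom.id ℂ _) one_mem_homog (fun _ _ _ hx _ hy => mul_mem_homog hx hy)
    (Deform.ofU_mem Ψ) (Deform.ofR_mem Ψ) (Deform.ofM_mem Ψ) hb

theorem TensAlg.homog_le (n : ℕ) : homog (TensAlg.deg I M) n ≤
    LinearMap.range (TensAlg.ofR I M).toLinearMap * LinearMap.range (TensAlg.ofM I M) ^ n := by
  obtain ⟨X⟩ := exists_arrowBasis I M
  induction n with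
  | zero =>
    intro t ht
    rw [TensAlg.eq_ofR_of_mem_zero X ht, pow_zero, mul_one]
    exact ⟨_, rfl⟩
  | succ n ih =>
    intro t ht
    rw [ArrowBasis.eq_sum_of_mem_succ X ht]
    refine sum_mem fun k _ => ?_
    have h := ih (ArrowBasis.deriv_mem X ht k)
    generalize ArrowBasis.deriv X k t = y at h ⊢
    induction h using Submodule.mul_induction_on' with
    | mem_mul_mem r hr y hy =>
      obtain ⟨r, rfl⟩ := hr
      rw [AlgHom.toLinearMap_apply, ← mul_assoc, ← TensAlg.ofM_right,
        ← one_mul (TensAlg.ofM I M _ * y), pow_succ']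
      exact Submodule.mul_mem_mul ⟨1, map_one (TensAlg.ofR I M)⟩
        (Submodule.mul_mem_mul ⟨_, rfl⟩ hy)
    | add x _ y _ hx hy => rw [mul_add]; exact add_mem hx hy

theorem Deform.iSup_gr : ⨆ n, Deform.gr Ψ n = ⊤ := by
  have hS : ∀ s, algebraMap (SymmetricAlgebra ℂ U) (Deform Ψ) s ∈
      ⨆ k, LinearMap.range (Deform.ofU Ψ) ^ k := by
    have hm : ∀ i j, ∀ a ∈ LinearMap.range (Deform.ofU Ψ) ^ i,
        ∀ b ∈ LinearMap.range (Deform.ofU Ψ) ^ j, a * b ∈ LinearMap.range (Deform.ofU Ψ) ^ (i + j) :=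
      fun i j a ha b hb => by rw [pow_add]; exact Submodule.mul_mem_mul ha hb
    intro s
    induction s using SymmetricAlgebra.induction with
    | algebraMap r =>
      rw [← IsScalarTower.algebraMap_apply]
      exact Submodule.mem_iSup_of_mem 0 (by rw [pow_zero]; exact Submodule.algebraMap_mem r)
    | ι z =>
      rw [← Deform.ofU_eq]
      exact Submodule.mem_iSup_of_mem 1 (by rw [pow_one]; exact ⟨z, rfl⟩)
    | mul a b ha hb => rw [map_mul]; exact mul_mem_iSup hm ha hb
    | add a b ha hb => rw [map_add]; exact add_mem ha hb
  have hT : ∀ n, ∀ t ∈ homog (TensAlg.deg I M) n, Deform.mk Ψ (inc I M U t) ∈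
      LinearMap.range (Deform.ofR Ψ).toLinearMap * LinearMap.range (Deform.ofM Ψ) ^ n := by
    intro n t ht
    have h := Submodule.mem_map_of_mem (f := ((Deform.mk Ψ).comp (inc I M U)).toLinearMap)
      (TensAlg.homog_le n ht)
    rw [Submodule.map_mul, Submodule.map_pow, ← LinearMap.range_comp, ← LinearMap.range_comp] at h
    exact h
  refine eq_top_iff.2 fun b _ => ?_
  obtain ⟨z, rfl⟩ := Deform.mk_surjective Ψ b
  induction z using TensorProduct.induction_on with
  | zero => simp
  | add x y hx hy => rw [map_add]; exact add_mem (hx trivial) (hy trivial)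
  | tmul s t =>
    rw [← sum_comp TensAlg.iSup_homog t, TensorProduct.tmul_sum, map_sum]
    refine sum_mem fun i _ => ?_
    rw [Deform.mk_tmul]
    generalize algebraMap (SymmetricAlgebra ℂ U) (Deform Ψ) s = y, hS s = hy
    induction hy using Submodule.iSup_induction' with
    | mem k y hy =>
      refine Submodule.mem_iSup_of_mem (i + 2 * k) (Submodule.mem_iSup_of_mem i
        (Submodule.mem_iSup_of_mem k (Submodule.mem_iSup_of_mem rfl ?_)))
      rw [mul_assoc]
      exact Submodule.mul_mem_mul hy (hT i _ (comp_mem TensAlg.iSup_homog _ _))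
    | zero => simp
    | add x y _ _ hx hy => rw [add_mul]; exact add_mem hx hy

theorem Deform.gr_eq (n : ℕ) : Deform.gr Ψ n = homog (Deform.deg Ψ) n :=
  eq_homog_of_le (Deform.gr_le Ψ) (Deform.iSup_gr Ψ) n

theorem Deform.π_mk (s : SymmetricAlgebra ℂ U) (t : TensAlg I M) :
    Deform.π Ψ (Deform.mk Ψ (s ⊗ₜ t)) =
      algebraMap ℂ _ (SymmetricAlgebra.algebraMapInv s) * QuadAlg.mk W t :=
  (RingQuot.liftAlgHom_mkAlgHom_apply ℂ _ _ _).trans (Algebra.TensorProduct.lift_tmul _ _ _ _ _)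

theorem Deform.π_mk_inc (t : TensAlg I M) :
    Deform.π Ψ (Deform.mk Ψ (inc I M U t)) = QuadAlg.mk W t := by
  rw [inc_apply, Deform.π_mk, map_one, map_one, one_mul]

theorem Deform.π_ofU (z : U) : Deform.π Ψ (Deform.ofU Ψ z) = 0 :=
  (Deform.π_mk Ψ _ _).trans (by rw [SymmetricAlgebra.algebraMapInv_ι, map_zero, zero_mul])

theorem Deform.π_mem {n : ℕ} {b : Deform Ψ} (hb : b ∈ homog (Deform.deg Ψ) n) :
    Deform.π Ψ b ∈ homog (QuadAlg.deg W) n := by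
  -- The two gradings are compared as algebra homomorphisms, so checking generators suffices.
  have h : (QuadAlg.deg W).comp (Deform.π Ψ) =
      (mapAlgHom (Deform.π Ψ)).comp (Deform.deg Ψ) := by
    refine Deform.hom_ext (fun z => ?_) (fun r => ?_) (fun m => ?_)
    · rw [AlgHom.comp_apply, AlgHom.comp_apply, Deform.π_ofU, map_zero,
        mem_homog.1 (Deform.ofU_mem Ψ z), coe_mapAlgHom, map_monomial, RingHom.coe_coe,
        Deform.π_ofU, map_zero]
    · rw [AlgHom.comp_apply, AlgHom.comp_apply, mem_homog.1 (Deform.ofR_mem Ψ r), coe_mapAlgHom,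
        map_monomial, RingHom.coe_coe, ← Deform.mk_inc_ofR, Deform.π_mk_inc]
      exact QuadAlg.ofR_mem W r
    · rw [AlgHom.comp_apply, AlgHom.comp_apply, mem_homog.1 (Deform.ofM_mem Ψ m), coe_mapAlgHom,
        map_monomial, RingHom.coe_coe, ← Deform.mk_inc_ofM, Deform.π_mk_inc]
      exact QuadAlg.ofM_mem W m
  have h2 := AlgHom.congr_fun h b
  rw [AlgHom.comp_apply, AlgHom.comp_apply, mem_homog.1 hb, coe_mapAlgHom, map_monomial] at h2
  exact h2

/-- Modulo the ideal generated by `U` the relations become `w = 0`, so `A` maps to that quotient.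
The quotient map factors through `π`, hence `ker π` is no larger than the ideal. -/
theorem Deform.ker_π : TwoSidedIdeal.ker (Deform.π Ψ) = TwoSidedIdeal.span (Set.range fun z =>
    algebraMap (SymmetricAlgebra ℂ U) (Deform Ψ) (SymmetricAlgebra.ι ℂ U z)) := by
  refine le_antisymm ?_ ?_
  · set J := TwoSidedIdeal.span (Set.range fun z =>
      algebraMap (SymmetricAlgebra ℂ U) (Deform Ψ) (SymmetricAlgebra.ι ℂ U z)) with hJ
    let φ : Deform Ψ →ₐ[ℂ] J.ringCon.Quotient := RingCon.mkₐ ℂ J.ringCon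
    have hφ : ∀ b, φ b = 0 ↔ b ∈ J := fun b =>
      (RingCon.eq J.ringCon).trans (TwoSidedIdeal.mem_iff J b).symm
    have hU : ∀ z, φ (Deform.ofU Ψ z) = 0 := fun z => (hφ _).2 (by
      rw [Deform.ofU_eq]; exact TwoSidedIdeal.subset_span ⟨z, rfl⟩)
    let χ : QuadAlg W →ₐ[ℂ] J.ringCon.Quotient :=
      QuadAlg.lift (φ.comp ((Deform.mk Ψ).comp (inc I M U))) (by
        intro t ht
        rw [AlgHom.comp_apply, AlgHom.comp_apply]
        refine (congrArg φ (Deform.mk_ofTens Ψ ⟨t, ht⟩)).trans ?_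
        induction Ψ ⟨t, ht⟩ using TensorProduct.induction_on with
        | zero => simp
        | add x y hx hy => simp only [map_add, hx, hy, add_zero]
        | tmul r z => rw [Deform.mk_ofRU_tmul, map_mul, hU, zero_mul])
    have h : χ.comp (Deform.π Ψ) = φ := by
      refine Deform.hom_ext (fun z => ?_) (fun r => ?_) (fun m => ?_)
      · rw [AlgHom.comp_apply, Deform.π_ofU, map_zero, hU]
      · rw [AlgHom.comp_apply, ← Deform.mk_inc_ofR, Deform.π_mk_inc]
        exact QuadAlg.lift_mk _ _ _
      · rw [AlgHom.comp_apply, ← Deform.mk_inc_ofM, Deform.π_mk_inc]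
        exact QuadAlg.lift_mk _ _ _
    intro b hb
    rw [TwoSidedIdeal.mem_ker] at hb
    rw [← hφ, ← h, AlgHom.comp_apply, hb, map_zero]
  · rw [TwoSidedIdeal.span_le]
    rintro _ ⟨z, rfl⟩
    exact (TwoSidedIdeal.mem_ker _).2
      ((congrArg _ (Deform.ofU_eq Ψ z).symm).trans (Deform.π_ofU Ψ z))

theorem Deform.isGradedDeformation :
    IsGradedDeformation W U (Deform Ψ) (Deform.gr Ψ) (Deform.ofR Ψ) (Deform.π Ψ) := by
  have hgr : Deform.gr Ψ = homog (Deform.deg Ψ) := funext (Deform.gr_eq Ψ)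
  have htop : ⨆ n, homog (Deform.deg Ψ) n = ⊤ := by
    rw [← hgr, Deform.iSup_gr]
  refine ⟨?_, ?_, ?_, ?_, ?_, ?_, ?_, ?_, Deform.ker_π Ψ⟩
  · rw [hgr]; exact isInternal_homog htop
  · rw [hgr]; exact one_mem_homog
  · rw [hgr]; exact fun m n x hx y hy => mul_mem_homog hx hy
  · rw [hgr]; exact Deform.ofR_mem Ψ
  · rw [hgr]; exact fun z => (Deform.ofU_eq Ψ z) ▸ Deform.ofU_mem Ψ z
  · exact fun r => Deform.π_mk_inc Ψ _
  · intro n b hb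
    rw [QuadAlg.gr_eq]
    rw [hgr] at hb
    exact Deform.π_mem Ψ hb
  · intro a
    obtain ⟨t, rfl⟩ := QuadAlg.mk_surjective W a
    exact ⟨_, Deform.π_mk_inc Ψ t⟩

end GradedDeformation

/-! ### Consequences of flatness -/

section FlatConsequences

variable {I : Type u} [Fintype I] [DecidableEq I]
variable {M : Type v} [AddCommGroup M] [Module ℂ M] [Module (I → ℂ) M] [Module (I → ℂ)ᵐᵒᵖ M]
  [SMulCommClass (I → ℂ) (I → ℂ)ᵐᵒᵖ M] [IsScalarTower ℂ (I → ℂ) M]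
  [IsScalarTower ℂ (I → ℂ)ᵐᵒᵖ M] [FiniteDimensional ℂ M]
variable {W : Relations I M}
variable {U : Type w} [AddCommGroup U] [Module ℂ U]

/-- The linear part of the relation is detected by the homomorphisms from `Sym U` to the dual
numbers given by functionals `f` on `U`. They yield `∑ a_i(0) f(z_i) = 0` for all `f`. -/
theorem algebraMapInv_eq_zero_of_sum_eq_zero {ι : Type*} [Fintype ι] {z : ι → U}
    (hz : LinearIndependent ℂ z) {a : ι → SymmetricAlgebra ℂ U}
    (h : ∑ i, a i * SymmetricAlgebra.ι ℂ U (z i) = 0) (i : ι) :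
    SymmetricAlgebra.algebraMapInv (a i) = 0 := by
  refine Fintype.linearIndependent_iff.1 hz (fun i => SymmetricAlgebra.algebraMapInv (a i)) ?_ i
  rw [← Module.forall_dual_apply_eq_zero_iff ℂ]
  intro f
  let φ : SymmetricAlgebra ℂ U →ₐ[ℂ] DualNumber ℂ :=
    SymmetricAlgebra.lift (TrivSqZeroExt.inrHom ℂ ℂ ∘ₗ f)
  have hfst : ∀ s, (φ s).fst = SymmetricAlgebra.algebraMapInv s := by
    have : (TrivSqZeroExt.fstHom ℂ ℂ ℂ).comp φ = SymmetricAlgebra.algebraMapInv := by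
      refine SymmetricAlgebra.algHom_ext (LinearMap.ext fun z => ?_)
      simp [φ, SymmetricAlgebra.algebraMapInv]
    exact fun s => AlgHom.congr_fun this s
  have h2 := congrArg (fun s => (φ s).snd) h
  simp only [map_sum, map_mul, map_zero, TrivSqZeroExt.snd_zero, TrivSqZeroExt.snd_sum] at h2
  rw [map_sum, ← h2]
  refine Finset.sum_congr rfl fun i _ => ?_
  simp [φ, ← hfst, TrivSqZeroExt.snd_mul, mul_comm]

variable {B : Type x} [Ring B] [Algebra ℂ B] [Algebra (SymmetricAlgebra ℂ U) B]
  [IsScalarTower ℂ (SymmetricAlgebra ℂ U) B] {π : B →ₐ[ℂ] QuadAlg W}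

theorem map_symm_smul
    (hπ : ∀ z, π (algebraMap (SymmetricAlgebra ℂ U) B (SymmetricAlgebra.ι ℂ U z)) = 0)
    (s : SymmetricAlgebra ℂ U) (b : B) :
    π (s • b) = SymmetricAlgebra.algebraMapInv s • π b := by
  have h : ∀ s, π (algebraMap (SymmetricAlgebra ℂ U) B s) =
      algebraMap ℂ _ (SymmetricAlgebra.algebraMapInv s) := by
    intro s
    induction s using SymmetricAlgebra.induction with
    | algebraMap r =>
      rw [← IsScalarTower.algebraMap_apply, AlgHom.commutes, AlgHom.commutes]
      rfl
    | ι z => rw [hπ, SymmetricAlgebra.algebraMapInv_ι, map_zero]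
    | mul a b ha hb => simp only [map_mul, ha, hb]
    | add a b ha hb => simp only [map_add, ha, hb]
  rw [Algebra.smul_def, map_mul, Algebra.smul_def, h]

/-- In a flat deformation, a relation `∑ zᵢ bᵢ = 0` with linearly independent `zᵢ ∈ U` forces
`bᵢ` to vanish in `A`. -/
theorem eq_zero_of_sum_smul_eq_zero [Module.Flat (SymmetricAlgebra ℂ U) B]
    (hπ : ∀ z, π (algebraMap (SymmetricAlgebra ℂ U) B (SymmetricAlgebra.ι ℂ U z)) = 0)
    {ι : Type*} [Fintype ι] {z : ι → U} (hz : LinearIndependent ℂ z) {b : ι → B}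
    (h : ∑ i, SymmetricAlgebra.ι ℂ U (z i) • b i = 0) (i : ι) : π (b i) = 0 := by
  -- The equational criterion for flatness: the relation comes from relations `∑ z_i a_ij = 0` in
  -- `Sym U`, whose coefficients have zero constant term and therefore die in `A`.
  have h0 := Module.Flat.isTrivialRelation_of_sum_smul_eq_zero (R := SymmetricAlgebra ℂ U) (M := B)
    (f := fun i => SymmetricAlgebra.ι ℂ U (z i)) (x := b)
  obtain ⟨k, a, y, h1, h2⟩ := h0 h
  rw [h1 i, map_sum]
  refine Finset.sum_eq_zero fun j _ => ?_
  rw [map_symm_smul hπ, algebraMapInv_eq_zero_of_sum_eq_zero hz (a := fun i => a i j)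
    (by rw [← h2 j]; exact Finset.sum_congr rfl fun i _ => mul_comm _ _), zero_smul]

/-- A flat deformation satisfies the Poincaré–Birkhoff–Witt condition. -/
theorem isPBW_of_flat (Ψ : W.toSubmodule →ₗ[ℂ] (I → ℂ) ⊗[ℂ] U)
    [Module.Flat (SymmetricAlgebra ℂ U) (Deform Ψ)] : IsPBW Ψ := by
  intro p q hpq
  let E : U ⊗[ℂ] M →ₗ[ℂ] SymmetricAlgebra ℂ U ⊗[ℂ] TensAlg I M :=
    TensorProduct.map (SymmetricAlgebra.ι ℂ U) (TensAlg.ofM I M)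
  have h1 : ∀ p, psiM Ψ p ∈ LinearMap.range E := by
    intro p
    induction p using TensorProduct.induction_on with
    | zero => simp
    | add x y hx hy => rw [map_add]; exact add_mem hx hy
    | tmul t m =>
      rw [psiM_tmul, psiHat, LinearMap.comp_apply]
      induction Ψ t using TensorProduct.induction_on with
      | zero => simp
      | add x y hx hy => rw [map_add, add_mul]; exact add_mem hx hy
      | tmul r z =>
        refine ⟨z ⊗ₜ (r • m), ?_⟩
        rw [ofRU_tmul, smul_mul_assoc, ← map_mul, ← TensAlg.ofM_left, ← tmul_eq_smul_inc]
        rfl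
  have h2 : ∀ q, mPsi Ψ q ∈ LinearMap.range E := by
    intro p
    induction p using TensorProduct.induction_on with
    | zero => simp
    | add x y hx hy => rw [map_add]; exact add_mem hx hy
    | tmul m t =>
      rw [mPsi_tmul, psiHat, LinearMap.comp_apply]
      induction Ψ t using TensorProduct.induction_on with
      | zero => simp
      | add x y hx hy => rw [map_add, mul_add]; exact add_mem hx hy
      | tmul r z =>
        refine ⟨z ⊗ₜ (op r • m), ?_⟩
        rw [ofRU_tmul, mul_smul_comm, ← map_mul, ← TensAlg.ofM_right, ← tmul_eq_smul_inc]
        rfl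
  have h3 : ∀ p, Deform.mk Ψ (psiM Ψ p) = Deform.mk Ψ (inc I M U (relM W p)) := by
    intro p
    induction p using TensorProduct.induction_on with
    | zero => simp
    | add x y hx hy => simp only [map_add, hx, hy]
    | tmul t m =>
      rw [psiM_tmul, relM_tmul, map_mul, map_mul, map_mul, Deform.mk_ofTens]
      rfl
  have h4 : ∀ q, Deform.mk Ψ (mPsi Ψ q) = Deform.mk Ψ (inc I M U (mRel W q)) := by
    intro q
    induction q using TensorProduct.induction_on with
    | zero => simp
    | add x y hx hy => simp only [map_add, hx, hy]
    | tmul m t =>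
      rw [mPsi_tmul, mRel_tmul, map_mul, map_mul, map_mul, Deform.mk_ofTens]
      rfl
  -- The defect lies in `U ⊗ M`. It vanishes in `Ã_Ψ` because both reductions equal the image of the
  -- same element of `T_R(M)`.
  obtain ⟨y, hy⟩ := sub_mem (h1 p) (h2 q)
  have h5 : Deform.mk Ψ (E y) = 0 := by rw [hy, map_sub, h3, h4, hpq, sub_self]
  obtain ⟨s, z, m, hz, rfl⟩ : ∃ (s : Finset (Module.Basis.ofVectorSpaceIndex ℂ U))
      (z : s → U) (m : s → M), LinearIndependent ℂ z ∧ y = ∑ i, z i ⊗ₜ m i := by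
    let bs := Module.Basis.ofVectorSpace ℂ U
    obtain ⟨c, rfl⟩ := TensorProduct.eq_repr_basis_left bs y
    refine ⟨c.support, fun i => bs i, fun i => c i,
      bs.linearIndependent.comp _ Subtype.val_injective, ?_⟩
    rw [Finsupp.sum, ← Finset.sum_coe_sort]
  have h6 : ∀ i, m i = 0 := by
    intro i
    have h7 := eq_zero_of_sum_smul_eq_zero (B := Deform Ψ) (π := Deform.π Ψ)
      (fun z => by rw [← Deform.ofU_eq, Deform.π_ofU]) hz (b := fun i => Deform.ofM Ψ (m i)) (by
        rw [← h5, map_sum, map_sum]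
        refine Finset.sum_congr rfl fun i _ => ?_
        rw [TensorProduct.map_tmul, tmul_eq_smul_inc, Deform.mk_smul]
        rfl) i
    rw [← Deform.mk_inc_ofM, Deform.π_mk_inc] at h7
    exact (map_eq_zero_iff _ (QuadAlg.ofM_injective W)).1 h7
  rw [← sub_eq_zero, ← hy, map_sum]
  exact Finset.sum_eq_zero fun i _ => by rw [h6, TensorProduct.tmul_zero, map_zero]

end FlatConsequences

end QuadKoszul

end

noncomputable section

namespace QuadKoszul

universe u v w x

/-! ### The center of the quadratic dual -/

section Duality

variable {I : Type u} [Fintype I] [DecidableEq I]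
variable {M : Type v} [AddCommGroup M] [Module ℂ M] [Module (I → ℂ) M] [Module (I → ℂ)ᵐᵒᵖ M]
  [SMulCommClass (I → ℂ) (I → ℂ)ᵐᵒᵖ M] [IsScalarTower ℂ (I → ℂ) M]
  [IsScalarTower ℂ (I → ℂ)ᵐᵒᵖ M] [FiniteDimensional ℂ M]
variable {W : Relations I M}

instance : FiniteDimensional ℂ (BDual I M) :=
  inferInstanceAs (FiniteDimensional ℂ (Module.Dual ℂ M))

variable (X : ArrowBasis I M)

/-- The dual basis of `M^*`. -/
def dualArrow (k : X.ι) : BDual I M := ArrowBasis.coord X k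

theorem dualArrow_apply (k : X.ι) (m : M) : dualArrow X k m = ArrowBasis.coord X k m := rfl

theorem BDual.map_sum (g : BDual I M) {ι : Type*} (s : Finset ι) (m : ι → M) :
    g (∑ i ∈ s, m i) = ∑ i ∈ s, g (m i) := _root_.map_sum g m s

theorem BDual.map_smul_eq (g : BDual I M) (r : I → ℂ) (m : M) :
    g (r • m) = ∑ c, r c * g (e c • m) := by
  conv_lhs => rw [← sum_smul_e r, Finset.sum_smul]
  rw [BDual.map_sum]
  exact Finset.sum_congr rfl fun c _ => by rw [smul_assoc, BDual.map_csmul]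

theorem op_sum_smul_e (r : I → ℂ) (m : M) : op r • m = ∑ c, r c • op (e c) • m := by
  conv_lhs => rw [← sum_smul_e r, ← MulOpposite.opAddEquiv_apply, map_sum, Finset.sum_smul]
  exact Finset.sum_congr rfl fun c _ => by
    rw [MulOpposite.opAddEquiv_apply, MulOpposite.op_smul, smul_assoc]

theorem e_symm (a b : I) : e a b = e b a := by
  by_cases h : a = b
  · rw [h]
  · rw [e_of_ne h, e_of_ne (Ne.symm h)]

theorem tensL_eq_sum (r : I → ℂ) (t : Tens I M) : tensL I r t = ∑ c, r c • tensL I (e c) t := by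
  induction t using tens_induction with
  | h0 => simp
  | ht m n =>
    conv_lhs => rw [tensL_tmul, ← sum_smul_e r, Finset.sum_smul]
    simp only [← tmulBil_apply, map_sum, LinearMap.sum_apply, smul_assoc, map_smul,
      LinearMap.smul_apply]
    exact Finset.sum_congr rfl fun c _ => by rw [tmulBil_apply, tmulBil_apply, tensL_tmul]
  | ha s t hs ht => simp only [map_add, hs, ht, smul_add, Finset.sum_add_distrib]

theorem sum_tensR_e (t : Tens I M) : ∑ c : I, tensR I (e c) t = t := by
  induction t using tens_induction with
  | h0 => simp
  | ht m n =>
    have h := op_sum_smul_e (1 : I → ℂ) n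
    simp only [Pi.one_apply, one_smul, MulOpposite.op_one] at h
    simp only [tensR_tmul]
    conv_rhs => rw [h]
    simp only [← tmulBil_apply, map_sum]
  | ha s t hs ht => simp only [map_add, Finset.sum_add_distrib, hs, ht]

theorem sum_dualArrow (g : BDual I M) : ∑ k, g (X.basis k) • dualArrow X k = g := by
  have h : ∀ m, (∑ k, g (X.basis k) • dualArrow X k) m =
      ∑ k, g (X.basis k) * ArrowBasis.coord X k m := fun m =>
    (LinearMap.sum_apply _ _ m).trans rfl
  refine BDual.ext fun m => ?_
  rw [h]
  conv_rhs => rw [← ArrowBasis.sum_coord X m, BDual.map_sum]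
  exact Finset.sum_congr rfl fun k _ => by rw [BDual.map_csmul, mul_comm]

theorem dualArrow_mul_e (k : X.ι) : op (e (X.src k)) • dualArrow X k = dualArrow X k :=
  BDual.ext fun m => by
    rw [BDual.right_apply, dualArrow_apply, ArrowBasis.coord_left, e_self, one_mul, dualArrow_apply]

theorem e_mul_dualArrow (k : X.ι) : e (X.tgt k) • dualArrow X k = dualArrow X k :=
  BDual.ext fun m => by
    rw [BDual.left_apply, dualArrow_apply, ArrowBasis.coord_right, e_self, one_mul, dualArrow_apply]

/-- Inserting `1 = ∑ e c` at the tensor sign matches the sum over `c` in the pairing. -/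
theorem sum_tmul_e {N : Type*} [AddCommGroup N] [Module ℂ N] [Module (I → ℂ) N]
    [Module (I → ℂ)ᵐᵒᵖ N] [SMulCommClass (I → ℂ) (I → ℂ)ᵐᵒᵖ N] [IsScalarTower ℂ (I → ℂ) N]
    [IsScalarTower ℂ (I → ℂ)ᵐᵒᵖ N] (m n : N) :
    ∑ c : I, tmul I (op (e c) • m) (e c • n) = tmul I m n := by
  have h : ∀ c : I, tmul I (op (e c) • m) (e c • n) = tmulBil I m (e c • n) := fun c => by
    rw [tmul_balanced, smul_smul, e_mul_e, tmulBil_apply]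
  rw [Finset.sum_congr rfl fun c _ => h c, ← map_sum, ← Finset.sum_smul, sum_e, one_smul,
    tmulBil_apply]

/-- The element of `M ⊗_R M` that represents a functional on `M^* ⊗_R M^*`. -/
def coPair (G : Tens I (BDual I M) →ₗ[ℂ] ℂ) : Tens I M :=
  ∑ b, ∑ c, G (tmul I (dualArrow X b) (dualArrow X c)) • tmul I (X.basis c) (X.basis b)

/-- The pairing contracts the first dual factor with the second factor of `M ⊗_R M`; this is why the
basis vectors occur in reversed order in `coPair`. -/
theorem pairing_coPair (s : Tens I (BDual I M)) (G : Tens I (BDual I M) →ₗ[ℂ] ℂ) :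
    pairing I M s (coPair X G) = G s := by
  induction s using tens_induction with
  | h0 => simp
  | ha s t hs ht => simp only [map_add, LinearMap.add_apply, hs, ht]
  | ht f g =>
    have key : ∀ d : I, G (tmul I (op (e d) • f) (e d • g)) =
        ∑ b, ∑ c, f (e d • X.basis b) * g (op (e d) • X.basis c) *
          G (tmul I (dualArrow X b) (dualArrow X c)) := by
      intro d
      conv_lhs => rw [← sum_dualArrow X (op (e d) • f), ← sum_dualArrow X (e d • g)]
      simp only [← tmulBil_apply, map_sum, LinearMap.sum_apply, map_smul, LinearMap.smul_apply,
        BDual.left_apply, BDual.right_apply, smul_eq_mul, Finset.mul_sum]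
      rw [Finset.sum_comm]
      exact Finset.sum_congr rfl fun b _ => Finset.sum_congr rfl fun c _ => by ring
    conv_rhs => rw [← sum_tmul_e f g, map_sum]
    simp only [coPair, key, map_sum, map_smul, pairing_tmul, smul_eq_mul]
    conv_rhs => rw [Finset.sum_comm]
    refine Finset.sum_congr rfl fun b _ => ?_
    conv_rhs => rw [Finset.sum_comm]
    refine Finset.sum_congr rfl fun c _ => ?_
    rw [Finset.mul_sum]
    exact Finset.sum_congr rfl fun d _ => mul_comm _ _

/-- Every functional on `M ⊗_R M` comes from `M^* ⊗_R M^*`. -/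
theorem pairing_surjective : Function.Surjective (pairing I M) := by
  obtain ⟨X⟩ := exists_arrowBasis I M
  intro F
  refine ⟨∑ b, ∑ c, F (tmul I (X.basis c) (X.basis b)) • tmul I (dualArrow X b) (dualArrow X c),
    tens_hom_ext fun m n => ?_⟩
  have key : ∀ d : I, F (tmul I (op (e d) • m) (e d • n)) =
      ∑ b, ∑ c, F (tmul I (X.basis c) (X.basis b)) *
        (dualArrow X b (e d • n) * dualArrow X c (op (e d) • m)) := by
    intro d
    conv_lhs => rw [← ArrowBasis.sum_coord X (op (e d) • m), ← ArrowBasis.sum_coord X (e d • n)]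
    simp only [← tmulBil_apply, map_sum, LinearMap.sum_apply, map_smul, LinearMap.smul_apply,
      smul_eq_mul, Finset.mul_sum]
    exact Finset.sum_congr rfl fun b _ => Finset.sum_congr rfl fun c _ => by
      rw [dualArrow_apply, dualArrow_apply]; ring
  conv_rhs => rw [← sum_tmul_e m n, map_sum]
  simp only [key, map_sum, LinearMap.sum_apply, map_smul, LinearMap.smul_apply, pairing_tmul,
    smul_eq_mul]
  conv_rhs => rw [Finset.sum_comm]
  refine Finset.sum_congr rfl fun b _ => ?_
  conv_rhs => rw [Finset.sum_comm]
  refine Finset.sum_congr rfl fun c _ => ?_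
  rw [Finset.mul_sum]

/-- The double orthogonal of `W` is `W`: a functional separating `t` from `W` is given by an element
of `W^⊥`. -/
theorem mem_of_pairing_eq_zero {t : Tens I M}
    (h : ∀ s ∈ W.perp.toSubmodule, pairing I M s t = 0) : t ∈ W.toSubmodule := by
  by_contra ht
  obtain ⟨F, hF, hF'⟩ := Submodule.exists_le_ker_of_notMem ht
  obtain ⟨s, rfl⟩ := pairing_surjective F
  exact hF (h s fun t ht => hF' ht)

/-! ### The action of `T_R(M^*)` on `T_R(M)` -/

/-- The action of `T_R(M^*)` on `T_R(M)`, in which `M^*` acts by contraction from the left. -/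
def dualAct : TensAlg I (BDual I M) →ₐ[ℂ] Module.End ℂ (TensAlg I M) :=
  TensAlg.lift ((Algebra.lmul ℂ (TensAlg I M)).comp (TensAlg.ofR I M))
    { toFun := fun g => ∑ k, g (X.basis k) • ArrowBasis.deriv X k
      map_add' := fun g g' => by
        simp only [BDual.add_apply, add_smul, Finset.sum_add_distrib]
      map_smul' := fun c g => by
        simp only [BDual.smul_apply, mul_smul, Finset.smul_sum, RingHom.id_apply] }
    (by
      intro r g
      refine LinearMap.ext fun t => ?_
      simp only [LinearMap.coe_mk, AddHom.coe_mk, Module.End.mul_apply, LinearMap.sum_apply,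
        LinearMap.smul_apply, AlgHom.comp_apply, Algebra.coe_lmul_eq_mul, LinearMap.mul_apply',
        Finset.mul_sum, mul_smul_comm]
      refine Finset.sum_congr rfl fun k _ => ?_
      rw [BDual.left_apply, X.right, BDual.map_csmul, ← ArrowBasis.e_mul_deriv, ← mul_assoc,
        ← map_mul, mul_e, map_smul, smul_mul_assoc, smul_smul, mul_comm])
    (by
      intro r g
      refine LinearMap.ext fun t => ?_
      simp only [LinearMap.coe_mk, AddHom.coe_mk, Module.End.mul_apply, LinearMap.sum_apply,
        LinearMap.smul_apply, AlgHom.comp_apply, Algebra.coe_lmul_eq_mul, LinearMap.mul_apply']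
      refine Finset.sum_congr rfl fun k _ => ?_
      rw [BDual.right_apply, X.left, BDual.map_csmul, ArrowBasis.deriv_ofR_mul, smul_smul,
        mul_comm])

theorem dualAct_ofR (r : I → ℂ) (t : TensAlg I M) :
    dualAct X (TensAlg.ofR I _ r) t = TensAlg.ofR I M r * t := by
  rw [dualAct, TensAlg.lift_ofR]
  rfl

/-- Contraction strips the leftmost factor of a tensor. In a product `f g` the factor `g` acts
first, in agreement with the order reversal of the pairing. -/
theorem dualAct_ofM (g : BDual I M) (m : M) (t : TensAlg I M) :
    dualAct X (TensAlg.ofM I _ g) (TensAlg.ofM I M m * t) =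
      TensAlg.ofR I M (fun c => g (op (e c) • m)) * t := by
  have h : (fun c => g (op (e c) • m)) =
      ∑ k, (g (X.basis k) * ArrowBasis.coord X k m) • e (X.tgt k) := by
    funext c
    conv_lhs => rw [← ArrowBasis.sum_coord X m, Finset.smul_sum, BDual.map_sum]
    rw [Finset.sum_apply]
    refine Finset.sum_congr rfl fun k _ => ?_
    rw [smul_comm, X.right, BDual.map_csmul, BDual.map_csmul, Pi.smul_apply, smul_eq_mul,
      e_symm]
    ring
  rw [dualAct, TensAlg.lift_ofM, h, map_sum, Finset.sum_mul]
  simp only [LinearMap.coe_mk, AddHom.coe_mk, LinearMap.sum_apply, LinearMap.smul_apply,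
    ArrowBasis.deriv_ofM_mul, map_smul, smul_mul_assoc, smul_smul]

theorem dualAct_ofTens (s : Tens I (BDual I M)) (w : Tens I M) (t : TensAlg I M) :
    dualAct X (TensAlg.ofTens I _ s) (TensAlg.ofTens I M w * t) =
      TensAlg.ofR I M (fun d => pairing I M s (tensR I (e d) w)) * t := by
  have hadd : ∀ f g : I → ℂ, (fun d => f d + g d) = f + g := fun _ _ => rfl
  induction s using tens_induction with
  | h0 =>
    simp only [map_zero, LinearMap.zero_apply]
    rw [show (fun _ : I => (0 : ℂ)) = 0 from rfl, map_zero, zero_mul]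
  | ha s s' hs hs' => simp only [map_add, LinearMap.add_apply, hs, hs', hadd, add_mul]
  | ht f g =>
    induction w using tens_induction with
    | h0 =>
      simp only [map_zero, zero_mul]
      rw [show (fun _ : I => (0 : ℂ)) = 0 from rfl, map_zero, zero_mul]
    | ha w w' hw hw' => simp only [map_add, add_mul, hw, hw', hadd]
    | ht m n =>
      rw [TensAlg.ofTens_tmul, TensAlg.ofTens_tmul, map_mul (dualAct X), Module.End.mul_apply, mul_assoc,
        dualAct_ofM, ← mul_assoc, ← TensAlg.ofM_left, dualAct_ofM]
      congr 2
      funext d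
      rw [tensR_tmul, pairing_tmul, ← smul_comm, BDual.map_smul_eq]
      exact Finset.sum_congr rfl fun c _ => mul_comm _ _

theorem dualAct_ofTens_of_perp {s : Tens I (BDual I M)} (hs : s ∈ W.perp.toSubmodule)
    (w : W.toSubmodule) (t : TensAlg I M) :
    dualAct X (TensAlg.ofTens I _ s) (TensAlg.ofTens I M w * t) = 0 := by
  rw [dualAct_ofTens]
  have h : (fun d => pairing I M s (tensR I (e d) w)) = (0 : I → ℂ) :=
    funext fun d => hs _ (W.right_mem _ w.2)
  rw [h, map_zero, zero_mul]

/-- The kernel of `T_R(M^*) → A^!` in degree three kills `W ⊗ M ∩ M ⊗ W`. -/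
theorem dualAct_eq_zero {D : TensAlg I (BDual I M)} (hD : QuadAlg.mk W.perp D = 0)
    (hD3 : D ∈ homog (TensAlg.deg I (BDual I M)) 3) {p : W.toSubmodule ⊗[ℂ] M}
    {q : M ⊗[ℂ] W.toSubmodule} (h : relM W p = mRel W q) : dualAct X D (relM W p) = 0 := by
  obtain ⟨Z⟩ := exists_arrowBasis I (BDual I M)
  have hD' := QuadAlg.mem_span_of_mk_eq_zero_of_mem W.perp hD hD3
  clear hD hD3
  induction hD' using Submodule.span_induction with
  | mem D hD =>
    obtain ⟨i, j, hij, a, ha, b, hb, s, hs, rfl⟩ := hD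
    rw [map_mul, map_mul, Module.End.mul_apply, Module.End.mul_apply]
    have key : dualAct X (TensAlg.ofTens I _ s) (dualAct X b (relM W p)) = 0 := by
      -- In degree three exactly one of `a`, `b` has degree one. If `b` has degree zero, the element
      -- of `W^⊥` meets the left factor and the presentation in `W ⊗ M` is used; if `b` has degree
      -- one, it first removes the arrow of the presentation in `M ⊗ W`.
      rcases j with _ | j
      · rw [TensAlg.eq_ofR_of_mem_zero Z hb, dualAct_ofR]
        clear h
        induction p using TensorProduct.induction_on with
        | zero => simp
        | add x y hx hy => rw [map_add, mul_add, map_add, hx, hy, add_zero]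
        | tmul t m =>
          rw [relM_tmul, ← mul_assoc, ← TensAlg.ofTens_tensL]
          exact dualAct_ofTens_of_perp X hs ⟨_, W.left_mem _ t.2⟩ _
      · obtain rfl : j = 0 := by omega
        rw [h, ArrowBasis.eq_sum_of_mem_succ Z hb, map_sum, LinearMap.sum_apply, map_sum]
        refine Finset.sum_eq_zero fun k _ => ?_
        rw [TensAlg.eq_ofR_of_mem_zero Z (ArrowBasis.deriv_mem Z hb k), ← TensAlg.ofM_right]
        clear h
        induction q using TensorProduct.induction_on with
        | zero => simp
        | add x y hx hy => rw [map_add, map_add, map_add, hx, hy, add_zero]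
        | tmul m t =>
          rw [mRel_tmul, dualAct_ofM, ← TensAlg.ofTens_tensL, ← mul_one (TensAlg.ofTens I M _)]
          exact dualAct_ofTens_of_perp X hs ⟨_, W.left_mem _ t.2⟩ _
    rw [key, map_zero]
  | zero => simp
  | add x y _ _ hx hy => rw [map_add, LinearMap.add_apply, hx, hy, add_zero]
  | smul c x _ hx => rw [map_smul, LinearMap.smul_apply, hx, smul_zero]

/-! ### The condition on a functional -/

/-- The map `w ⊗ m ↦ ∑ f(w e_d) e_d m`. -/
def lPair (f : Module.Dual ℂ W.toSubmodule) : W.toSubmodule ⊗[ℂ] M →ₗ[ℂ] M :=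
  TensorProduct.lift (LinearMap.mk₂ ℂ
    (fun t m => (fun d => f (W.rMap (e d) t) : I → ℂ) • m)
    (fun t t' m => by rw [← add_smul]; congr 1; funext d; simp)
    (fun c t m => by rw [← smul_assoc]; congr 1; funext d; simp)
    (fun t m m' => smul_add _ _ _) (fun c t m => smul_comm _ c m))

/-- The map `m ⊗ w ↦ ∑ f(e_c w) m e_c`. -/
def rPair (f : Module.Dual ℂ W.toSubmodule) : M ⊗[ℂ] W.toSubmodule →ₗ[ℂ] M :=
  TensorProduct.lift (LinearMap.mk₂ ℂ
    (fun m t => op (fun d => f (W.lMap (e d) t) : I → ℂ) • m)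
    (fun m m' t => smul_add _ _ _) (fun c m t => smul_comm _ c m)
    (fun m t t' => by rw [← add_smul, ← MulOpposite.op_add]; congr 2; funext d; simp)
    (fun c m t => by rw [← smul_assoc, ← MulOpposite.op_smul]; congr 2; funext d; simp))

theorem lPair_tmul (f : Module.Dual ℂ W.toSubmodule) (t : W.toSubmodule) (m : M) :
    lPair f (t ⊗ₜ m) = (fun d => f (W.rMap (e d) t) : I → ℂ) • m := rfl

theorem rPair_tmul (f : Module.Dual ℂ W.toSubmodule) (t : W.toSubmodule) (m : M) :
    rPair f (m ⊗ₜ t) = op (fun d => f (W.lMap (e d) t) : I → ℂ) • m := rfl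

variable (W) in
/-- The functional on `W` given by an element of `M^* ⊗_R M^*`. -/
def pairRel (s : Tens I (BDual I M)) : Module.Dual ℂ W.toSubmodule :=
  pairing I M s ∘ₗ W.toSubmodule.subtype

theorem pairRel_apply (s : Tens I (BDual I M)) (t : W.toSubmodule) :
    pairRel W s t = pairing I M s t := rfl

/-- The commutator of `s` with `g ∈ M^*` is a cubic relation of `A^!`, so it annihilates the common
element of `W ⊗ M` and `M ⊗ W`. Computing the action of `g s` from one presentation and of `s g`
from the other gives the two sides, paired with `g`. -/
theorem lPair_eq_rPair_of_commute {s : Tens I (BDual I M)}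
    (hs : ∀ g, QuadAlg.mk W.perp (TensAlg.ofTens I _ s) * QuadAlg.ofM W.perp g =
      QuadAlg.ofM W.perp g * QuadAlg.mk W.perp (TensAlg.ofTens I _ s))
    {p : W.toSubmodule ⊗[ℂ] M} {q : M ⊗[ℂ] W.toSubmodule} (h : relM W p = mRel W q) :
    lPair (pairRel W s) p = rPair (pairRel W s) q := by
  obtain ⟨X⟩ := exists_arrowBasis I M
  rw [← sub_eq_zero, ← Module.forall_dual_apply_eq_zero_iff ℂ]
  intro g
  rw [map_sub, sub_eq_zero]
  let g' : BDual I M := g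
  have h0 : dualAct X (TensAlg.ofTens I _ s * TensAlg.ofM I _ g' -
      TensAlg.ofM I _ g' * TensAlg.ofTens I _ s) (relM W p) = 0 := by
    refine dualAct_eq_zero X (W := W) ?_ (sub_mem ?_ ?_) h
    · rw [map_sub, map_mul, map_mul, sub_eq_zero]
      exact hs g'
    · exact mul_mem_homog (TensAlg.ofTens_mem s) (TensAlg.ofM_mem g')
    · exact mul_mem_homog (TensAlg.ofM_mem g') (TensAlg.ofTens_mem s)
  rw [map_sub, LinearMap.sub_apply, sub_eq_zero] at h0
  -- Full contraction lands in `R`; summing the coordinates removes the idempotents and leaves the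
  -- scalar pairing.
  have h1 : ∀ p, ∑ c, TensAlg.aug I M (dualAct X (TensAlg.ofM I _ g' * TensAlg.ofTens I _ s)
      (relM W p)) c = g (lPair (pairRel W s) p) := by
    intro p
    induction p using TensorProduct.induction_on with
    | zero => simp
    | add x y hx hy => simp only [map_add, Pi.add_apply, Finset.sum_add_distrib, hx, hy]
    | tmul t m =>
      rw [relM_tmul, map_mul (dualAct X), Module.End.mul_apply, dualAct_ofTens, ← TensAlg.ofM_left,
        ← mul_one (TensAlg.ofM I M _), dualAct_ofM, mul_one, TensAlg.aug_ofR, lPair_tmul]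
      have h2 := BDual.map_sum g' Finset.univ fun c : I => op (e c) •
        ((fun d => pairing I M s (tensR I (e d) t) : I → ℂ) • m)
      rw [← h2]
      have h3 := op_sum_smul_e (1 : I → ℂ)
        ((fun d => pairing I M s (tensR I (e d) t) : I → ℂ) • m)
      simp only [Pi.one_apply, one_smul, MulOpposite.op_one] at h3
      rw [← h3]
      rfl
  have h2 : ∀ q, ∑ c, TensAlg.aug I M (dualAct X (TensAlg.ofTens I _ s * TensAlg.ofM I _ g')
      (mRel W q)) c = g (rPair (pairRel W s) q) := by
    intro q
    induction q using TensorProduct.induction_on with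
    | zero => simp
    | add x y hx hy => simp only [map_add, Pi.add_apply, Finset.sum_add_distrib, hx, hy]
    | tmul m t =>
      rw [mRel_tmul, map_mul (dualAct X), Module.End.mul_apply, dualAct_ofM, ← TensAlg.ofTens_tensL,
        ← mul_one (TensAlg.ofTens I M _), dualAct_ofTens, mul_one, TensAlg.aug_ofR, rPair_tmul,
        op_sum_smul_e, ← map_sum, sum_tensR_e, tensL_eq_sum, map_sum, map_sum]
      refine Finset.sum_congr rfl fun c _ => ?_
      rw [map_smul (pairing I M s), map_smul g, smul_eq_mul, smul_eq_mul, mul_comm]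
      rfl
  rw [← h1 p, ← h2 q, ← h0, h]

/-- Conversely, every functional `Φ` on `A^!` restricts to its cubic part as pairing with an element
of `W ⊗_R M ∩ M ⊗_R W`. The hypothesis for that element says that `Φ` takes the same value on `s g`
and `g s`. -/
theorem commute_of_lPair_eq_rPair {s : Tens I (BDual I M)}
    (hs : ∀ (p : W.toSubmodule ⊗[ℂ] M) (q : M ⊗[ℂ] W.toSubmodule), relM W p = mRel W q →
      lPair (pairRel W s) p = rPair (pairRel W s) q) (g : BDual I M) :
    QuadAlg.mk W.perp (TensAlg.ofTens I _ s) * QuadAlg.ofM W.perp g =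
      QuadAlg.ofM W.perp g * QuadAlg.mk W.perp (TensAlg.ofTens I _ s) := by
  obtain ⟨X⟩ := exists_arrowBasis I M
  rw [← sub_eq_zero, ← Module.forall_dual_apply_eq_zero_iff ℂ]
  intro Φ
  rw [map_sub, sub_eq_zero]
  let y : X.ι → QuadDual W := fun k => QuadAlg.ofM W.perp (dualArrow X k)
  let G : X.ι → Tens I (BDual I M) →ₗ[ℂ] ℂ := fun a =>
    Φ ∘ₗ LinearMap.mulLeft ℂ (y a) ∘ₗ QuadAlg.ofTens W.perp
  let G' : X.ι → Tens I (BDual I M) →ₗ[ℂ] ℂ := fun c =>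
    Φ ∘ₗ LinearMap.mulRight ℂ (y c) ∘ₗ QuadAlg.ofTens W.perp
  have hG : ∀ a s, G a s = Φ (y a * QuadAlg.mk W.perp (TensAlg.ofTens I _ s)) := fun _ _ => rfl
  have hG' : ∀ a s, G' a s = Φ (QuadAlg.mk W.perp (TensAlg.ofTens I _ s) * y a) := fun _ _ => rfl
  -- Fixing an outer factor of a cubic product leaves a functional that kills `W^⊥`, because `Φ` is
  -- defined on `A^!`; its representing tensor is therefore a relation.
  have hω : ∀ a, coPair X (G a) ∈ W.toSubmodule := fun a => mem_of_pairing_eq_zero fun s hs => by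
    rw [pairing_coPair, hG, QuadAlg.mk_ofTens W.perp hs, mul_zero, map_zero]
  have hω' : ∀ a, coPair X (G' a) ∈ W.toSubmodule := fun a => mem_of_pairing_eq_zero fun s hs => by
    rw [pairing_coPair, hG', QuadAlg.mk_ofTens W.perp hs, zero_mul, map_zero]
  let p : W.toSubmodule ⊗[ℂ] M := ∑ a, (⟨_, hω a⟩ : W.toSubmodule) ⊗ₜ X.basis a
  let q : M ⊗[ℂ] W.toSubmodule := ∑ c, X.basis c ⊗ₜ (⟨_, hω' c⟩ : W.toSubmodule)
  -- Both sides are the tensor whose coefficient at `x_c x_b x_a` is `Φ(y_a y_b y_c)`.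
  have hpq : relM W p = mRel W q := by
    simp only [p, q, map_sum, relM_tmul, mRel_tmul, coPair, map_smul, TensAlg.ofTens_tmul,
      Finset.sum_mul, Finset.mul_sum, smul_mul_assoc, mul_smul_comm, hG, hG', map_mul, mul_assoc]
    conv_rhs => rw [Finset.sum_comm]
    refine Finset.sum_congr rfl fun a _ => ?_
    conv_rhs => rw [Finset.sum_comm]
    exact Finset.sum_congr rfl fun b _ => Finset.sum_congr rfl fun c _ => rfl
  have h := congrArg g (hs p q hpq)
  have hl : g (lPair (pairRel W s) p) =
      Φ (QuadAlg.ofM W.perp g * QuadAlg.mk W.perp (TensAlg.ofTens I _ s)) := by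
    simp only [p, map_sum, lPair_tmul, X.left, pairRel_apply, Relations.coe_rMap]
    conv_rhs => rw [← sum_dualArrow X g, map_sum, Finset.sum_mul, map_sum]
    refine Finset.sum_congr rfl fun a _ => ?_
    rw [BDual.map_csmul, ← pairing_tensL, pairing_coPair, hG, TensAlg.ofTens_tensL,
      map_mul (QuadAlg.mk W.perp), ← mul_assoc, QuadAlg.mk_ofR, ← QuadAlg.ofM_right,
      dualArrow_mul_e, map_smul (QuadAlg.ofM W.perp), smul_mul_assoc, map_smul Φ, smul_eq_mul,
      mul_comm]
  have hr : g (rPair (pairRel W s) q) =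
      Φ (QuadAlg.mk W.perp (TensAlg.ofTens I _ s) * QuadAlg.ofM W.perp g) := by
    simp only [q, map_sum, rPair_tmul, X.right, pairRel_apply, Relations.coe_lMap]
    conv_rhs => rw [← sum_dualArrow X g, map_sum, Finset.mul_sum, map_sum]
    refine Finset.sum_congr rfl fun a _ => ?_
    rw [BDual.map_csmul, ← pairing_tensR, pairing_coPair, hG', TensAlg.ofTens_tensR,
      map_mul (QuadAlg.mk W.perp), mul_assoc, QuadAlg.mk_ofR, ← QuadAlg.ofM_left, e_mul_dualArrow,
      map_smul (QuadAlg.ofM W.perp), mul_smul_comm, map_smul Φ, smul_eq_mul, mul_comm]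
  rw [← hl, ← hr, h]

end Duality

end QuadKoszul

end

noncomputable section

namespace QuadKoszul

universe u v w x

/-! ### Central functionals and the criterion for flatness -/

section Center

variable {I : Type u} [Fintype I] [DecidableEq I]
variable {M : Type v} [AddCommGroup M] [Module ℂ M] [Module (I → ℂ) M] [Module (I → ℂ)ᵐᵒᵖ M]
  [SMulCommClass (I → ℂ) (I → ℂ)ᵐᵒᵖ M] [IsScalarTower ℂ (I → ℂ) M]
  [IsScalarTower ℂ (I → ℂ)ᵐᵒᵖ M] [FiniteDimensional ℂ M]
variable {W : Relations I M}

theorem Relations.lMap_mul (r s : I → ℂ) (t : W.toSubmodule) :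
    W.lMap (r * s) t = W.lMap r (W.lMap s t) := Subtype.ext (tensL_mul r s t.1)

theorem Relations.lMap_smul (c : ℂ) (r : I → ℂ) (t : W.toSubmodule) :
    W.lMap (c • r) t = c • W.lMap r t := Subtype.ext (tensL_smul c r t.1)

theorem Relations.lMap_rMap (r s : I → ℂ) (t : W.toSubmodule) :
    W.lMap r (W.rMap s t) = W.rMap s (W.lMap r t) := Subtype.ext (tensL_tensR r s t.1)

theorem Relations.sum_lMap_e (t : W.toSubmodule) : ∑ a, W.lMap (e a) t = t := by
  refine Subtype.ext ?_
  have h := tensL_eq_sum (1 : I → ℂ) t.1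
  simp only [Pi.one_apply, one_smul, tensL_one] at h
  rw [AddSubmonoidClass.coe_finsetSum]
  exact h.symm

/-! ### The degree two part of the center of `A^!` -/

theorem QuadAlg.exists_mk_ofTens {a : QuadAlg W} (ha : a ∈ QuadAlg.gr W 2) :
    ∃ t, QuadAlg.mk W (TensAlg.ofTens I M t) = a := by
  rw [← QuadAlg.range_ofQuot] at ha
  obtain ⟨t, rfl⟩ := ha
  obtain ⟨t, rfl⟩ := Submodule.mkQ_surjective _ t
  exact ⟨t, rfl⟩

theorem QuadAlg.mk_ofTens_mem (t : Tens I M) :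
    QuadAlg.mk W (TensAlg.ofTens I M t) ∈ QuadAlg.gr W 2 := by
  rw [← QuadAlg.range_ofQuot]
  exact ⟨W.toSubmodule.mkQ t, rfl⟩

theorem dualDegTwo_mk (s : Tens I (BDual I M)) :
    dualDegTwo W ⟨_, QuadAlg.mk_ofTens_mem s⟩ = pairRel W s := by
  have h : (QuadAlg.degTwo W.perp).symm ⟨_, QuadAlg.mk_ofTens_mem s⟩ =
      W.perp.toSubmodule.mkQ s := (LinearEquiv.symm_apply_eq _).2 (Subtype.ext rfl)
  rw [dualDegTwo, LinearMap.comp_apply, LinearEquiv.coe_coe, h]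
  rfl

/-- The degree two relations of `A^!` are exactly `W^⊥`, so `A^!_2` embeds in the dual of `W`. -/
theorem pairRel_eq_iff {s s' : Tens I (BDual I M)} : pairRel W s = pairRel W s' ↔
    QuadAlg.mk W.perp (TensAlg.ofTens I _ s) = QuadAlg.mk W.perp (TensAlg.ofTens I _ s') := by
  rw [← sub_eq_zero, ← sub_eq_zero (b := QuadAlg.mk W.perp _), ← map_sub, ← map_sub,
    QuadAlg.mk_ofTens_eq_zero_iff]
  constructor
  · intro h t ht
    rw [map_sub]
    exact LinearMap.congr_fun h ⟨t, ht⟩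
  · intro h
    refine LinearMap.ext fun t => ?_
    have := h t t.2
    rwa [map_sub] at this

theorem pairRel_surjective : Function.Surjective (pairRel W) := by
  intro f
  obtain ⟨F, hF⟩ := LinearMap.exists_extend f
  obtain ⟨s, rfl⟩ := pairing_surjective F
  exact ⟨s, hF⟩

theorem commute_ofR_iff (s : Tens I (BDual I M)) (r : I → ℂ) :
    QuadAlg.mk W.perp (TensAlg.ofTens I _ s) * QuadAlg.ofR W.perp r =
      QuadAlg.ofR W.perp r * QuadAlg.mk W.perp (TensAlg.ofTens I _ s) ↔
    pairRel W s ∘ₗ W.lMap r = pairRel W s ∘ₗ W.rMap r := by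
  rw [← QuadAlg.mk_ofR, ← map_mul (QuadAlg.mk W.perp), ← map_mul (QuadAlg.mk W.perp),
    ← TensAlg.ofTens_tensL, ← TensAlg.ofTens_tensR, ← pairRel_eq_iff]
  have h1 : pairRel W (tensR I r s) = pairRel W s ∘ₗ W.lMap r :=
    LinearMap.ext fun t => pairing_tensR r s t.1
  have h2 : pairRel W (tensL I r s) = pairRel W s ∘ₗ W.rMap r :=
    LinearMap.ext fun t => pairing_tensL r s t.1
  rw [h1, h2]

theorem QuadAlg.mem_center_iff {z : QuadAlg W} : z ∈ Subalgebra.center ℂ (QuadAlg W) ↔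
    (∀ r, z * QuadAlg.ofR W r = QuadAlg.ofR W r * z) ∧
      ∀ m, z * QuadAlg.ofM W m = QuadAlg.ofM W m * z := by
  rw [Subalgebra.mem_center_iff]
  refine ⟨fun h => ⟨fun r => (h _).symm, fun m => (h _).symm⟩, fun ⟨h1, h2⟩ b => ?_⟩
  induction b using QuadAlg.induction with
  | hR r => exact (h1 r).symm
  | hM m => exact (h2 m).symm
  | hm a b ha hb => rw [mul_assoc, hb, ← mul_assoc, ha, mul_assoc]
  | ha a b ha hb => rw [add_mul, mul_add, ha, hb]

/-- A functional on `W` is central if it vanishes on commutators with `R` and satisfies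
`f ⊗ 1 = 1 ⊗ f` on `W ⊗ M ∩ M ⊗ W`. -/
structure IsCentralFunctional (f : Module.Dual ℂ W.toSubmodule) : Prop where
  lMap_eq : ∀ r t, f (W.lMap r t) = f (W.rMap r t)
  lPair_eq : ∀ p q, relM W p = mRel W q → lPair f p = rPair f q

theorem isCentralFunctional_pairRel_iff (s : Tens I (BDual I M)) :
    IsCentralFunctional (pairRel W s) ↔
      QuadAlg.mk W.perp (TensAlg.ofTens I _ s) ∈ centerTwo W := by
  rw [centerTwo, Submodule.mem_inf, Subalgebra.mem_toSubmodule, QuadAlg.mem_center_iff]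
  refine ⟨fun h => ⟨⟨fun r => (commute_ofR_iff s r).2 (LinearMap.ext (h.lMap_eq r)),
    commute_of_lPair_eq_rPair h.lPair_eq⟩, QuadAlg.mk_ofTens_mem s⟩, fun h => ⟨fun r t => ?_,
    fun p q => lPair_eq_rPair_of_commute h.1.2⟩⟩
  exact LinearMap.congr_fun ((commute_ofR_iff s r).1 (h.1.1 r)) t

/-- Every functional on `W` comes from `A^!_2`, so the central functionals are precisely the values
of the transpose of `q`. -/
theorem isCentralFunctional_iff {f : Module.Dual ℂ W.toSubmodule} :
    IsCentralFunctional f ↔ ∃ z, (toCenterDual W).flip z = f := by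
  constructor
  · intro h
    obtain ⟨s, rfl⟩ := pairRel_surjective f
    exact ⟨⟨_, (isCentralFunctional_pairRel_iff s).1 h⟩, dualDegTwo_mk s⟩
  · rintro ⟨⟨z, hz⟩, rfl⟩
    obtain ⟨s, rfl⟩ := QuadAlg.exists_mk_ofTens hz.2
    have h : (toCenterDual W).flip ⟨_, hz⟩ = pairRel W s := dualDegTwo_mk s
    rw [h]
    exact (isCentralFunctional_pairRel_iff s).2 hz

instance : FiniteDimensional ℂ (QuadAlg.gr W 2) :=
  LinearEquiv.finiteDimensional (QuadAlg.degTwo W)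

instance : FiniteDimensional ℂ (centerTwo W) :=
  Submodule.finiteDimensional_of_le (inf_le_right : centerTwo W ≤ QuadAlg.gr W.perp 2)

theorem flip_toCenterDual_injective : Function.Injective (toCenterDual W).flip := by
  rintro ⟨z, hz⟩ ⟨z', hz'⟩ h
  obtain ⟨s, rfl⟩ := QuadAlg.exists_mk_ofTens hz.2
  obtain ⟨s', rfl⟩ := QuadAlg.exists_mk_ofTens hz'.2
  refine Subtype.ext (pairRel_eq_iff.1 ?_)
  rw [← dualDegTwo_mk, ← dualDegTwo_mk]
  exact h

/-- The transpose of `q` is the inclusion `Z(A^!)_2 → A^!_2 ≅ W^*`, which is injective, and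
`Z(A^!)_2` is finite-dimensional, hence reflexive. -/
theorem toCenterDual_surjective : Function.Surjective (toCenterDual W) := by
  rw [← LinearMap.range_eq_top]
  by_contra h
  obtain ⟨y, hy⟩ : ∃ y, y ∉ LinearMap.range (toCenterDual W) := by
    by_contra hy
    push Not at hy
    exact h (eq_top_iff.2 fun y _ => hy y)
  obtain ⟨F, hF, hF'⟩ := Submodule.exists_le_ker_of_notMem hy
  obtain ⟨z, rfl⟩ := (Module.bijective_dual_eval ℂ (centerTwo W)).2 F
  have hz : z = 0 := flip_toCenterDual_injective
    (LinearMap.ext fun t => by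
      rw [map_zero]; exact LinearMap.mem_ker.1 (hF' ⟨t, rfl⟩))
  exact hF (by rw [hz, map_zero, LinearMap.zero_apply])

/-! ### Bimodule maps `W → R ⊗ U` -/

variable {U : Type w} [AddCommGroup U] [Module ℂ U]

variable (I U) in
/-- The map `R ⊗ U → U` that sends each `e a ⊗ z` to `z`. -/
def sumRU : (I → ℂ) ⊗[ℂ] U →ₗ[ℂ] U :=
  (TensorProduct.lid ℂ U).toLinearMap ∘ₗ
    (LinearMap.rTensor U (∑ a, LinearMap.proj a : (I → ℂ) →ₗ[ℂ] ℂ))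

theorem sumRU_tmul (r : I → ℂ) (z : U) : sumRU I U (r ⊗ₜ z) = (∑ a, r a) • z := by
  simp [sumRU]

theorem sumRU_smul (r : I → ℂ) (p : (I → ℂ) ⊗[ℂ] U) :
    sumRU I U (r • p) = sumRU I U (op r • p) := by
  induction p using TensorProduct.induction_on with
  | zero => simp
  | tmul s z =>
    rw [TensorProduct.smul_tmul', TensorProduct.smul_tmul', smul_eq_mul, op_smul_eq_mul,
      mul_comm]
  | add p q hp hq => simp only [smul_add, map_add, hp, hq]

/-- An element of `e a R ⊗ U = ℂ e a ⊗ U` is determined by its image in `U`, which is why `Ψ` can be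
rebuilt from `Ψ°`. -/
theorem e_smul_eq (a : I) (p : (I → ℂ) ⊗[ℂ] U) : e a • p = e a ⊗ₜ sumRU I U (e a • p) := by
  induction p using TensorProduct.induction_on with
  | zero => simp
  | tmul s z =>
    rw [TensorProduct.smul_tmul', sumRU_tmul, smul_eq_mul, mul_comm, mul_e, ← TensorProduct.smul_tmul]
    congr 2
    simp [Pi.single_apply]
  | add p q hp hq => rw [smul_add, map_add, TensorProduct.tmul_add, ← hp, ← hq]

variable {Ψ : W.toSubmodule →ₗ[ℂ] (I → ℂ) ⊗[ℂ] U}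

theorem circ_apply (t : W.toSubmodule) : circ Ψ t = sumRU I U (Ψ t) := rfl

theorem circ_lMap (hΨ : IsBimoduleMap W Ψ) (r : I → ℂ) (t : W.toSubmodule) :
    circ Ψ (W.lMap r t) = circ Ψ (W.rMap r t) := by
  have h1 : Ψ (W.lMap r t) = r • Ψ t := (hΨ r t).1
  have h2 : Ψ (W.rMap r t) = op r • Ψ t := (hΨ r t).2
  rw [circ_apply, circ_apply, h1, h2, sumRU_smul]

theorem eq_sum_circ (hΨ : IsBimoduleMap W Ψ) (t : W.toSubmodule) :
    Ψ t = ∑ a, e a ⊗ₜ circ Ψ (W.lMap (e a) t) := by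
  conv_lhs => rw [← Relations.sum_lMap_e t, map_sum]
  refine Finset.sum_congr rfl fun a _ => ?_
  have h1 : Ψ (W.lMap (e a) t) = e a • Ψ t := (hΨ (e a) t).1
  rw [circ_apply, h1, ← e_smul_eq]

/-- The bimodule map `W → R ⊗ U` that corresponds to a linear map `W → U`. -/
def ofCirc (φ : W.toSubmodule →ₗ[ℂ] U) : W.toSubmodule →ₗ[ℂ] (I → ℂ) ⊗[ℂ] U :=
  ∑ a, TensorProduct.mk ℂ (I → ℂ) U (e a) ∘ₗ φ ∘ₗ W.lMap (e a)

theorem ofCirc_apply (φ : W.toSubmodule →ₗ[ℂ] U) (t : W.toSubmodule) :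
    ofCirc φ t = ∑ a, e a ⊗ₜ φ (W.lMap (e a) t) := by
  rw [ofCirc, LinearMap.sum_apply]
  rfl

theorem circ_ofCirc (φ : W.toSubmodule →ₗ[ℂ] U) : circ (ofCirc φ) = φ := by
  refine LinearMap.ext fun t => ?_
  rw [circ_apply, ofCirc_apply, map_sum]
  conv_rhs => rw [← Relations.sum_lMap_e t, map_sum]
  refine Finset.sum_congr rfl fun a _ => ?_
  rw [sumRU_tmul, Finset.sum_pi_single']
  simp

/-- Left and right actions on `R ⊗ U` coincide, so equality of `φ` on `r w` and `w r` is exactly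
what turns left linearity into right linearity. -/
theorem isBimoduleMap_ofCirc {φ : W.toSubmodule →ₗ[ℂ] U}
    (h : ∀ r t, φ (W.lMap r t) = φ (W.rMap r t)) : IsBimoduleMap W (ofCirc φ) := by
  have key : ∀ r a t, φ (W.lMap (e a) (W.lMap r t)) = r a • φ (W.lMap (e a) t) := by
    intro r a t
    rw [← Relations.lMap_mul, mul_comm, mul_e, Relations.lMap_smul, map_smul]
  intro r t
  constructor
  · change ofCirc φ (W.lMap r t) = _
    rw [ofCirc_apply, ofCirc_apply, Finset.smul_sum]
    refine Finset.sum_congr rfl fun a _ => ?_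
    rw [key, TensorProduct.smul_tmul', smul_eq_mul, mul_e, TensorProduct.smul_tmul]
  · change ofCirc φ (W.rMap r t) = _
    rw [ofCirc_apply, ofCirc_apply, Finset.smul_sum]
    refine Finset.sum_congr rfl fun a _ => ?_
    rw [Relations.lMap_rMap, ← h, ← Relations.lMap_mul, mul_comm, Relations.lMap_mul, key,
      TensorProduct.smul_tmul', op_smul_eq_mul, mul_comm, mul_e,
      TensorProduct.smul_tmul]

theorem eq_ofCirc (hΨ : IsBimoduleMap W Ψ) : Ψ = ofCirc (circ Ψ) :=
  LinearMap.ext fun t => by rw [ofCirc_apply, eq_sum_circ hΨ]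

/-! ### The condition on `Ψ` in terms of the center -/

variable (M U) in
/-- The inclusion `U ⊗ M → S ⊗ T_R(M)`. -/
def inclUM : U ⊗[ℂ] M →ₗ[ℂ] SymmetricAlgebra ℂ U ⊗[ℂ] TensAlg I M :=
  TensorProduct.map (SymmetricAlgebra.ι ℂ U) (TensAlg.ofM I M)

theorem inclUM_tmul (z : U) (m : M) :
    inclUM (I := I) M U (z ⊗ₜ m) =
      SymmetricAlgebra.ι ℂ U z • inc I M U (TensAlg.ofM I M m) := by
  rw [inclUM, TensorProduct.map_tmul, tmul_eq_smul_inc]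

theorem symmι_injective : Function.Injective (SymmetricAlgebra.ι ℂ U) := by
  rw [injective_iff_map_eq_zero]
  intro z hz
  by_contra h
  have h1 := algebraMapInv_eq_zero_of_sum_eq_zero (z := fun _ : Unit => z) (a := fun _ => 1)
    (LinearIndependent.of_subsingleton () h) (by simp [hz]) ()
  rw [map_one] at h1
  exact one_ne_zero h1

theorem inclUM_injective : Function.Injective (inclUM (I := I) M U) := by
  have h : Function.Injective (TensAlg.ofM I M) := by
    -- With no relations the quadratic algebra is already a quotient of `T_R(M)` in which `M`
    -- embeds, so `M` embeds in `T_R(M)`.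
    have h1 := QuadAlg.ofM_injective (I := I) (M := M) ⟨⊥, by simp, by simp⟩
    exact Function.Injective.of_comp (f := QuadAlg.mk _) h1
  exact TensorProduct.map_injective_of_flat_flat _ _ symmι_injective h

/-- The coordinate functionals of a basis of `U` recover the coefficients of `y`. This reduces the
identity in `U ⊗ M` to scalar functionals on `W`. -/
theorem eq_zero_of_forall_lid {N : Type*} [AddCommGroup N] [Module ℂ N] {y : U ⊗[ℂ] N}
    (h : ∀ l : Module.Dual ℂ U, TensorProduct.lid ℂ N (LinearMap.rTensor N l y) = 0) : y = 0 := by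
  let b := Module.Basis.ofVectorSpace ℂ U
  obtain ⟨c, rfl⟩ := TensorProduct.eq_repr_basis_left b y
  have hc : c = 0 := by
    ext i
    have h1 := h (b.coord i)
    rw [Finsupp.sum, map_sum, map_sum, Finset.sum_eq_single i] at h1
    · simpa using h1
    · intro j _ hj
      simp [hj]
    · intro hi
      simp [Finsupp.notMem_support_iff.1 hi]
  rw [hc, Finsupp.sum_zero_index]

/-- The map `w ⊗ m ↦ ∑ φ(w e_d) ⊗ e_d m`. -/
def lTens (φ : W.toSubmodule →ₗ[ℂ] U) : W.toSubmodule ⊗[ℂ] M →ₗ[ℂ] U ⊗[ℂ] M :=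
  ∑ d : I, TensorProduct.map (φ ∘ₗ W.rMap (e d)) (lAct I (e d))

/-- The map `m ⊗ w ↦ ∑ φ(e_c w) ⊗ m e_c`. -/
def rTens (φ : W.toSubmodule →ₗ[ℂ] U) : M ⊗[ℂ] W.toSubmodule →ₗ[ℂ] U ⊗[ℂ] M :=
  (∑ d : I, TensorProduct.map (φ ∘ₗ W.lMap (e d)) (rAct I (e d))) ∘ₗ
    (TensorProduct.comm ℂ M W.toSubmodule).toLinearMap

theorem lid_lTens (φ : W.toSubmodule →ₗ[ℂ] U) (l : Module.Dual ℂ U)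
    (p : W.toSubmodule ⊗[ℂ] M) :
    TensorProduct.lid ℂ M (LinearMap.rTensor M l (lTens φ p)) = lPair (l ∘ₗ φ) p := by
  induction p using TensorProduct.induction_on with
  | zero => simp
  | add p q hp hq => simp only [map_add, hp, hq]
  | tmul t m =>
    rw [lPair_tmul, ← sum_smul_e (fun d => (l ∘ₗ φ) (W.rMap (e d) t)), Finset.sum_smul, lTens,
      LinearMap.sum_apply, map_sum, map_sum]
    refine Finset.sum_congr rfl fun d _ => ?_
    rw [TensorProduct.map_tmul, LinearMap.rTensor_tmul, TensorProduct.lid_tmul, smul_assoc]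
    rfl

theorem lid_rTens (φ : W.toSubmodule →ₗ[ℂ] U) (l : Module.Dual ℂ U)
    (p : M ⊗[ℂ] W.toSubmodule) :
    TensorProduct.lid ℂ M (LinearMap.rTensor M l (rTens φ p)) = rPair (l ∘ₗ φ) p := by
  induction p using TensorProduct.induction_on with
  | zero => simp
  | add p q hp hq => simp only [map_add, hp, hq]
  | tmul m t =>
    rw [rPair_tmul, op_sum_smul_e, rTens, LinearMap.comp_apply, LinearEquiv.coe_coe,
      TensorProduct.comm_tmul, LinearMap.sum_apply, map_sum, map_sum]
    refine Finset.sum_congr rfl fun d _ => ?_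
    rw [TensorProduct.map_tmul, LinearMap.rTensor_tmul, TensorProduct.lid_tmul]
    rfl

theorem psiM_eq (hΨ : IsBimoduleMap W Ψ) (p : W.toSubmodule ⊗[ℂ] M) :
    psiM Ψ p = inclUM M U (lTens (circ Ψ) p) := by
  induction p using TensorProduct.induction_on with
  | zero => simp
  | add p q hp hq => simp only [map_add, hp, hq]
  | tmul t m =>
    rw [psiM_tmul, psiHat, LinearMap.comp_apply, eq_sum_circ hΨ, map_sum, Finset.sum_mul, lTens,
      LinearMap.sum_apply, map_sum]
    refine Finset.sum_congr rfl fun d _ => ?_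
    rw [TensorProduct.map_tmul, inclUM_tmul, ofRU_tmul, smul_mul_assoc, ← map_mul,
      ← TensAlg.ofM_left, circ_lMap hΨ]
    rfl

theorem mPsi_eq (hΨ : IsBimoduleMap W Ψ) (p : M ⊗[ℂ] W.toSubmodule) :
    mPsi Ψ p = inclUM M U (rTens (circ Ψ) p) := by
  induction p using TensorProduct.induction_on with
  | zero => simp
  | add p q hp hq => simp only [map_add, hp, hq]
  | tmul m t =>
    rw [mPsi_tmul, psiHat, LinearMap.comp_apply, eq_sum_circ hΨ, map_sum, Finset.mul_sum, rTens,
      LinearMap.comp_apply, LinearEquiv.coe_coe, TensorProduct.comm_tmul, LinearMap.sum_apply,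
      map_sum]
    refine Finset.sum_congr rfl fun d _ => ?_
    rw [TensorProduct.map_tmul, inclUM_tmul, ofRU_tmul, mul_smul_comm, ← map_mul,
      ← TensAlg.ofM_right]
    rfl

/-- Both reductions take values in `U ⊗ M`, which embeds in `S ⊗ T_R(M)`, so they can be compared
after applying each functional `l` on `U`. Commutation with `R` is automatic for a bimodule map. -/
theorem isPBW_iff_isCentralFunctional (hΨ : IsBimoduleMap W Ψ) :
    IsPBW Ψ ↔ ∀ l : Module.Dual ℂ U, IsCentralFunctional (l ∘ₗ circ Ψ) := by
  constructor
  · intro h l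
    refine ⟨fun r t => congrArg l (circ_lMap hΨ r t), fun p q hpq => ?_⟩
    have h1 := h p q hpq
    rw [psiM_eq hΨ, mPsi_eq hΨ] at h1
    rw [← lid_lTens, ← lid_rTens, inclUM_injective h1]
  · intro h p q hpq
    rw [psiM_eq hΨ, mPsi_eq hΨ]
    congr 1
    rw [← sub_eq_zero]
    refine eq_zero_of_forall_lid fun l => ?_
    rw [map_sub, map_sub, lid_lTens, lid_rTens, (h l).lPair_eq p q hpq, sub_self]

/-- If every `l ∘ Ψ°` is evaluation of `q` at some central `z`, then `Ψ°` is constant on fibres of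
`q` and descends along any linear section. Conversely, by reflexivity, `l ∘ ψ` is evaluation at an
element of `Z(A^!)_2`. -/
theorem isPBW_iff (hΨ : IsBimoduleMap W Ψ) :
    IsPBW Ψ ↔ ∃ ψ : Module.Dual ℂ (centerTwo W) →ₗ[ℂ] U, circ Ψ = ψ ∘ₗ toCenterDual W := by
  rw [isPBW_iff_isCentralFunctional hΨ]
  constructor
  · intro h
    obtain ⟨s, hs⟩ := LinearMap.exists_rightInverse_of_surjective (toCenterDual W)
      (LinearMap.range_eq_top.2 toCenterDual_surjective)
    refine ⟨circ Ψ ∘ₗ s, LinearMap.ext fun t => ?_⟩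
    rw [← sub_eq_zero, ← Module.forall_dual_apply_eq_zero_iff ℂ]
    intro l
    obtain ⟨z, hz⟩ := isCentralFunctional_iff.1 (h l)
    have h1 : ∀ t, l (circ Ψ t) = toCenterDual W t z := fun t => (LinearMap.congr_fun hz t).symm
    have h2 : toCenterDual W (s (toCenterDual W t)) = toCenterDual W t :=
      LinearMap.congr_fun hs (toCenterDual W t)
    rw [map_sub, LinearMap.comp_apply, LinearMap.comp_apply, h1, h1, h2, sub_self]
  · rintro ⟨ψ, hψ⟩ l
    obtain ⟨z, hz⟩ := (Module.bijective_dual_eval ℂ (centerTwo W)).2 (l ∘ₗ ψ)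
    refine isCentralFunctional_iff.2 ⟨z, LinearMap.ext fun t => ?_⟩
    rw [hψ]
    exact LinearMap.congr_fun hz (toCenterDual W t)

theorem toCenterDual_lMap (r : I → ℂ) (t : W.toSubmodule) :
    toCenterDual W (W.lMap r t) = toCenterDual W (W.rMap r t) :=
  LinearMap.ext fun z => (isCentralFunctional_iff.2 ⟨z, rfl⟩).lMap_eq r t

/-- The criterion for flatness. -/
theorem flat_iff (hA : IsKoszul W) (hΨ : IsBimoduleMap W Ψ) :
    Module.Flat (SymmetricAlgebra ℂ U) (Deform Ψ) ↔
      ∃ ψ : Module.Dual ℂ (centerTwo W) →ₗ[ℂ] U, circ Ψ = ψ ∘ₗ toCenterDual W := by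
  rw [← isPBW_iff hΨ]
  exact ⟨fun _ => isPBW_of_flat Ψ, Deform.flat_of_isPBW hA hΨ⟩

end Center

end QuadKoszul

end

noncomputable section

namespace QuadKoszul

universe u v w x

/-! ### Base change -/

section BaseChange

variable {I : Type u} [Fintype I] [DecidableEq I]
variable {M : Type v} [AddCommGroup M] [Module ℂ M] [Module (I → ℂ) M] [Module (I → ℂ)ᵐᵒᵖ M]
  [SMulCommClass (I → ℂ) (I → ℂ)ᵐᵒᵖ M] [IsScalarTower ℂ (I → ℂ) M]
  [IsScalarTower ℂ (I → ℂ)ᵐᵒᵖ M] [FiniteDimensional ℂ M]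
variable {W : Relations I M}
variable {U : Type*} [AddCommGroup U] [Module ℂ U]

/-! ### The universal property of `Ã_Ψ` over `Sym U` -/

section Lift

variable {B : Type*} [Ring B] [Algebra ℂ B] [Algebra (SymmetricAlgebra ℂ U) B]
  [IsScalarTower ℂ (SymmetricAlgebra ℂ U) B]

variable (U) in
/-- The map `R ⊗ U → B` for an algebra `B` over `Sym U` with a map from `R`. -/
def mapRU (ρ : (I → ℂ) →ₐ[ℂ] B) : (I → ℂ) ⊗[ℂ] U →ₗ[ℂ] B :=
  TensorProduct.lift (LinearMap.mk₂ ℂ (fun r z => SymmetricAlgebra.ι ℂ U z • ρ r)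
    (fun r r' z => by rw [map_add, smul_add])
    (fun c r z => by rw [map_smul, smul_comm])
    (fun r z z' => by rw [map_add, add_smul])
    (fun c r z => by rw [map_smul, smul_assoc]))

theorem mapRU_tmul (ρ : (I → ℂ) →ₐ[ℂ] B) (r : I → ℂ) (z : U) :
    mapRU U ρ (r ⊗ₜ z) = SymmetricAlgebra.ι ℂ U z • ρ r := rfl

theorem mapRU_left (ρ : (I → ℂ) →ₐ[ℂ] B) (r : I → ℂ) (p : (I → ℂ) ⊗[ℂ] U) :
    mapRU U ρ (r • p) = ρ r * mapRU U ρ p := by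
  induction p using TensorProduct.induction_on with
  | zero => simp
  | add p q hp hq => simp only [smul_add, map_add, mul_add, hp, hq]
  | tmul s z =>
    rw [TensorProduct.smul_tmul', mapRU_tmul, mapRU_tmul, smul_eq_mul, map_mul, mul_smul_comm]

theorem mapRU_right (ρ : (I → ℂ) →ₐ[ℂ] B) (r : I → ℂ) (p : (I → ℂ) ⊗[ℂ] U) :
    mapRU U ρ (op r • p) = mapRU U ρ p * ρ r := by
  induction p using TensorProduct.induction_on with
  | zero => simp
  | add p q hp hq => simp only [smul_add, map_add, add_mul, hp, hq]
  | tmul s z =>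
    rw [TensorProduct.smul_tmul', mapRU_tmul, mapRU_tmul, op_smul_eq_mul, map_mul, smul_mul_assoc]

variable {Ψ : W.toSubmodule →ₗ[ℂ] (I → ℂ) ⊗[ℂ] U}

variable (Ψ) in
theorem Deform.mk_ofRU (p : (I → ℂ) ⊗[ℂ] U) :
    Deform.mk Ψ (ofRU I M U p) = mapRU U (Deform.ofR Ψ) p := by
  induction p using TensorProduct.induction_on with
  | zero => simp
  | add p q hp hq => simp only [map_add, hp, hq]
  | tmul r z => rw [Deform.mk_ofRU_tmul, mapRU_tmul, Deform.ofU_eq, Algebra.smul_def]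

/-- Universal property of `Ã_Ψ` as an algebra over `Sym U`. -/
def Deform.liftSym (F : TensAlg I M →ₐ[ℂ] B) (h : ∀ t : W.toSubmodule,
    F (TensAlg.ofTens I M t) = mapRU U (F.comp (TensAlg.ofR I M)) (Ψ t)) :
    Deform Ψ →ₐ[SymmetricAlgebra ℂ U] B :=
  let hc : ∀ s t, Commute (IsScalarTower.toAlgHom ℂ (SymmetricAlgebra ℂ U) B s) (F t) :=
    fun s t => Algebra.commute_algebraMap_left s (F t)
  let f : Deform Ψ →ₐ[ℂ] B := Deform.lift (IsScalarTower.toAlgHom ℂ (SymmetricAlgebra ℂ U) B) F hc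
    (by
      intro t
      rw [h]
      induction Ψ t using TensorProduct.induction_on with
      | zero => simp
      | add p q hp hq => simp only [map_add, hp, hq]
      | tmul r z =>
        rw [mapRU_tmul, ofRU_tmul, ← tmul_eq_smul_inc, Algebra.TensorProduct.lift_tmul,
          Algebra.smul_def]
        rfl)
  { f with
    commutes' := fun s => by
      change f (algebraMap _ _ s) = _
      rw [← Deform.mk_tmul_one]
      exact (Deform.lift_mk _ _ _ _ _ _).trans (by rw [map_one, mul_one]; rfl) }

theorem Deform.liftSym_mk_inc (F : TensAlg I M →ₐ[ℂ] B) (h : ∀ t : W.toSubmodule,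
    F (TensAlg.ofTens I M t) = mapRU U (F.comp (TensAlg.ofR I M)) (Ψ t)) (t : TensAlg I M) :
    Deform.liftSym F h (Deform.mk Ψ (inc I M U t)) = F t :=
  (Deform.lift_mk _ _ _ _ _ _).trans (by rw [map_one, one_mul])

theorem Deform.symHom_ext {f g : Deform Ψ →ₐ[SymmetricAlgebra ℂ U] B}
    (h : ∀ t, f (Deform.mk Ψ (inc I M U t)) = g (Deform.mk Ψ (inc I M U t))) : f = g := by
  refine AlgHom.ext fun b => ?_
  refine AlgHom.congr_fun (φ₁ := f.restrictScalars ℂ) (φ₂ := g.restrictScalars ℂ)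
    (Deform.hom_ext (fun z => ?_) (fun r => h _) (fun m => h _)) b
  rw [Deform.ofU_eq]
  exact (f.commutes _).trans (g.commutes _).symm

end Lift

variable {V : Type*} [AddCommGroup V] [Module ℂ V]
variable (Ω : W.toSubmodule →ₗ[ℂ] (I → ℂ) ⊗[ℂ] V) (ψ : V →ₗ[ℂ] U)

/-- The composition of `Ω : W → R ⊗ V` with a linear map `V → U`. -/
def pushRU : W.toSubmodule →ₗ[ℂ] (I → ℂ) ⊗[ℂ] U := LinearMap.lTensor (I → ℂ) ψ ∘ₗ Ω

variable {Ω} in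
theorem isBimoduleMap_pushRU (hΩ : IsBimoduleMap W Ω) : IsBimoduleMap W (pushRU Ω ψ) := by
  have hl : ∀ (r : I → ℂ) (p : (I → ℂ) ⊗[ℂ] V),
      LinearMap.lTensor (I → ℂ) ψ (r • p) = r • LinearMap.lTensor (I → ℂ) ψ p := by
    intro r p
    induction p using TensorProduct.induction_on with
    | zero => simp
    | add p q hp hq => simp only [smul_add, map_add, hp, hq]
    | tmul s z => rfl
  have hr : ∀ (r : I → ℂ) (p : (I → ℂ) ⊗[ℂ] V),
      LinearMap.lTensor (I → ℂ) ψ (op r • p) = op r • LinearMap.lTensor (I → ℂ) ψ p := by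
    intro r p
    induction p using TensorProduct.induction_on with
    | zero => simp
    | add p q hp hq => simp only [smul_add, map_add, hp, hq]
    | tmul s z => rfl
  intro r t
  rw [pushRU, LinearMap.comp_apply, LinearMap.comp_apply, LinearMap.comp_apply, (hΩ r t).1,
    (hΩ r t).2, hl, hr]
  exact ⟨rfl, rfl⟩

theorem circ_pushRU : circ (pushRU Ω ψ) = ψ ∘ₗ circ Ω := by
  refine LinearMap.ext fun t => ?_
  rw [LinearMap.comp_apply, circ_apply, circ_apply, pushRU, LinearMap.comp_apply]
  induction Ω t using TensorProduct.induction_on with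
  | zero => simp
  | add p q hp hq => simp only [map_add, hp, hq]
  | tmul r z => rw [LinearMap.lTensor_tmul, sumRU_tmul, sumRU_tmul, map_smul]

theorem symMap_ι (z : V) :
    symMap ψ (SymmetricAlgebra.ι ℂ V z) = SymmetricAlgebra.ι ℂ U (ψ z) := by
  rw [symMap, SymmetricAlgebra.lift_ι_apply, LinearMap.comp_apply]

/-! ### Base change of `Ã_Ω` along a linear map -/

section Equiv

variable {ψ} [Algebra (SymmetricAlgebra ℂ V) (SymmetricAlgebra ℂ U)]
  [IsScalarTower ℂ (SymmetricAlgebra ℂ V) (SymmetricAlgebra ℂ U)]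

theorem ι_smul_eq (hψ : ∀ s, algebraMap (SymmetricAlgebra ℂ V) (SymmetricAlgebra ℂ U) s =
    symMap ψ s) {B : Type*} [AddCommGroup B] [Module (SymmetricAlgebra ℂ U) B]
    [Module (SymmetricAlgebra ℂ V) B]
    [IsScalarTower (SymmetricAlgebra ℂ V) (SymmetricAlgebra ℂ U) B] (z : V) (b : B) :
    SymmetricAlgebra.ι ℂ V z • b = SymmetricAlgebra.ι ℂ U (ψ z) • b := by
  rw [← symMap_ι, ← hψ, algebraMap_smul]

theorem mapRU_lTensor (hψ : ∀ s, algebraMap (SymmetricAlgebra ℂ V) (SymmetricAlgebra ℂ U) s =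
    symMap ψ s) {B : Type*} [Ring B] [Algebra ℂ B] [Algebra (SymmetricAlgebra ℂ U) B]
    [IsScalarTower ℂ (SymmetricAlgebra ℂ U) B] [Algebra (SymmetricAlgebra ℂ V) B]
    [IsScalarTower ℂ (SymmetricAlgebra ℂ V) B]
    [IsScalarTower (SymmetricAlgebra ℂ V) (SymmetricAlgebra ℂ U) B] (ρ : (I → ℂ) →ₐ[ℂ] B)
    (p : (I → ℂ) ⊗[ℂ] V) : mapRU U ρ (LinearMap.lTensor (I → ℂ) ψ p) = mapRU V ρ p := by
  induction p using TensorProduct.induction_on with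
  | zero => simp
  | add p q hp hq => simp only [map_add, hp, hq]
  | tmul r z => rw [LinearMap.lTensor_tmul, mapRU_tmul, mapRU_tmul, ι_smul_eq hψ]

/-- Both algebras are generated by `T_R(M)` over `Sym U`, subject to `w = ψ(Ω(w))`. The universal
properties give homomorphisms in both directions, and they are inverse because they fix `T_R(M)`. -/
theorem exists_baseChange_equiv (hψ : ∀ s, algebraMap (SymmetricAlgebra ℂ V)
    (SymmetricAlgebra ℂ U) s = symMap ψ s) :
    ∃ θ : (SymmetricAlgebra ℂ U ⊗[SymmetricAlgebra ℂ V] Deform Ω) ≃ₐ[SymmetricAlgebra ℂ U]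
      Deform (pushRU Ω ψ), ∀ t, θ (1 ⊗ₜ Deform.mk Ω (inc I M V t)) =
        Deform.mk (pushRU Ω ψ) (inc I M U t) := by
  let _ : Algebra (SymmetricAlgebra ℂ V) (Deform (pushRU Ω ψ)) :=
    Algebra.compHom _ (algebraMap (SymmetricAlgebra ℂ V) (SymmetricAlgebra ℂ U))
  have : IsScalarTower (SymmetricAlgebra ℂ V) (SymmetricAlgebra ℂ U) (Deform (pushRU Ω ψ)) :=
    IsScalarTower.of_algebraMap_eq fun _ => rfl
  have : IsScalarTower ℂ (SymmetricAlgebra ℂ V) (Deform (pushRU Ω ψ)) :=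
    IsScalarTower.of_algebraMap_eq fun c => by
      rw [IsScalarTower.algebraMap_apply (SymmetricAlgebra ℂ V) (SymmetricAlgebra ℂ U),
        ← IsScalarTower.algebraMap_apply ℂ (SymmetricAlgebra ℂ V) (SymmetricAlgebra ℂ U),
        ← IsScalarTower.algebraMap_apply]
  let g : Deform Ω →ₐ[SymmetricAlgebra ℂ V] Deform (pushRU Ω ψ) :=
    Deform.liftSym ((Deform.mk (pushRU Ω ψ)).comp (inc I M U)) (by
      intro t
      rw [AlgHom.comp_apply, Deform.mk_ofTens, Deform.mk_ofRU, ← mapRU_lTensor hψ]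
      rfl)
  let θ₁ : (SymmetricAlgebra ℂ U ⊗[SymmetricAlgebra ℂ V] Deform Ω) →ₐ[SymmetricAlgebra ℂ U]
      Deform (pushRU Ω ψ) :=
    Algebra.TensorProduct.lift (Algebra.ofId _ _) g fun s b =>
      Algebra.commute_algebraMap_left s (g b)
  let F : TensAlg I M →ₐ[ℂ] (SymmetricAlgebra ℂ U ⊗[SymmetricAlgebra ℂ V] Deform Ω) :=
    ((Algebra.TensorProduct.includeRight (R := SymmetricAlgebra ℂ V)
      (A := SymmetricAlgebra ℂ U) (B := Deform Ω)).restrictScalars ℂ).comp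
      ((Deform.mk Ω).comp (inc I M V))
  have hF : ∀ t, F t = 1 ⊗ₜ Deform.mk Ω (inc I M V t) := fun _ => rfl
  let θ₂ : Deform (pushRU Ω ψ) →ₐ[SymmetricAlgebra ℂ U]
      (SymmetricAlgebra ℂ U ⊗[SymmetricAlgebra ℂ V] Deform Ω) :=
    Deform.liftSym F (by
      intro t
      rw [hF, Deform.mk_ofTens, pushRU, LinearMap.comp_apply]
      induction Ω t using TensorProduct.induction_on with
      | zero => simp
      | add p q hp hq => simp only [map_add, TensorProduct.tmul_add, hp, hq]
      | tmul r z =>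
        rw [LinearMap.lTensor_tmul, mapRU_tmul, AlgHom.comp_apply, hF, Deform.mk_ofRU, mapRU_tmul,
          ← TensorProduct.smul_tmul, ι_smul_eq hψ, TensorProduct.smul_tmul']
        rfl)
  have h1 : ∀ t, θ₁ (1 ⊗ₜ Deform.mk Ω (inc I M V t)) = Deform.mk (pushRU Ω ψ) (inc I M U t) := by
    intro t
    refine (Algebra.TensorProduct.lift_tmul _ _ _ _ _).trans ?_
    rw [map_one, one_mul]
    exact Deform.liftSym_mk_inc _ _ t
  have h2 : ∀ t, θ₂ (Deform.mk (pushRU Ω ψ) (inc I M U t)) = 1 ⊗ₜ Deform.mk Ω (inc I M V t) :=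
    fun t => Deform.liftSym_mk_inc _ _ t
  refine ⟨AlgEquiv.ofAlgHom θ₁ θ₂ ?_ ?_, h1⟩
  · refine Deform.symHom_ext fun t => ?_
    rw [AlgHom.comp_apply, h2, h1]
    rfl
  · refine Algebra.TensorProduct.ext (Subsingleton.elim _ _) (Deform.symHom_ext fun t => ?_)
    exact (congrArg θ₂ (h1 t)).trans (h2 t)

end Equiv

end BaseChange

end QuadKoszul

end

noncomputable section

namespace QuadKoszul

universe u v w x

/-! ### Flat graded deformations -/

section FlatDeformation

variable {I : Type u} [Fintype I] [DecidableEq I]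
variable {M : Type v} [AddCommGroup M] [Module ℂ M] [Module (I → ℂ) M] [Module (I → ℂ)ᵐᵒᵖ M]
  [SMulCommClass (I → ℂ) (I → ℂ)ᵐᵒᵖ M] [IsScalarTower ℂ (I → ℂ) M]
  [IsScalarTower ℂ (I → ℂ)ᵐᵒᵖ M] [FiniteDimensional ℂ M]
variable {W : Relations I M}
variable {U : Type*} [AddCommGroup U] [Module ℂ U]
variable {B : Type*} [Ring B] [Algebra ℂ B] [Algebra (SymmetricAlgebra ℂ U) B]
  [IsScalarTower ℂ (SymmetricAlgebra ℂ U) B]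

theorem exists_gradedProj {gr : ℕ → Submodule ℂ B} (h : DirectSum.IsInternal gr) :
    ∃ p : ℕ → B →ₗ[ℂ] B, (∀ n, ∀ b ∈ gr n, p n b = b) ∧
      ∀ m n, m ≠ n → ∀ b ∈ gr m, p n b = 0 := by
  let _ := h.chooseDecomposition
  exact ⟨fun n => (gr n).subtype ∘ₗ DirectSum.component ℂ ℕ (fun i => gr i) n ∘ₗ
    (DirectSum.decomposeLinearEquiv gr).toLinearMap,
    fun n b hb => DirectSum.decompose_of_mem_same gr hb,
    fun m n hmn b hb => DirectSum.decompose_of_mem_ne gr hb hmn⟩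

variable (U B) in
/-- The multiplication `U ⊗ B → B` of an algebra `B` over `Sym U`. -/
def smulU : U ⊗[ℂ] B →ₗ[ℂ] B :=
  TensorProduct.lift (LinearMap.mk₂ ℂ (fun z b => SymmetricAlgebra.ι ℂ U z • b)
    (fun z z' b => by rw [map_add, add_smul])
    (fun c z b => by rw [map_smul, smul_assoc])
    (fun z b b' => smul_add _ _ _)
    (fun c z b => smul_comm _ _ _))

theorem smulU_tmul (z : U) (b : B) :
    smulU U B (z ⊗ₜ b) = SymmetricAlgebra.ι ℂ U z • b := rfl

theorem mul_smulU (a : B) (y : U ⊗[ℂ] B) :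
    a * smulU U B y = smulU U B (LinearMap.lTensor U (LinearMap.mulLeft ℂ a) y) := by
  induction y using TensorProduct.induction_on with
  | zero => simp
  | add x y hx hy => simp only [map_add, mul_add, hx, hy]
  | tmul z b => exact mul_smul_comm _ _ _

theorem smulU_mul (a : B) (y : U ⊗[ℂ] B) :
    smulU U B y * a = smulU U B (LinearMap.lTensor U (LinearMap.mulRight ℂ a) y) := by
  induction y using TensorProduct.induction_on with
  | zero => simp
  | add x y hx hy => simp only [map_add, add_mul, hx, hy]
  | tmul z b => exact smul_mul_assoc _ _ _

/-! ### The structure of a graded deformation -/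

namespace IsGradedDeformation

variable {gr : ℕ → Submodule ℂ B} {ρ : (I → ℂ) →ₐ[ℂ] B} {π : B →ₐ[ℂ] QuadAlg W}

section

variable (hB : IsGradedDeformation W U B gr ρ π)

include hB

theorem iSup_eq_top : ⨆ n, gr n = ⊤ := hB.isInternal.submodule_iSup_eq_top

theorem π_ι (z : U) : π (algebraMap (SymmetricAlgebra ℂ U) B (SymmetricAlgebra.ι ℂ U z)) = 0 := by
  rw [← TwoSidedIdeal.mem_ker, hB.ker_π]
  exact TwoSidedIdeal.subset_span ⟨z, rfl⟩

/-- Since `U` is central, the subspace `U B` is already a two-sided ideal, so it contains the ideal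
generated by `U`. -/
theorem mem_range_smulU {b : B} (hb : π b = 0) : b ∈ LinearMap.range (smulU U B) := by
  let J : TwoSidedIdeal B := TwoSidedIdeal.mk' (LinearMap.range (smulU U B))
    (zero_mem _) (fun ha hb => add_mem ha hb) (fun ha => neg_mem ha)
    (fun {a _} => by rintro ⟨y, rfl⟩; exact ⟨_, (mul_smulU a y).symm⟩)
    (fun {_ a} => by rintro ⟨y, rfl⟩; exact ⟨_, (smulU_mul a y).symm⟩)
  have hJ : ∀ b, b ∈ J ↔ b ∈ LinearMap.range (smulU U B) := fun b => TwoSidedIdeal.mem_mk' ..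
  rw [← hJ]
  rw [← TwoSidedIdeal.mem_ker, hB.ker_π] at hb
  refine (TwoSidedIdeal.span_le.2 ?_) hb
  rintro _ ⟨z, rfl⟩
  exact (hJ _).2 ⟨z ⊗ₜ 1, by rw [smulU_tmul, Algebra.smul_def, mul_one]⟩

theorem ι_smul_mem (z : U) {n : ℕ} {b : B} (hb : b ∈ gr n) :
    SymmetricAlgebra.ι ℂ U z • b ∈ gr (n + 2) := by
  rw [Algebra.smul_def, add_comm]
  exact hB.mul_mem _ _ _ (hB.j_mem z) _ hb

theorem mem_span_of_π_eq_zero {n : ℕ} {b : B} (hn : b ∈ gr n) (hb : π b = 0) :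
    b ∈ Submodule.span ℂ {c | ∃ (z : U) (k : ℕ) (b' : B), k + 2 = n ∧ b' ∈ gr k ∧
      c = SymmetricAlgebra.ι ℂ U z • b'} := by
  obtain ⟨p, hp, hp'⟩ := exists_gradedProj hB.isInternal
  rw [← hp n b hn]
  obtain ⟨y, rfl⟩ := hB.mem_range_smulU hb
  clear hn hb
  induction y using TensorProduct.induction_on with
  | zero => simp
  | add x y hx hy => simp only [map_add]; exact add_mem hx hy
  | tmul z b =>
    have h : b ∈ ⨆ n, gr n := hB.iSup_eq_top ▸ Submodule.mem_top
    induction h using Submodule.iSup_induction' with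
    | mem k b hb =>
      rw [smulU_tmul]
      by_cases h : k + 2 = n
      · rw [← h, hp _ _ (hB.ι_smul_mem z hb)]
        exact Submodule.subset_span ⟨z, k, b, rfl, hb, rfl⟩
      · rw [hp' _ _ h _ (hB.ι_smul_mem z hb)]
        exact zero_mem _
    | zero => simp
    | add x y _ _ hx hy => rw [TensorProduct.tmul_add]; simp only [map_add]; exact add_mem hx hy

/-- The kernel `U B` starts in degree two because `U` has degree two and the grading is by `ℕ`. So
`R` and `M` lift canonically to any graded deformation. -/
theorem eq_of_π_eq {n : ℕ} (hn : n < 2) {b b' : B} (hb : b ∈ gr n) (hb' : b' ∈ gr n)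
    (h : π b = π b') : b = b' := by
  rw [← sub_eq_zero]
  have h1 := hB.mem_span_of_π_eq_zero (sub_mem hb hb') (by rw [map_sub, h, sub_self])
  rw [show {c | ∃ (z : U) (k : ℕ) (b' : B), k + 2 = n ∧ b' ∈ gr k ∧
    c = SymmetricAlgebra.ι ℂ U z • b'} = ∅ from Set.eq_empty_of_forall_notMem (by
      rintro _ ⟨z, k, b', hk, -⟩; omega), Submodule.span_empty] at h1
  exact (Submodule.mem_bot ℂ).1 h1

theorem exists_of_mem_gr {n : ℕ} {a : QuadAlg W} (ha : a ∈ QuadAlg.gr W n) :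
    ∃ b ∈ gr n, π b = a := by
  obtain ⟨p, hp, hp'⟩ := exists_gradedProj hB.isInternal
  have h : ∀ b, p n b ∈ gr n ∧ π (p n b) = comp (QuadAlg.deg W) n (π b) := by
    intro b
    have hb : b ∈ ⨆ n, gr n := hB.iSup_eq_top ▸ Submodule.mem_top
    induction hb using Submodule.iSup_induction' with
    | mem k b hb =>
      have h1 := hB.π_mem _ _ hb
      rw [QuadAlg.gr_eq] at h1
      rw [comp_of_mem h1]
      by_cases h : k = n
      · subst h
        rw [hp _ _ hb, if_pos rfl]
        exact ⟨hb, rfl⟩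
      · rw [hp' _ _ h _ hb, map_zero]
        exact ⟨zero_mem _, by simp [h]⟩
    | zero => simp
    | add x y _ _ hx hy =>
      simp only [map_add]
      exact ⟨add_mem hx.1 hy.1, by rw [hx.2, hy.2]⟩
  obtain ⟨b, rfl⟩ := hB.π_surjective a
  rw [QuadAlg.gr_eq] at ha
  exact ⟨_, (h b).1, by rw [(h b).2, comp_same ha]⟩

theorem exists_ρ_eq {b : B} (hb : b ∈ gr 0) : ∃ r, ρ r = b := by
  obtain ⟨X⟩ := exists_arrowBasis I M
  have h := hB.π_mem _ _ hb
  rw [QuadAlg.gr_eq] at h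
  exact ⟨_, hB.eq_of_π_eq two_pos (hB.ρ_mem _) hb
    ((hB.π_ρ _).trans (QuadAlg.eq_ofR_of_mem_zero W X h).symm)⟩

/-- The algebra `T_R(M)` maps to every graded deformation. -/
theorem exists_tensAlg_hom : ∃ F : TensAlg I M →ₐ[ℂ] B, F.comp (TensAlg.ofR I M) = ρ ∧
    (∀ m, F (TensAlg.ofM I M m) ∈ gr 1) ∧ π.comp F = QuadAlg.mk W := by
  -- In degree one `π` is injective, and its image contains `M`, so `l` lifts `M` into `gr 1`. The
  -- bimodule identities may then be checked after applying `π`.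
  obtain ⟨l, hl⟩ := (π.toLinearMap ∘ₗ (gr 1).subtype).exists_leftInverse_of_injective
    (LinearMap.ker_eq_bot.2 fun b b' h =>
      Subtype.ext (hB.eq_of_π_eq one_lt_two b.2 b'.2 h))
  have hμ : ∀ m, π (l (QuadAlg.ofM W m)) = QuadAlg.ofM W m := by
    intro m
    obtain ⟨b, hb, h⟩ := hB.exists_of_mem_gr (n := 1) (a := QuadAlg.ofM W m) (by
      rw [QuadAlg.gr_eq]; exact QuadAlg.ofM_mem W m)
    have h1 : l (π b) = ⟨b, hb⟩ := LinearMap.congr_fun hl ⟨b, hb⟩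
    rw [← h, h1]
  refine ⟨TensAlg.lift ρ ((gr 1).subtype ∘ₗ l ∘ₗ QuadAlg.ofM W) ?_ ?_, ?_, ?_, ?_⟩
  · intro r m
    refine hB.eq_of_π_eq one_lt_two (Subtype.mem _)
      (hB.mul_mem 0 1 _ (hB.ρ_mem r) _ (Subtype.mem _)) ?_
    rw [map_mul, hB.π_ρ]
    exact (hμ _).trans ((QuadAlg.ofM_left ..).trans (congrArg _ (hμ m).symm))
  · intro r m
    refine hB.eq_of_π_eq one_lt_two (Subtype.mem _)
      (hB.mul_mem 1 0 _ (Subtype.mem _) _ (hB.ρ_mem r)) ?_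
    rw [map_mul, hB.π_ρ]
    exact (hμ _).trans ((QuadAlg.ofM_right ..).trans (congrArg (· * _) (hμ m).symm))
  · exact AlgHom.ext fun r => TensAlg.lift_ofR _ _ _ _ r
  · intro m
    rw [TensAlg.lift_ofM]
    exact Subtype.mem _
  · refine TensAlg.hom_ext (fun r => ?_) (fun m => ?_)
    · rw [AlgHom.comp_apply, TensAlg.lift_ofR, hB.π_ρ, QuadAlg.mk_ofR]
    · rw [AlgHom.comp_apply, TensAlg.lift_ofM]
      exact hμ m

theorem tensAlg_hom_unique {F F' : TensAlg I M →ₐ[ℂ] B}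
    (hR : F.comp (TensAlg.ofR I M) = F'.comp (TensAlg.ofR I M))
    (hM : ∀ m, F (TensAlg.ofM I M m) ∈ gr 1) (hM' : ∀ m, F' (TensAlg.ofM I M m) ∈ gr 1)
    (hπ : π.comp F = π.comp F') : F = F' :=
  TensAlg.hom_ext (fun r => AlgHom.congr_fun hR r) fun m =>
    hB.eq_of_π_eq one_lt_two (hM m) (hM' m) (AlgHom.congr_fun hπ _)

theorem tensAlg_hom_mem {F : TensAlg I M →ₐ[ℂ] B} (hR : F.comp (TensAlg.ofR I M) = ρ)
    (hM : ∀ m, F (TensAlg.ofM I M m) ∈ gr 1) {n : ℕ} {t : TensAlg I M}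
    (ht : t ∈ homog (TensAlg.deg I M) n) : F t ∈ gr n := by
  obtain ⟨X⟩ := exists_arrowBasis I M
  induction n generalizing t with
  | zero =>
    rw [TensAlg.eq_ofR_of_mem_zero X ht]
    exact (AlgHom.congr_fun hR _) ▸ hB.ρ_mem _
  | succ n ih =>
    rw [ArrowBasis.eq_sum_of_mem_succ X ht, map_sum]
    refine sum_mem fun k _ => ?_
    rw [map_mul, add_comm]
    exact hB.mul_mem _ _ _ (hM _) _ (ih (ArrowBasis.deriv_mem X ht k))

variable [Module.Flat (SymmetricAlgebra ℂ U) B]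

/-- By flatness a relation `∑ z_i ρ(r_i) = 0` with independent `z_i` forces each `r_i` to vanish in
`A`, and `R` embeds in `A`. -/
theorem mapRU_injective : Function.Injective (mapRU U ρ) := by
  rw [injective_iff_map_eq_zero]
  intro y hy
  let bs := Module.Basis.ofVectorSpace ℂ U
  obtain ⟨c, rfl⟩ := TensorProduct.eq_repr_basis_right bs y
  have h1 : ∑ i : c.support, SymmetricAlgebra.ι ℂ U (bs i) • ρ (c i) = 0 := by
    refine Eq.trans ?_ hy
    rw [Finsupp.sum, map_sum]
    exact Finset.sum_coe_sort c.support fun i => SymmetricAlgebra.ι ℂ U (bs i) • ρ (c i)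
  refine Finset.sum_eq_zero fun i hi => ?_
  have h2 := eq_zero_of_sum_smul_eq_zero (U := U) hB.π_ι
    (bs.linearIndependent.comp _ Subtype.val_injective) h1 ⟨i, hi⟩
  rw [hB.π_ρ, map_eq_zero_iff _ (QuadAlg.ofR_injective W)] at h2
  exact (congrArg (· ⊗ₜ bs i) h2).trans (TensorProduct.zero_tmul _ _)

/-- A relation is sent to degree two of `ker π = U B`, which is `U` times degree zero, that is, `U
ρ(R)`. Injectivity of `R ⊗ U → B` makes the resulting element of `R ⊗ U` unique, and uniqueness
yields the bimodule property. -/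
theorem exists_bimoduleMap {F : TensAlg I M →ₐ[ℂ] B} (hR : F.comp (TensAlg.ofR I M) = ρ)
    (hM : ∀ m, F (TensAlg.ofM I M m) ∈ gr 1) (hπ : π.comp F = QuadAlg.mk W) :
    ∃ Ψ : W.toSubmodule →ₗ[ℂ] (I → ℂ) ⊗[ℂ] U, IsBimoduleMap W Ψ ∧
      ∀ t : W.toSubmodule, F (TensAlg.ofTens I M t) = mapRU U ρ (Ψ t) := by
  have hinj := hB.mapRU_injective
  obtain ⟨l, hl⟩ := (mapRU U ρ).exists_leftInverse_of_injective (LinearMap.ker_eq_bot.2 hinj)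
  have hF : ∀ t : W.toSubmodule, F (TensAlg.ofTens I M t) ∈ LinearMap.range (mapRU U ρ) := by
    intro t
    have h1 := hB.mem_span_of_π_eq_zero (hB.tensAlg_hom_mem hR hM (TensAlg.ofTens_mem t.1))
      ((AlgHom.congr_fun hπ _).trans (QuadAlg.mk_ofTens W t.2))
    refine (Submodule.span_le.2 ?_) h1
    rintro _ ⟨z, k, b, hk, hb, rfl⟩
    obtain rfl : k = 0 := by omega
    obtain ⟨r, rfl⟩ := hB.exists_ρ_eq hb
    exact ⟨r ⊗ₜ z, mapRU_tmul _ _ _⟩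
  have hΨ : ∀ t : W.toSubmodule,
      F (TensAlg.ofTens I M t) = mapRU U ρ (l (F (TensAlg.ofTens I M t))) := by
    intro t
    obtain ⟨y, hy⟩ := hF t
    have h1 : l (mapRU U ρ y) = y := LinearMap.congr_fun hl y
    rw [← hy, h1]
  refine ⟨l ∘ₗ F.toLinearMap ∘ₗ TensAlg.ofTens I M ∘ₗ W.toSubmodule.subtype,
    fun r t => ⟨hinj ?_, hinj ?_⟩, hΨ⟩
  · rw [mapRU_left]
    refine (hΨ (W.lMap r t)).symm.trans ?_
    rw [Relations.coe_lMap, TensAlg.ofTens_tensL, map_mul]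
    exact congrArg₂ _ (AlgHom.congr_fun hR r) (hΨ t)
  · rw [mapRU_right]
    refine (hΨ (W.rMap r t)).symm.trans ?_
    rw [Relations.coe_rMap, TensAlg.ofTens_tensR, map_mul]
    exact congrArg₂ _ (hΨ t) (AlgHom.congr_fun hR r)

/-- A flat graded deformation is isomorphic to `Ã_Ψ`. -/
theorem bijective_liftSym {F : TensAlg I M →ₐ[ℂ] B} (hR : F.comp (TensAlg.ofR I M) = ρ)
    (hM : ∀ m, F (TensAlg.ofM I M m) ∈ gr 1) (hπ : π.comp F = QuadAlg.mk W)
    {Ψ : W.toSubmodule →ₗ[ℂ] (I → ℂ) ⊗[ℂ] U} (h : ∀ t : W.toSubmodule,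
      F (TensAlg.ofTens I M t) = mapRU U (F.comp (TensAlg.ofR I M)) (Ψ t)) :
    Function.Bijective (Deform.liftSym F h) := by
  set f := Deform.liftSym F h with hf
  have hfπ : ∀ b, π (f b) = Deform.π Ψ b := by
    have : (π.comp (f.restrictScalars ℂ)) = Deform.π Ψ := by
      refine Deform.hom_ext (fun z => ?_) (fun r => ?_) (fun m => ?_)
      · rw [Deform.π_ofU, Deform.ofU_eq, AlgHom.comp_apply]
        exact (congrArg π (f.commutes _)).trans (hB.π_ι z)
      · rw [← Deform.mk_inc_ofR, Deform.π_mk_inc, AlgHom.comp_apply]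
        exact (congrArg π (Deform.liftSym_mk_inc F h _)).trans (AlgHom.congr_fun hπ _)
      · rw [← Deform.mk_inc_ofM, Deform.π_mk_inc, AlgHom.comp_apply]
        exact (congrArg π (Deform.liftSym_mk_inc F h _)).trans (AlgHom.congr_fun hπ _)
    exact AlgHom.congr_fun this
  have hC := Deform.isGradedDeformation Ψ
  have htop : ⨆ n, homog (Deform.deg Ψ) n = ⊤ := by
    rw [← Deform.iSup_gr]
    exact iSup_congr fun n => (Deform.gr_eq Ψ n).symm
  have hsurj : Function.Surjective f := by
    -- Modulo the image of `T_R(M)`, an element of degree `n` lies in `ker π`, hence is a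
    -- combination of elements of `U` times elements of degree `n - 2`.
    have key : ∀ n, ∀ b ∈ gr n, b ∈ LinearMap.range f.toLinearMap := by
      intro n
      induction n using Nat.strong_induction_on with
      | _ n ih =>
        intro b hb
        have h1 := hB.π_mem _ _ hb
        rw [QuadAlg.gr_eq] at h1
        obtain ⟨t, ht, h2⟩ := QuadAlg.exists_homog_lift W h1
        have h3 := hB.mem_span_of_π_eq_zero (sub_mem hb (hB.tensAlg_hom_mem hR hM ht))
          (by rw [map_sub, ← h2, sub_eq_zero]; exact (AlgHom.congr_fun hπ t).symm)
        have h4 : b - F t ∈ (LinearMap.range f.toLinearMap).restrictScalars ℂ := by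
          refine (Submodule.span_le.2 ?_) h3
          rintro _ ⟨z, k, b', hk, hb', rfl⟩
          exact Submodule.smul_mem _ _ (ih k (by omega) b' hb')
        rw [← sub_add_cancel b (F t)]
        exact add_mem h4 ⟨_, Deform.liftSym_mk_inc F h t⟩
    intro b
    have hb : b ∈ ⨆ n, gr n := hB.iSup_eq_top ▸ Submodule.mem_top
    have h1 : ⨆ n, gr n ≤ (LinearMap.range f.toLinearMap).restrictScalars ℂ :=
      iSup_le fun n b hb => key n b hb
    exact h1 hb
  refine ⟨?_, hsurj⟩
  rw [injective_iff_map_eq_zero]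
  -- The kernel `K` of `f` satisfies `K = U K`: the vanishing of `Tor` for the flat module `B`, in
  -- equational form.
  have key : ∀ c, f c = 0 → ∃ (s : Finset (U × Deform Ψ)) (c' : s → Deform Ψ),
      (∀ i, f (c' i) = 0) ∧ c = ∑ i : s, SymmetricAlgebra.ι ℂ U i.1.1 • c' i := by
    intro c hc
    obtain ⟨y, rfl⟩ := hC.mem_range_smulU (by rw [← hfπ, hc, map_zero] : Deform.π Ψ c = 0)
    obtain ⟨s, rfl⟩ := TensorProduct.exists_finset y
    have h1 : smulU U (Deform Ψ) (∑ i ∈ s, i.1 ⊗ₜ i.2) =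
        ∑ i : s, SymmetricAlgebra.ι ℂ U i.1.1 • i.1.2 := by
      rw [map_sum, ← Finset.sum_coe_sort]
      rfl
    have h2 : ∑ i : s, SymmetricAlgebra.ι ℂ U i.1.1 • f i.1.2 = 0 := by
      rw [h1, map_sum] at hc
      exact (Finset.sum_congr rfl fun i _ => (map_smul f _ _).symm).trans hc
    have h3 := Module.Flat.isTrivialRelation_of_sum_smul_eq_zero (R := SymmetricAlgebra ℂ U)
      (M := B) (f := fun i : s => SymmetricAlgebra.ι ℂ U i.1.1) (x := fun i => f i.1.2)
    obtain ⟨k, a, y, h4, h5⟩ := h3 h2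
    choose y' hy' using fun j => hsurj (y j)
    -- The relation between the images is trivial by flatness. Subtracting lifts of its witnesses
    -- leaves `c` unchanged and moves the coefficients into the kernel.
    refine ⟨s, fun i => i.1.2 - ∑ j, a i j • y' j, fun i => ?_, ?_⟩
    · have h6 : f (∑ j, a i j • y' j) = ∑ j, a i j • y j := by
        rw [map_sum]
        exact Finset.sum_congr rfl fun j _ => by rw [map_smul f, hy']
      rw [map_sub, h6, ← h4, sub_self]
    · have h6 : ∑ i : s, SymmetricAlgebra.ι ℂ U i.1.1 • ∑ j, a i j • y' j = 0 := by
        simp only [Finset.smul_sum, smul_smul]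
        rw [Finset.sum_comm]
        refine Finset.sum_eq_zero fun j _ => ?_
        rw [← Finset.sum_smul, h5 j, zero_smul]
      simp only [smul_sub, Finset.sum_sub_distrib, h6, sub_zero, h1]
  -- From `K = U K` with `U` in degree two, a component of degree `n` of a kernel element involves
  -- components of degree `n - 2` of kernel elements, so all of them vanish.
  have h0 : ∀ n c, f c = 0 → comp (Deform.deg Ψ) n c = 0 := by
    intro n
    induction n using Nat.strong_induction_on with
    | _ n ih =>
      intro c hc
      obtain ⟨s, c', hc', rfl⟩ := key c hc
      rw [map_sum]
      refine Finset.sum_eq_zero fun i _ => ?_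
      rw [Algebra.smul_def, ← Deform.ofU_eq]
      by_cases hn : n < 2
      · exact comp_mul_left_of_lt (Deform.ofU_mem Ψ _) _ hn
      · obtain ⟨n, rfl⟩ := Nat.exists_eq_add_of_le (not_lt.1 hn)
        rw [comp_mul_left (Deform.ofU_mem Ψ _), ih n (by omega) _ (hc' i), mul_zero]
  exact fun c hc => eq_zero_of_comp htop fun n => h0 n c hc

end

end IsGradedDeformation

end FlatDeformation

end QuadKoszul

end

noncomputable section

namespace QuadKoszul

universe u v w x

/-! ### The universal deformation -/

section Universal

variable {I : Type u} [Fintype I] [DecidableEq I]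
variable {M : Type v} [AddCommGroup M] [Module ℂ M] [Module (I → ℂ) M] [Module (I → ℂ)ᵐᵒᵖ M]
  [SMulCommClass (I → ℂ) (I → ℂ)ᵐᵒᵖ M] [IsScalarTower ℂ (I → ℂ) M]
  [IsScalarTower ℂ (I → ℂ)ᵐᵒᵖ M] [FiniteDimensional ℂ M]
variable {W : Relations I M}
variable {U : Type*} [AddCommGroup U] [Module ℂ U]
variable {V : Type*} [AddCommGroup V] [Module ℂ V]
variable {B : Type*} [Ring B] [Algebra ℂ B] [Algebra (SymmetricAlgebra ℂ U) B]
  [IsScalarTower ℂ (SymmetricAlgebra ℂ U) B]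
variable {gr : ℕ → Submodule ℂ B} {ρ : (I → ℂ) →ₐ[ℂ] B} {π : B →ₐ[ℂ] QuadAlg W}
variable {Ω : W.toSubmodule →ₗ[ℂ] (I → ℂ) ⊗[ℂ] V} {ψ : V →ₗ[ℂ] U}

theorem isScalarTower_symMap (ψ : V →ₗ[ℂ] U) :
    letI : Algebra (SymmetricAlgebra ℂ V) (SymmetricAlgebra ℂ U) := (symMap ψ).toRingHom.toAlgebra
    IsScalarTower ℂ (SymmetricAlgebra ℂ V) (SymmetricAlgebra ℂ U) :=
  letI : Algebra (SymmetricAlgebra ℂ V) (SymmetricAlgebra ℂ U) := (symMap ψ).toRingHom.toAlgebra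
  IsScalarTower.of_algebraMap_eq fun c => ((symMap ψ).commutes c).symm

/-- An algebra isomorphic to the deformation defined by `Ω` followed by `ψ` is a base change. -/
theorem isBaseChange_of_algEquiv (hB : IsGradedDeformation W U B gr ρ π)
    (f : Deform (pushRU Ω ψ) ≃ₐ[SymmetricAlgebra ℂ U] B)
    (hR : ∀ r, f (Deform.ofR (pushRU Ω ψ) r) = ρ r)
    (hM : ∀ m, f (Deform.ofM (pushRU Ω ψ) m) ∈ gr 1)
    (hπ : ∀ t, π (f (Deform.mk (pushRU Ω ψ) (inc I M U t))) = QuadAlg.mk W t) :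
    IsBaseChange W ψ (Deform.gr Ω) (Deform.ofR Ω) (Deform.π Ω) gr ρ π := by
  let _ : Algebra (SymmetricAlgebra ℂ V) (SymmetricAlgebra ℂ U) :=
    (symMap ψ).toRingHom.toAlgebra
  have := isScalarTower_symMap ψ
  obtain ⟨θ, hθ⟩ := exists_baseChange_equiv (ψ := ψ) Ω fun _ => rfl
  let h : Deform Ω →ₐ[ℂ] B := ((θ.trans f).toAlgHom.restrictScalars ℂ).comp
    ((Algebra.TensorProduct.includeRight (R := SymmetricAlgebra ℂ V)
      (A := SymmetricAlgebra ℂ U) (B := Deform Ω)).restrictScalars ℂ)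
  have hh : ∀ x, h x = f (θ (1 ⊗ₜ x)) := fun _ => rfl
  have hT : ∀ t, h (Deform.mk Ω (inc I M V t)) = f (Deform.mk (pushRU Ω ψ) (inc I M U t)) :=
    fun t => by rw [hh, hθ]
  have hU : ∀ z, h (Deform.ofU Ω z) =
      algebraMap (SymmetricAlgebra ℂ U) B (SymmetricAlgebra.ι ℂ U (ψ z)) := by
    intro z
    rw [hh, Deform.ofU_eq, Algebra.algebraMap_eq_smul_one, ← TensorProduct.smul_tmul,
      ι_smul_eq (ψ := ψ) fun _ => rfl, ← TensorProduct.smul_tmul', map_smul θ, map_smul f,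
      ← Algebra.TensorProduct.one_def, map_one, map_one, Algebra.algebraMap_eq_smul_one]
  refine ⟨θ.trans f, fun n x hx => ?_, fun r => ?_, fun x => ?_⟩
  · exact Deform.map_mem (f := h) hB.one_mem hB.mul_mem (fun z => hU z ▸ hB.j_mem _)
      (fun r => ((hT _).trans (hR r)) ▸ hB.ρ_mem r) (fun m => (hT (TensAlg.ofM I M m)) ▸ hM m) hx
  · exact (hT _).trans (hR r)
  · refine AlgHom.congr_fun (φ₁ := π.comp h) (Deform.hom_ext (fun z => ?_) (fun r => ?_)
      (fun m => ?_)) x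
    · rw [AlgHom.comp_apply, hU, hB.π_ι, Deform.π_ofU]
    · rw [← Deform.mk_inc_ofR, Deform.π_mk_inc, AlgHom.comp_apply, hT, hπ]
    · rw [← Deform.mk_inc_ofM, Deform.π_mk_inc, AlgHom.comp_apply, hT, hπ]

theorem isBaseChange_pushRU (Ω : W.toSubmodule →ₗ[ℂ] (I → ℂ) ⊗[ℂ] V) (ψ : V →ₗ[ℂ] U) :
    IsBaseChange W ψ (Deform.gr Ω) (Deform.ofR Ω) (Deform.π Ω) (Deform.gr (pushRU Ω ψ))
      (Deform.ofR (pushRU Ω ψ)) (Deform.π (pushRU Ω ψ)) :=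
  isBaseChange_of_algEquiv (Deform.isGradedDeformation _) AlgEquiv.refl (fun _ => rfl)
    (fun m => by
      rw [Deform.gr_eq]
      exact Deform.ofM_mem _ m) (fun t => Deform.π_mk_inc _ t)

/-- If `B` is a base change of `Ã_Ω` then the relations of `B` come from those of `Ã_Ω`. -/
theorem ofTens_eq_of_isBaseChange (hB : IsGradedDeformation W U B gr ρ π)
    {F : TensAlg I M →ₐ[ℂ] B} (hR : F.comp (TensAlg.ofR I M) = ρ)
    (hM : ∀ m, F (TensAlg.ofM I M m) ∈ gr 1) (hπ : π.comp F = QuadAlg.mk W)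
    (hψ : IsBaseChange W ψ (Deform.gr Ω) (Deform.ofR Ω) (Deform.π Ω) gr ρ π)
    (t : W.toSubmodule) : F (TensAlg.ofTens I M t) = mapRU U ρ (pushRU Ω ψ t) := by
  let _ : Algebra (SymmetricAlgebra ℂ V) (SymmetricAlgebra ℂ U) :=
    (symMap ψ).toRingHom.toAlgebra
  have := isScalarTower_symMap ψ
  obtain ⟨θ, h1, h2, h3⟩ := hψ
  let h : Deform Ω →ₐ[ℂ] B := (θ.toAlgHom.restrictScalars ℂ).comp
    ((Algebra.TensorProduct.includeRight (R := SymmetricAlgebra ℂ V)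
      (A := SymmetricAlgebra ℂ U) (B := Deform Ω)).restrictScalars ℂ)
  have hh : ∀ x, h x = θ (1 ⊗ₜ x) := fun _ => rfl
  -- The map from `T_R(M)` to `B` is unique, so it factors through any isomorphism exhibiting `B` as
  -- a base change; the relations of `B` can then be read off from `Ω`.
  have hF : F = h.comp ((Deform.mk Ω).comp (inc I M V)) := by
    refine hB.tensAlg_hom_unique (hR.trans (AlgHom.ext fun r => (h2 r).symm)) hM (fun m => ?_) ?_
    · exact h1 1 _ (by rw [Deform.gr_eq]; exact Deform.ofM_mem Ω m)
    · rw [hπ]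
      refine AlgHom.ext fun t => ?_
      exact ((h3 _).trans (Deform.π_mk_inc Ω t)).symm
  have hF' : F (TensAlg.ofTens I M t) = h (Deform.mk Ω (inc I M V (TensAlg.ofTens I M t))) :=
    AlgHom.congr_fun hF _
  rw [hF', Deform.mk_ofTens, Deform.mk_ofRU, pushRU, LinearMap.comp_apply]
  induction Ω t using TensorProduct.induction_on with
  | zero => simp
  | add p q hp hq => simp only [map_add, hp, hq]
  | tmul r z =>
    rw [mapRU_tmul, LinearMap.lTensor_tmul, mapRU_tmul, hh, ← TensorProduct.smul_tmul,
      ι_smul_eq (ψ := ψ) fun _ => rfl, ← TensorProduct.smul_tmul', map_smul θ, h2]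

variable (W) in
/-- The bimodule map `W → R ⊗ Z(A^!)_2^*` that defines the universal deformation. -/
def univMap : W.toSubmodule →ₗ[ℂ] (I → ℂ) ⊗[ℂ] Module.Dual ℂ (centerTwo W) :=
  ofCirc (toCenterDual W)

theorem isBimoduleMap_univMap : IsBimoduleMap W (univMap W) :=
  isBimoduleMap_ofCirc toCenterDual_lMap

theorem circ_univMap : circ (univMap W) = toCenterDual W := circ_ofCirc _

theorem circ_pushRU_univMap (ψ : Module.Dual ℂ (centerTwo W) →ₗ[ℂ] U) :
    circ (pushRU (univMap W) ψ) = ψ ∘ₗ toCenterDual W := by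
  rw [circ_pushRU, circ_univMap]

/-- Every flat graded deformation is a base change of the universal one in exactly one way. -/
theorem existsUnique_isBaseChange [Module.Flat (SymmetricAlgebra ℂ U) B]
    (hB : IsGradedDeformation W U B gr ρ π) :
    ∃! ψ : Module.Dual ℂ (centerTwo W) →ₗ[ℂ] U, IsBaseChange W ψ (Deform.gr (univMap W))
      (Deform.ofR (univMap W)) (Deform.π (univMap W)) gr ρ π := by
  obtain ⟨F, hR, hM, hπ⟩ := hB.exists_tensAlg_hom
  obtain ⟨Ψ, hΨ, hF⟩ := hB.exists_bimoduleMap hR hM hπ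
  rw [← hR] at hF
  let f := AlgEquiv.ofBijective (Deform.liftSym F hF) (hB.bijective_liftSym hR hM hπ hF)
  have hf : ∀ t, f (Deform.mk Ψ (inc I M U t)) = F t := Deform.liftSym_mk_inc F hF
  -- Flatness is carried back from `B` to `Ã_Ψ`, and its easy direction gives the factorization of
  -- `Ψ°` through `q` without Koszulness.
  have hflat : Module.Flat (SymmetricAlgebra ℂ U) (Deform Ψ) :=
    Module.Flat.of_linearEquiv f.toLinearEquiv
  obtain ⟨ψ, hψ⟩ := (isPBW_iff hΨ).1 (isPBW_of_flat Ψ)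
  obtain rfl : Ψ = pushRU (univMap W) ψ := by
    rw [eq_ofCirc hΨ, hψ, ← circ_pushRU_univMap,
      ← eq_ofCirc (isBimoduleMap_pushRU ψ isBimoduleMap_univMap)]
  refine ⟨ψ, isBaseChange_of_algEquiv hB f (fun r => (hf _).trans (AlgHom.congr_fun hR r))
    (fun m => (hf (TensAlg.ofM I M m)) ▸ hM m)
    (fun t => (congrArg π (hf t)).trans (AlgHom.congr_fun hπ t)), fun ψ' hψ' => ?_⟩
  -- Both bimodule maps describe the image of `W` in `B`, and `R ⊗ U` embeds in `B`; surjectivity of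
  -- `q` then separates `ψ` and `ψ'`.
  have h1 : pushRU (univMap W) ψ' = pushRU (univMap W) ψ := by
    refine LinearMap.ext fun t => hB.mapRU_injective ?_
    rw [← ofTens_eq_of_isBaseChange hB hR hM hπ hψ', hF, hR]
  have h2 := congrArg circ h1
  rw [circ_pushRU_univMap, circ_pushRU_univMap] at h2
  exact (LinearMap.cancel_right toCenterDual_surjective).1 h2

end Universal

end QuadKoszul

end

theorem mainTheorem4 {I : Type*} [Fintype I] [DecidableEq I]
    {M : Type*} [AddCommGroup M] [Module ℂ M] [Module (I → ℂ) M] [Module (I → ℂ)ᵐᵒᵖ M]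
    [SMulCommClass (I → ℂ) (I → ℂ)ᵐᵒᵖ M] [IsScalarTower ℂ (I → ℂ) M]
    [IsScalarTower ℂ (I → ℂ)ᵐᵒᵖ M] [FiniteDimensional ℂ M]
    (W : QuadKoszul.Relations I M) (hA : QuadKoszul.IsKoszul W) :
    -- the criterion for flatness of the graded deformation `Ã_Ψ`
    (∀ (U : Type*) [AddCommGroup U] [Module ℂ U] [FiniteDimensional ℂ U]
        (Ψ : W.toSubmodule →ₗ[ℂ] TensorProduct ℂ (I → ℂ) U),
        QuadKoszul.IsBimoduleMap W Ψ →
          QuadKoszul.IsGradedDeformation W U (QuadKoszul.Deform Ψ) (QuadKoszul.Deform.gr Ψ)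
              (QuadKoszul.Deform.ofR Ψ) (QuadKoszul.Deform.π Ψ) ∧
            (Module.Flat (SymmetricAlgebra ℂ U) (QuadKoszul.Deform Ψ) ↔
              ∃ ψ : Module.Dual ℂ (QuadKoszul.centerTwo W) →ₗ[ℂ] U,
                QuadKoszul.circ Ψ = ψ ∘ₗ QuadKoszul.toCenterDual W)) ∧
    -- the universal graded flat deformation `Ã = Ã_Ω`, over `Sym Z(A^!)_2^*`
    ∃ Ω : W.toSubmodule →ₗ[ℂ]
        TensorProduct ℂ (I → ℂ) (Module.Dual ℂ (QuadKoszul.centerTwo W)),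
      QuadKoszul.IsBimoduleMap W Ω ∧
      QuadKoszul.circ Ω = QuadKoszul.toCenterDual W ∧
      QuadKoszul.IsGradedDeformation W (Module.Dual ℂ (QuadKoszul.centerTwo W))
        (QuadKoszul.Deform Ω) (QuadKoszul.Deform.gr Ω) (QuadKoszul.Deform.ofR Ω)
        (QuadKoszul.Deform.π Ω) ∧
      Module.Flat (SymmetricAlgebra ℂ (Module.Dual ℂ (QuadKoszul.centerTwo W)))
        (QuadKoszul.Deform Ω) ∧
      ∀ (U : Type*) [AddCommGroup U] [Module ℂ U] [FiniteDimensional ℂ U],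
        -- every base change of `Ã` is a graded flat deformation
        (∀ ψ : Module.Dual ℂ (QuadKoszul.centerTwo W) →ₗ[ℂ] U,
          ∃ Ψ : W.toSubmodule →ₗ[ℂ] TensorProduct ℂ (I → ℂ) U,
            QuadKoszul.IsBimoduleMap W Ψ ∧
            QuadKoszul.circ Ψ = ψ ∘ₗ QuadKoszul.toCenterDual W ∧
            Module.Flat (SymmetricAlgebra ℂ U) (QuadKoszul.Deform Ψ) ∧
            QuadKoszul.IsBaseChange W ψ (QuadKoszul.Deform.gr Ω) (QuadKoszul.Deform.ofR Ω)
              (QuadKoszul.Deform.π Ω) (QuadKoszul.Deform.gr Ψ) (QuadKoszul.Deform.ofR Ψ)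
              (QuadKoszul.Deform.π Ψ)) ∧
        -- every graded flat deformation is a base change of `Ã` in exactly one way
        (∀ (B : Type*) [Ring B] [Algebra ℂ B] [Algebra (SymmetricAlgebra ℂ U) B]
          [IsScalarTower ℂ (SymmetricAlgebra ℂ U) B] (gr : ℕ → Submodule ℂ B)
          (ρ : (I → ℂ) →ₐ[ℂ] B) (π : B →ₐ[ℂ] QuadKoszul.QuadAlg W),
          QuadKoszul.IsGradedDeformation W U B gr ρ π →
          Module.Flat (SymmetricAlgebra ℂ U) B →
            ∃! ψ : Module.Dual ℂ (QuadKoszul.centerTwo W) →ₗ[ℂ] U,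
              QuadKoszul.IsBaseChange W ψ (QuadKoszul.Deform.gr Ω) (QuadKoszul.Deform.ofR Ω)
                (QuadKoszul.Deform.π Ω) gr ρ π) := by
  refine ⟨fun U _ _ _ Ψ hΨ => ⟨QuadKoszul.Deform.isGradedDeformation Ψ,
      QuadKoszul.flat_iff hA hΨ⟩, QuadKoszul.univMap W, QuadKoszul.isBimoduleMap_univMap,
    QuadKoszul.circ_univMap, QuadKoszul.Deform.isGradedDeformation _,
    (QuadKoszul.flat_iff hA QuadKoszul.isBimoduleMap_univMap).2 ⟨LinearMap.id, ?_⟩,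
    fun U _ _ _ => ⟨fun ψ => ?_, fun B _ _ _ _ gr ρ π hB hflat =>
      QuadKoszul.existsUnique_isBaseChange hB⟩⟩
  · rw [QuadKoszul.circ_univMap, LinearMap.id_comp]
  · have h := QuadKoszul.isBimoduleMap_pushRU ψ (QuadKoszul.isBimoduleMap_univMap (W := W))
    exact ⟨_, h, QuadKoszul.circ_pushRU_univMap ψ,
      (QuadKoszul.flat_iff hA h).2 ⟨ψ, QuadKoszul.circ_pushRU_univMap ψ⟩,
      QuadKoszul.isBaseChange_pushRU _ ψ⟩
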